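/- Let $k$ be an algebraically closed field, let $Q$ be a finite quiver without oriented cycles, and let $\operatorname{rep} Q$ be the category of finite dimensional (left) modules over the path algebra $kQ$. For a module $T$, let $\operatorname{add} T$ be the full subcategory of direct summands of finite direct sums $T^n$, and let $\operatorname{Gen} T$ be the full subcategory of quotients of objects of $\operatorname{add} T$. A torsion class in $\operatorname{rep} Q$ is a full subcategory $\mathcal T$ containing $0$ and closed under quotients and extensions; it is finitely generated if there are finitely many indecomposable objects $X_1,\dots,X_n$ of $\mathcal T$ such that $\mathcal T\subseteq\operatorname{Gen}(X_1\oplus\dots\oplus X_n)$. An object $P$ of $\mathcal T$ is $\operatorname{Ext}$-projective in $\mathcal T$ if $\operatorname{Ext}^1(P,I)=0$ for all $I$ in $\mathcal T$. A module over a ring $A$ is called tilting if $\operatorname{Ext}^1_A(C,C)=0$, $\operatorname{pd}_A C\le 1$, and there is a short exact sequence $0\to A\to C'\to C''\to 0$ with $C',C''\in\operatorname{add} C$. An object $C$ of $\operatorname{rep} Q$ is partial tilting if $\operatorname{Ext}^1(C,C)=0$ and $\operatorname{pd} C\le 1$, and it is support tilting if it is partial tilting and is tilting as a module over $kQ/\operatorname{ann}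 C$. A module is basic if it is a finite direct sum of pairwise non-isomorphic indecomposable modules. Theorem. (a) A partial tilting object $C$ of $\operatorname{rep} Q$ is support tilting if and only if the number of isomorphism classes of indecomposable direct summands of $C$ equals the number of isomorphism classes of simple modules in the support of $C$, that is, of simple modules occurring as subquotients (equivalently, as composition factors) of $C$. (b) There is a bijection between the finitely generated torsion classes in $\operatorname{rep} Q$ and the isomorphism classes of basic support tilting objects of $\operatorname{rep} Q$. It sends a torsion class $\mathcal T$ to the direct sum of all indecomposable $\operatorname{Ext}$-projectives of $\mathcal T$, one from each isomorphism class (there are only finitely many classes), and its inverse sends $C$ to $\operatorname{Gen} C$. -/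

import Mathlib

open CategoryTheory CategoryTheory.Limits

universe u v w t

noncomputable section

/-! ### Path algebras -/

/-- A path of the quiver `V`, with its source and its target. -/
structure QuiverPath (V : Type u) [Quiver.{v} V] : Type (max u v) where
  /-- the source -/
  src : V
  /-- the target -/
  tgt : V
  /-- the path itself -/
  path : Quiver.Path src tgt

/-- The trivial path at the vertex `x`. -/
def QuiverPath.triv {V : Type u} [Quiver.{v} V] (x : V) : QuiverPath V := ⟨x, x, Quiver.Path.nil⟩

/-- The path algebra `kQ` of a quiver `Q` with vertex set `V`: it has the paths of `Q` as a
`k`-basis. -/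
def PathAlgebra (k : Type w) [Field k] (V : Type u) [Quiver.{v} V] : Type (max u v w) :=
  QuiverPath V →₀ k

namespace PathAlgebra

variable {k : Type w} [Field k] {V : Type u} [Quiver.{v} V]

instance : AddCommGroup (PathAlgebra k V) := inferInstanceAs (AddCommGroup (QuiverPath V →₀ k))

instance : Module k (PathAlgebra k V) := inferInstanceAs (Module k (QuiverPath V →₀ k))

/-- The basis of the path algebra given by the paths. -/
def pathBasis : Module.Basis (QuiverPath V) k (PathAlgebra k V) :=
  Module.Basis.ofRepr (LinearEquiv.refl k (QuiverPath V →₀ k))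

/-- The basis element of the path algebra given by a path. -/
def ofPath (p : QuiverPath V) : PathAlgebra k V := pathBasis p

open Classical in
/-- The product of two paths: `p * q` is the path `q` followed by the path `p`
if `q` ends where `p` starts, and `0` otherwise.  (With this convention, left modules over the path
algebra are covariant representations of the quiver.) -/
def pathMul (p q : QuiverPath V) : PathAlgebra k V :=
  if h : q.tgt = p.src then ofPath ⟨q.src, p.tgt, q.path.comp (p.path.cast h.symm rfl)⟩ else 0

/-- The bilinear extension of the product of paths. -/
def mulBilin : PathAlgebra k V →ₗ[k] PathAlgebra k V →ₗ[k] PathAlgebra k V :=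
  pathBasis.constr k fun p => pathBasis.constr k fun q => pathMul p q

instance : Mul (PathAlgebra k V) := ⟨fun a b => mulBilin a b⟩

instance [Fintype V] : One (PathAlgebra k V) := ⟨∑ x : V, ofPath (QuiverPath.triv x)⟩

theorem mul_eq (a b : PathAlgebra k V) : a * b = mulBilin a b := rfl

theorem one_eq [Fintype V] :
    (1 : PathAlgebra k V) = ∑ x : V, ofPath (QuiverPath.triv x) := rfl

theorem mulBilin_ofPath (p q : QuiverPath V) :
    mulBilin (ofPath p : PathAlgebra k V) (ofPath q) = pathMul p q := by
  rw [mulBilin, ofPath, Module.Basis.constr_basis, ofPath, Module.Basis.constr_basis]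

theorem pathMul_assoc (p q r : QuiverPath V) :
    mulBilin (pathMul p q : PathAlgebra k V) (ofPath r) = mulBilin (ofPath p) (pathMul q r) := by
  obtain ⟨a, b, p⟩ := p
  obtain ⟨c, d, q⟩ := q
  obtain ⟨e, f, r⟩ := r
  by_cases h1 : d = a
  · subst h1
    by_cases h2 : f = c
    · subst h2
      simp [pathMul, mulBilin_ofPath]
    · simp [pathMul, mulBilin_ofPath, h2]
  · by_cases h2 : f = c
    · subst h2
      simp [pathMul, mulBilin_ofPath, h1]
    · simp [pathMul, h1, h2]

theorem triv_mul (q : QuiverPath V) :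
    ∀ x : V, x ≠ q.tgt → (pathMul (QuiverPath.triv x) q : PathAlgebra k V) = 0 := by
  intro x hx
  simp [pathMul, QuiverPath.triv, Ne.symm hx]

theorem mul_triv (q : QuiverPath V) :
    ∀ x : V, x ≠ q.src → (pathMul q (QuiverPath.triv x) : PathAlgebra k V) = 0 := by
  intro x hx
  simp [pathMul, QuiverPath.triv, hx]

theorem induction_on {P : PathAlgebra k V → Prop} (a : PathAlgebra k V)
    (hadd : ∀ a b, P a → P b → P (a + b)) (h0 : P 0)
    (hs : ∀ (c : k) (p : QuiverPath V), P (c • ofPath p)) : P a := by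
  rw [← pathBasis.linearCombination_repr a, Finsupp.linearCombination_apply, Finsupp.sum]
  exact Finset.sum_induction _ P hadd h0 fun p _ => hs _ p

theorem mulBilin_assoc (a b c : PathAlgebra k V) :
    mulBilin (mulBilin a b) c = mulBilin a (mulBilin b c) := by
  induction a using induction_on with
  | h0 => simp
  | hadd x y hx hy => simp only [map_add, LinearMap.add_apply, hx, hy]
  | hs s p =>
    induction b using induction_on with
    | h0 => simp
    | hadd x y hx hy => simp only [map_add, LinearMap.add_apply, hx, hy]
    | hs s' q =>
      induction c using induction_on with
      | h0 => simp
      | hadd x y hx hy => simp only [map_add, hx, hy]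
      | hs s'' r => simp [mulBilin_ofPath, pathMul_assoc]

theorem one_mulBilin [Fintype V] (a : PathAlgebra k V) : mulBilin 1 a = a := by
  have h : mulBilin (1 : PathAlgebra k V) = LinearMap.id := by
    refine pathBasis.ext fun p => ?_
    change mulBilin 1 (ofPath p) = ofPath p
    rw [one_eq, map_sum, LinearMap.sum_apply]
    simp only [mulBilin_ofPath]
    rw [Finset.sum_eq_single p.tgt (fun x _ hx => triv_mul p x hx) (by simp)]
    simp [pathMul, QuiverPath.triv]
  rw [h, LinearMap.id_apply]

theorem mulBilin_one [Fintype V] (a : PathAlgebra k V) : mulBilin a 1 = a := by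
  have h : mulBilin.flip (1 : PathAlgebra k V) = LinearMap.id := by
    refine pathBasis.ext fun p => ?_
    change mulBilin (ofPath p) 1 = ofPath p
    rw [one_eq, map_sum]
    simp only [mulBilin_ofPath]
    rw [Finset.sum_eq_single p.src (fun x _ hx => mul_triv p x hx) (by simp)]
    simp [pathMul, QuiverPath.triv]
  rw [← LinearMap.flip_apply, h, LinearMap.id_apply]

instance [Fintype V] : Ring (PathAlgebra k V) where
  __ := (inferInstance : AddCommGroup (PathAlgebra k V))
  left_distrib a b c := map_add (mulBilin a) b c
  right_distrib a b c := by simp only [mul_eq, map_add, LinearMap.add_apply]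
  zero_mul a := by simp only [mul_eq, map_zero, LinearMap.zero_apply]
  mul_zero a := by simp only [mul_eq, map_zero]
  mul_assoc := mulBilin_assoc
  one_mul := one_mulBilin
  mul_one := mulBilin_one

instance [Fintype V] : Algebra k (PathAlgebra k V) :=
  Algebra.ofModule
    (fun c a b => by rw [mul_eq, mul_eq, map_smul, LinearMap.smul_apply])
    (fun c a b => by rw [mul_eq, mul_eq, map_smul])

end PathAlgebra

/-- A quiver is acyclic if every path from a vertex to itself is trivial. -/
def QuiverAcyclic (V : Type u) [Quiver.{v} V] : Prop :=
  ∀ (x : V) (p : Quiver.Path x x), p = Quiver.Path.nil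

/-! ### Notions in abelian categories -/

section AbelianCategory

attribute [local instance] Abelian.hasFiniteBiproducts

variable {C : Type u} [Category.{v} C] [Abelian C]

/-- `add T`: the finite direct sums of copies of `T` and their direct summands. -/
def addClosure (T : C) : ObjectProperty C :=
  fun X => ∃ n : ℕ, Nonempty (Retract X (⨁ fun _ : Fin n => T))

/-- The quotients of the objects of `P`. -/
def quotientsOf (P : ObjectProperty C) : ObjectProperty C :=
  fun X => ∃ (Y : C) (f : Y ⟶ X), P Y ∧ Epi f

/-- `Gen T`: the quotients of the objects of `add T`. -/
def Gen (T : C) : ObjectProperty C := quotientsOf (addClosure T)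

/-- `P` is generated by a finite set of indecomposable objects of `P`. -/
def IsFinitelyGenerated (P : ObjectProperty C) : Prop :=
  ∃ (n : ℕ) (X : Fin n → C), (∀ i, Indecomposable (X i)) ∧ (∀ i, P (X i)) ∧ P ≤ Gen (⨁ X)

/-- `X` is an `Ext`-projective object of `P`. -/
def IsExtProjective [HasExt.{w} C] (P : ObjectProperty C) (X : C) : Prop :=
  P X ∧ ∀ Y : C, P Y → Subsingleton (Abelian.Ext X Y 1)

/-- `X` is the direct sum of all objects with the property `P`, one for each isomorphism class
(in particular there are only finitely many isomorphism classes). -/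
def IsSumOfRepresentatives (P : ObjectProperty C) (X : C) : Prop :=
  ∃ (n : ℕ) (Y : Fin n → C), (∀ i, P (Y i)) ∧
    (∀ i j, Nonempty (Y i ≅ Y j) → i = j) ∧
    (∀ Z : C, P Z → ∃ i, Nonempty (Z ≅ Y i)) ∧
    Nonempty (X ≅ ⨁ Y)

/-- `X` is the sum of all indecomposable `Ext`-projectives of `P`, one for each isomorphism
class. -/
def IsSumOfExtProjectives [HasExt.{w} C] (P : ObjectProperty C) (X : C) : Prop :=
  IsSumOfRepresentatives (fun Y => Indecomposable Y ∧ IsExtProjective P Y) X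

/-- `X` is basic: a finite direct sum of pairwise non-isomorphic indecomposable objects. -/
def IsBasic (X : C) : Prop :=
  ∃ (n : ℕ) (Y : Fin n → C), (∀ i, Indecomposable (Y i)) ∧
    (∀ i j, Nonempty (Y i ≅ Y j) → i = j) ∧ Nonempty (X ≅ ⨁ Y)

/-- `X` is rigid of projective dimension at most one. -/
def IsRigidOfPdLEOne [HasExt.{w} C] (X : C) : Prop :=
  Subsingleton (Abelian.Ext X X 1) ∧ HasProjectiveDimensionLE X 1

/-- The isomorphism classes of indecomposable direct summands of `X`. -/
def indecomposableSummands (X : C) : Set (Quotient (isIsomorphicSetoid C)) :=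
  {q | ∃ Y : C, Indecomposable Y ∧ Nonempty (Retract Y X) ∧ q = Quotient.mk _ Y}

/-- The support of `X`: the isomorphism classes of simple objects that occur as a subquotient
(equivalently, for `X` of finite length, as a composition factor) of `X`. -/
def simpleSupport (X : C) : Set (Quotient (isIsomorphicSetoid C)) :=
  {q | ∃ S : C, Simple S ∧ (∃ (Y : C) (i : Y ⟶ X) (p : Y ⟶ S), Mono i ∧ Epi p) ∧
    q = Quotient.mk _ S}

end AbelianCategory

/-! ### Tilting modules -/

/-- Tilting modules over a ring `R`: `Ext¹(M, M) = 0`, `pd M ≤ 1`, and there is a short exact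
sequence `0 ⟶ R ⟶ M' ⟶ M'' ⟶ 0` with `M'` and `M''` in `add M`. -/
def IsTiltingModule {R : Type t} [Ring R] (M : ModuleCat.{t} R) : Prop :=
  IsRigidOfPdLEOne M ∧
    ∃ S : ShortComplex (ModuleCat.{t} R), S.ShortExact ∧ Nonempty (S.X₁ ≅ ModuleCat.of R R) ∧
      addClosure M S.X₂ ∧ addClosure M S.X₃

/-- `M` as a module over the quotient of `R` by the annihilator of `M`. -/
def overAnnihilatorQuotient {R : Type t} [Ring R] (M : ModuleCat.{t} R) :
    ModuleCat.{t} (R ⧸ Module.annihilator R M) :=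
  letI := Module.quotientAnnihilator (R := R) (M := M)
  ModuleCat.of (R ⧸ Module.annihilator R M) M

/-! ### Representations of quivers -/

section Rep

variable (k : Type w) [Field k] (V : Type u) [Quiver.{v} V] [Fintype V]

/-- All modules over the path algebra `kQ`. -/
abbrev PathAlgebraMod : Type (max u v w + 1) := ModuleCat.{max u v w} (PathAlgebra k V)

/-- The objects of `rep Q`: the modules over `kQ` that are finite dimensional over `k`. -/
def repQ : ObjectProperty (PathAlgebraMod k V) := fun M =>
  letI : Module k M := ModuleCat.moduleOfAlgebraModule M
  Module.Finite k M

variable {k V}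

/-- Torsion classes of `rep Q`: full subcategories of `rep Q` that contain `0` and are closed under
quotients and extensions (and so under isomorphisms and finite direct sums). -/
structure IsTorsionClass (T : ObjectProperty (PathAlgebraMod k V)) : Prop where
  le_repQ : T ≤ repQ k V
  containsZero : T.ContainsZero
  quotients : T.IsClosedUnderQuotients
  extensions : T.IsClosedUnderExtensions

/-- Partial tilting objects of `rep Q`. -/
def IsPartialTilting (M : PathAlgebraMod k V) : Prop :=
  repQ k V M ∧ IsRigidOfPdLEOne M

/-- Support tilting objects of `rep Q`: partial tilting modules `M` that are tilting over
`kQ / ann M`. -/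
def IsSupportTilting (M : PathAlgebraMod k V) : Prop :=
  IsPartialTilting M ∧ IsTiltingModule (overAnnihilatorQuotient M)

variable (k V)

/-- The finitely generated torsion classes of `rep Q`. -/
def FGTorsionClass : Type (max u v w + 1) :=
  {T : ObjectProperty (PathAlgebraMod k V) // IsTorsionClass T ∧ IsFinitelyGenerated T}

/-- The basic support tilting objects of `rep Q`. -/
def BasicSupportTilting : Type (max u v w + 1) :=
  {M : PathAlgebraMod k V // IsSupportTilting M ∧ IsBasic M}

/-- Isomorphism of basic support tilting objects. -/
instance basicSupportTiltingSetoid : Setoid (BasicSupportTilting k V) :=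
  (isIsomorphicSetoid (PathAlgebraMod k V)).comap Subtype.val

end Rep

end

/-!
Write `R = kQ`. Since `Q` has no oriented cycles, `R` is finite dimensional, its simple modules are
the one-dimensional modules at the vertices, and each of them has a projective resolution of length
one (`PathAlgebra.IsSimpleAt.isSES`). So `R` is hereditary (`PathAlgebra.isHereditaryFG`), and the
projective modules `R e_x` read off the multiplicities of the simple modules
(`PathAlgebra.separatesSimples`). All that follows holds for finite dimensional hereditary algebras
with such a family of projective modules.

For a rigid module `M` with annihilator `K`, the ideal `K` is projective and has no nonzero
homomorphisms to `R / K`-modules, hence `Ext¹_R(R / K, N) = 0` for every `R / K`-module `N`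
(`extZero_quotient_annihilator`). So extensions over `R` and over `R / K` agree where it matters,
and `M` is tilting over `R / K` if and only if there is an exact sequence
`0 ⟶ R / K ⟶ A ⟶ C ⟶ 0` of `R`-modules with `A` and `C` in `add M`
(`isTiltingModule_iff_hasTiltingSequence`). In that case `add M` contains all `Ext`-projectives of
`Gen M` (`HasTiltingSequence.isAdd_of_isGenExtProjective`): the kernel `L` of a right approximation
`M^n ⟶ X` satisfies `Ext¹(M, L) = 0`, so a surjection `(R / K)^m ⟶ L` extends to `A^m`, so `L` is in
`Gen M` and the approximation splits. In general `R / K` embeds into a power of `M`, and the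
coresolution `0 ⟶ R / K ⟶ M^m ⟶ C ⟶ 0` by a left approximation has an `Ext`-projective cokernel `C`
(`exists_coresolution_quotient_annihilator`).

For (b), a minimal family of indecomposable generators of a torsion class consists of
`Ext`-projectives, by Nakayama's lemma over local endomorphism rings. If `P` is their sum and `C` the
cokernel above, then `P × C` is support tilting and generates the same class
(`IsFinGenTorsion.exists_supportTilting`). Conversely, if `M` is basic support tilting, then the
indecomposable `Ext`-projectives of `Gen M` are those in `add M`, so that `M` is their sum by the
Krull–Schmidt theorem (`HasTiltingSequence.isSumOfExtProjectives`). Thus `M ↦ Gen M` is a bijection.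

For (a), consider dimension vectors. By the Happel–Ringel lemma, pairwise non-isomorphic
indecomposable modules without extensions admit no cycles of nonzero homomorphisms
(`IsBasicFamily.exists_no_homs`); as `dim Hom(Z, X) - dim Ext¹(Z, X)` is linear in the dimension
vector of `X`, their dimension vectors are linearly independent
(`SeparatesSimples.linearIndependent_dimVector`). So a rigid module has at most as many
indecomposable summands as there are simple modules in its support, and the same bound holds for the
family enlarged by the summands of the cokernel `C`. If equality holds, then `C` contributes nothing
new, and `M` is support tilting (`SeparatesSimples.hasTiltingSequence_iff`). If, on the other hand,
`M` is support tilting, then the dimension vectors of its summands span those of all simple modules in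
the support, because the kernels of the maps from `R / K` to them also have coresolutions in `add M`
(`SeparatesSimples.card_le_of_hasTiltingSequence`).
-/

noncomputable section

/-! ### Short exact sequences of modules and the vanishing of `Ext¹` -/

section AbelianExt

open Abelian

variable {C : Type u} [Category.{v} C] [Abelian C] [HasExt.{w} C] {S : ShortComplex C}

theorem CategoryTheory.ShortComplex.ShortExact.subsingleton_ext_X₃ (hS : S.ShortExact) (X : C)
    {n m : ℕ} (hn : n + 1 = m) (h₂ : Subsingleton (Ext X S.X₂ n))
    (h₁ : Subsingleton (Ext X S.X₁ m)) : Subsingleton (Ext X S.X₃ n) := by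
  refine subsingleton_of_forall_eq 0 fun e => ?_
  obtain ⟨e', rfl⟩ := Ext.covariant_sequence_exact₃ X hS e hn (Subsingleton.elim _ _)
  rw [Subsingleton.elim e' 0, Ext.zero_comp]

theorem CategoryTheory.ShortComplex.ShortExact.subsingleton_ext_X₁_of_lift (hS : S.ShortExact)
    (X : C) (h₂ : Subsingleton (Ext X S.X₂ 1)) (hl : ∀ p : X ⟶ S.X₃, ∃ q, q ≫ S.g = p) :
    Subsingleton (Ext X S.X₁ 1) := by
  refine subsingleton_of_forall_eq 0 fun e => ?_
  obtain ⟨φ, rfl⟩ := Ext.covariant_sequence_exact₁ X hS e (Subsingleton.elim _ _) rfl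
  obtain ⟨φ, rfl⟩ := Ext.homEquiv₀.symm.surjective φ
  obtain ⟨q, rfl⟩ := hl φ
  rw [Ext.homEquiv₀_symm_apply, ← Ext.mk₀_comp_mk₀,
    Ext.comp_assoc (a₂₃ := 1) _ _ _ (by simp) (by simp) (by simp), hS.comp_extClass,
    Ext.comp_zero]

theorem CategoryTheory.ShortComplex.ShortExact.exists_lift (hS : S.ShortExact) {X : C}
    (h₁ : Subsingleton (Ext X S.X₁ 1)) (p : X ⟶ S.X₃) : ∃ q, q ≫ S.g = p := by
  obtain ⟨φ, hφ⟩ := Ext.covariant_sequence_exact₃ X hS (Ext.mk₀ p) (zero_add 1)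
    (Subsingleton.elim _ _)
  obtain ⟨φ, rfl⟩ := Ext.homEquiv₀.symm.surjective φ
  rw [Ext.homEquiv₀_symm_apply, Ext.mk₀_comp_mk₀] at hφ
  exact ⟨φ, Ext.homEquiv₀.symm.injective hφ⟩

theorem CategoryTheory.ShortComplex.ShortExact.subsingleton_ext_from_X₁ (hS : S.ShortExact) (Y : C)
    {n m : ℕ} (hn : 1 + n = m) (h₂ : Subsingleton (Ext S.X₂ Y n))
    (h₃ : Subsingleton (Ext S.X₃ Y m)) : Subsingleton (Ext S.X₁ Y n) := by
  refine subsingleton_of_forall_eq 0 fun e => ?_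
  obtain ⟨e', rfl⟩ := Ext.contravariant_sequence_exact₁ hS Y e hn (Subsingleton.elim _ _)
  rw [Subsingleton.elim e' 0, Ext.comp_zero]

theorem CategoryTheory.ShortComplex.ShortExact.subsingleton_ext_from_X₂ (hS : S.ShortExact) (Y : C)
    {n : ℕ} (h₁ : Subsingleton (Ext S.X₁ Y n))
    (h₃ : Subsingleton (Ext S.X₃ Y n)) : Subsingleton (Ext S.X₂ Y n) := by
  refine subsingleton_of_forall_eq 0 fun e => ?_
  obtain ⟨e', rfl⟩ := Ext.contravariant_sequence_exact₂ hS Y e (Subsingleton.elim _ _)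
  rw [Subsingleton.elim e' 0, Ext.comp_zero]

theorem CategoryTheory.ShortComplex.ShortExact.subsingleton_ext_from_X₃_of_extend
    (hS : S.ShortExact) (Y : C) (h₂ : Subsingleton (Ext S.X₂ Y 1))
    (hl : ∀ p : S.X₁ ⟶ Y, ∃ q, S.f ≫ q = p) : Subsingleton (Ext S.X₃ Y 1) := by
  refine subsingleton_of_forall_eq 0 fun e => ?_
  obtain ⟨φ, rfl⟩ := Ext.contravariant_sequence_exact₃ hS Y e (Subsingleton.elim _ _) (add_zero 1)
  obtain ⟨φ, rfl⟩ := Ext.homEquiv₀.symm.surjective φ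
  obtain ⟨q, rfl⟩ := hl φ
  rw [Ext.homEquiv₀_symm_apply, ← Ext.mk₀_comp_mk₀,
    ← Ext.comp_assoc (a₁₂ := 1) _ _ _ (by simp) (by simp) (by simp), hS.extClass_comp,
    Ext.zero_comp]

theorem CategoryTheory.ShortComplex.ShortExact.exists_extend (hS : S.ShortExact) {Y : C}
    (h₃ : Subsingleton (Ext S.X₃ Y 1)) (p : S.X₁ ⟶ Y) : ∃ q, S.f ≫ q = p := by
  obtain ⟨φ, hφ⟩ := Ext.contravariant_sequence_exact₁ hS Y (Ext.mk₀ p) (add_zero 1)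
    (Subsingleton.elim _ _)
  obtain ⟨φ, rfl⟩ := Ext.homEquiv₀.symm.surjective φ
  rw [Ext.homEquiv₀_symm_apply, Ext.mk₀_comp_mk₀] at hφ
  exact ⟨φ, Ext.homEquiv₀.symm.injective hφ⟩

end AbelianExt

section ExtVanishing

variable {R : Type t} [Ring R]
variable {A B C X Y Z : Type t} [AddCommGroup A] [AddCommGroup B] [AddCommGroup C]
  [AddCommGroup X] [AddCommGroup Y] [AddCommGroup Z]
  [Module R A] [Module R B] [Module R C] [Module R X] [Module R Y] [Module R Z]

/-- `0 ⟶ A ⟶ B ⟶ C ⟶ 0` is a short exact sequence of modules. -/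
structure IsSES (f : A →ₗ[R] B) (g : B →ₗ[R] C) : Prop where
  inj : Function.Injective f
  exact : Function.Exact f g
  surj : Function.Surjective g

theorem IsSES.of_submodule (N : Submodule R B) : IsSES N.subtype N.mkQ :=
  ⟨N.injective_subtype, LinearMap.exact_subtype_mkQ N, N.mkQ_surjective⟩

theorem IsSES.of_surjective {g : B →ₗ[R] C} (hg : Function.Surjective g) :
    IsSES (LinearMap.ker g).subtype g :=
  ⟨Submodule.injective_subtype _, LinearMap.exact_subtype_ker_map g, hg⟩

theorem IsSES.of_injective {f : A →ₗ[R] B} (hf : Function.Injective f) :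
    IsSES f (LinearMap.range f).mkQ :=
  ⟨hf, LinearMap.exact_map_mkQ_range f, Submodule.mkQ_surjective _⟩

theorem IsSES.shortExact {f : A →ₗ[R] B} {g : B →ₗ[R] C} (h : IsSES f g) :
    (ShortComplex.moduleCatMk f g h.exact.linearMap_comp_eq_zero).ShortExact where
  exact := (ShortComplex.ShortExact.moduleCat_exact_iff_function_exact _).2 h.exact
  mono_f := (ModuleCat.mono_iff_injective _).2 h.inj
  epi_g := (ModuleCat.epi_iff_surjective _).2 h.surj

theorem IsSES.of_shortExact {S : ShortComplex (ModuleCat.{t} R)} (hS : S.ShortExact) :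
    IsSES S.f.hom S.g.hom :=
  ⟨hS.moduleCat_injective_f, (ShortComplex.ShortExact.moduleCat_exact_iff_function_exact S).1
    hS.exact, hS.moduleCat_surjective_g⟩

variable (R X Y) in
/-- `Ext¹(X, Y) = 0`. -/
def ExtZero : Prop :=
  Subsingleton (Abelian.Ext (ModuleCat.of R X) (ModuleCat.of R Y) 1)

variable (R X) in
/-- The projective dimension of `X` is at most one. -/
def PdLEOne : Prop := HasProjectiveDimensionLE (ModuleCat.of R X) 1

theorem ExtZero.eq_zero (h : ExtZero R X Y)
    (e : Abelian.Ext (ModuleCat.of R X) (ModuleCat.of R Y) 1) : e = 0 :=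
  have : Subsingleton (Abelian.Ext (ModuleCat.of R X) (ModuleCat.of R Y) 1) := h
  Subsingleton.elim _ _

theorem PdLEOne.subsingleton_ext_two (h : PdLEOne R X) (Y : Type t) [AddCommGroup Y]
    [Module R Y] : Subsingleton (Abelian.Ext (ModuleCat.of R X) (ModuleCat.of R Y) 2) :=
  HasProjectiveDimensionLT.subsingleton (hX := h) _ 2 2 le_rfl _

theorem ExtZero.of_forall
    (h : ∀ e : Abelian.Ext (ModuleCat.of R X) (ModuleCat.of R Y) 1, e = 0) : ExtZero R X Y :=
  ⟨fun a b => (h a).trans (h b).symm⟩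

variable {f : A →ₗ[R] B} {g : B →ₗ[R] C}

theorem IsSES.exists_lift (h : IsSES f g) (hX : ExtZero R X A) (p : X →ₗ[R] C) :
    ∃ q : X →ₗ[R] B, g ∘ₗ q = p := by
  obtain ⟨q, hq⟩ := h.shortExact.exists_lift (X := ModuleCat.of R X) hX (ModuleCat.ofHom p)
  exact ⟨q.hom, congrArg ModuleCat.Hom.hom hq⟩

theorem IsSES.exists_extend (h : IsSES f g) (hY : ExtZero R C Y) (p : A →ₗ[R] Y) :
    ∃ q : B →ₗ[R] Y, q ∘ₗ f = p := by
  obtain ⟨q, hq⟩ := h.shortExact.exists_extend (Y := ModuleCat.of R Y) hY (ModuleCat.ofHom p)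
  exact ⟨q.hom, congrArg ModuleCat.Hom.hom hq⟩

theorem IsSES.extZero_right (h : IsSES f g) (hX : PdLEOne R X) (hB : ExtZero R X B) :
    ExtZero R X C :=
  h.shortExact.subsingleton_ext_X₃ (ModuleCat.of R X) rfl hB (hX.subsingleton_ext_two A)

theorem IsSES.extZero_left (h : IsSES f g) (hC : PdLEOne R C) (hB : ExtZero R B Y) :
    ExtZero R A Y :=
  h.shortExact.subsingleton_ext_from_X₁ (ModuleCat.of R Y) rfl hB (hC.subsingleton_ext_two Y)

theorem IsSES.extZero_of_lift (h : IsSES f g) (hB : ExtZero R X B)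
    (hl : ∀ p : X →ₗ[R] C, ∃ q : X →ₗ[R] B, g ∘ₗ q = p) : ExtZero R X A :=
  h.shortExact.subsingleton_ext_X₁_of_lift (ModuleCat.of R X) hB fun p =>
    (hl p.hom).imp' ModuleCat.ofHom fun _ hq => ModuleCat.hom_ext hq

theorem IsSES.extZero_of_extend (h : IsSES f g) (hB : ExtZero R B Y)
    (hl : ∀ p : A →ₗ[R] Y, ∃ q : B →ₗ[R] Y, q ∘ₗ f = p) : ExtZero R C Y :=
  h.shortExact.subsingleton_ext_from_X₃_of_extend (ModuleCat.of R Y) hB fun p =>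
    (hl p.hom).imp' ModuleCat.ofHom fun _ hq => ModuleCat.hom_ext hq

theorem IsSES.extZero_middle_left (h : IsSES f g) (hA : ExtZero R A Y) (hC : ExtZero R C Y) :
    ExtZero R B Y :=
  h.shortExact.subsingleton_ext_from_X₂ (ModuleCat.of R Y) hA hC

theorem ExtZero.of_retract_left {i : X →ₗ[R] Z} {r : Z →ₗ[R] X} (h : r ∘ₗ i = LinearMap.id)
    (hZ : ExtZero R Z Y) : ExtZero R X Y := by
  refine .of_forall fun e => ?_
  have h' : ModuleCat.ofHom i ≫ ModuleCat.ofHom r = 𝟙 (ModuleCat.of R X) := ModuleCat.hom_ext h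
  rw [← e.mk₀_id_comp, ← h', ← Abelian.Ext.mk₀_comp_mk₀,
    Abelian.Ext.comp_assoc (a₂₃ := 1) _ _ _ (by simp) (by simp) (by simp),
    hZ.eq_zero ((Abelian.Ext.mk₀ (ModuleCat.ofHom r)).comp e (zero_add 1)),
    Abelian.Ext.comp_zero]

theorem extZero_of_projective [Module.Projective R X] : ExtZero R X Y :=
  have : Projective (ModuleCat.of R X) := (IsProjective.iff_projective X).1 ‹_›
  projective_iff_subsingleton_ext_one.1 this (Y := ModuleCat.of R Y)

theorem projective_of_extZero (h : ∀ M : ModuleCat.{t} R, ExtZero R X M) : Module.Projective R X :=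
  (IsProjective.iff_projective X).2
    (projective_iff_subsingleton_ext_one.2 fun M => h M)

/-- An extension of `X` by `Y` is computed from a projective presentation of `X`, and the vanishing
of its class means that it splits. -/
theorem extZero_of_split
    (h : ∀ (E : ModuleCat.{t} R) (i : Y →ₗ[R] E) (p : E →ₗ[R] X), IsSES i p →
      ∃ s : X →ₗ[R] E, p ∘ₗ s = LinearMap.id) : ExtZero R X Y := by
  -- a free presentation `0 ⟶ L ⟶ F ⟶ X ⟶ 0`; every map `L ⟶ Y` extends to `F` because the
  -- pushout of the presentation along it splits
  have hs : Function.Surjective (Finsupp.linearCombination R (id : X → X)) :=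
    fun x => ⟨Finsupp.single x 1, by simp⟩
  generalize Finsupp.linearCombination R (id : X → X) = π at hs
  refine (IsSES.of_surjective hs).extZero_of_extend extZero_of_projective fun p => ?_
  let L := LinearMap.ker π
  let N : Submodule R (Y × (X →₀ R)) := LinearMap.range (LinearMap.prod (-p) L.subtype)
  let i : Y →ₗ[R] (Y × (X →₀ R)) ⧸ N := N.mkQ ∘ₗ LinearMap.inl R Y _
  let q : ((Y × (X →₀ R)) ⧸ N) →ₗ[R] X := N.liftQ (π ∘ₗ LinearMap.snd R Y _) (by
    rintro _ ⟨l, rfl⟩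
    exact l.2)
  have hiq : IsSES i q := by
    refine ⟨?_, ?_, ?_⟩
    · rw [← LinearMap.ker_eq_bot, LinearMap.ker_eq_bot']
      intro y hy
      have hy' : ((y, 0) : Y × (X →₀ R)) ∈ N := (Submodule.Quotient.mk_eq_zero N).1 hy
      obtain ⟨l, hl⟩ := hy'
      have h1 : (l : X →₀ R) = 0 := congrArg Prod.snd hl
      have h2 : -p l = y := congrArg Prod.fst hl
      rw [← h2, show l = 0 from Subtype.ext h1]
      simp
    · intro z
      obtain ⟨⟨y, a⟩, rfl⟩ := N.mkQ_surjective z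
      constructor
      · intro ha
        have hneg : p (-⟨a, ha⟩) = -p ⟨a, ha⟩ := map_neg p _
        refine ⟨y + p ⟨a, ha⟩, (Submodule.Quotient.eq N).2 ⟨-⟨a, ha⟩, ?_⟩⟩
        ext <;> simp [-map_neg, hneg]
      · rintro ⟨y', hy'⟩
        rw [← hy']
        change π 0 = 0
        simp
    · intro x
      obtain ⟨a, ha⟩ := hs x
      exact ⟨N.mkQ (0, a), ha⟩
  obtain ⟨s, hs'⟩ := h (ModuleCat.of R _) i q hiq
  -- the section gives a retraction `z ↦ z - s (q z)` onto the image of `Y`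
  have hr : ∀ z, ∃ y, i y = z - s (q z) := fun z => by
    refine (hiq.exact _).1 ?_
    rw [map_sub]
    exact sub_eq_zero.2 (LinearMap.congr_fun hs' (q z)).symm
  choose r hr using hr
  let ρ : ((Y × (X →₀ R)) ⧸ N) →ₗ[R] Y :=
    { toFun := r
      map_add' := fun a b => hiq.inj (by rw [map_add, hr, hr, hr, map_add, map_add]; abel)
      map_smul' := fun c a => hiq.inj (by
        rw [RingHom.id_apply, map_smul, hr, hr, map_smul, map_smul, smul_sub]) }
  refine ⟨ρ ∘ₗ N.mkQ ∘ₗ LinearMap.inr R Y _, LinearMap.ext fun l => hiq.inj ?_⟩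
  change i (r (N.mkQ (0, (l : X →₀ R)))) = i (p l)
  rw [hr]
  have : q (N.mkQ (0, (l : X →₀ R))) = 0 := l.2
  rw [this, map_zero, sub_zero]
  exact (Submodule.Quotient.eq N).2 ⟨l, by ext <;> simp⟩

theorem ExtZero.pi_left {ι : Type} [Finite ι] {M : ι → Type t} [∀ i, AddCommGroup (M i)]
    [∀ i, Module R (M i)] (h : ∀ i, ExtZero R (M i) Y) : ExtZero R (∀ i, M i) Y := by
  classical
  have := Fintype.ofFinite ι
  refine .of_forall fun e => ?_
  have hid : 𝟙 (ModuleCat.of R (∀ i, M i)) = ∑ i, ModuleCat.ofHom (LinearMap.proj i) ≫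
      ModuleCat.ofHom (LinearMap.single R M i) := by
    refine ModuleCat.hom_ext (LinearMap.ext fun x => ?_)
    rw [ModuleCat.hom_sum, LinearMap.sum_apply]
    exact (Finset.univ_sum_single x).symm
  rw [← e.mk₀_id_comp, hid, Abelian.Ext.mk₀_sum, Abelian.Ext.sum_comp]
  refine Finset.sum_eq_zero fun i _ => ?_
  rw [← Abelian.Ext.mk₀_comp_mk₀,
    Abelian.Ext.comp_assoc (a₂₃ := 1) _ _ _ (by simp) (by simp) (by simp),
    (h i).eq_zero ((Abelian.Ext.mk₀ (ModuleCat.ofHom (LinearMap.single R M i))).comp e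
      (zero_add 1)), Abelian.Ext.comp_zero]

theorem ExtZero.pi_right {ι : Type} [Finite ι] {M : ι → Type t} [∀ i, AddCommGroup (M i)]
    [∀ i, Module R (M i)] (h : ∀ i, ExtZero R X (M i)) : ExtZero R X (∀ i, M i) := by
  classical
  have := Fintype.ofFinite ι
  refine .of_forall fun e => ?_
  have hid : 𝟙 (ModuleCat.of R (∀ i, M i)) = ∑ i, ModuleCat.ofHom (LinearMap.proj i) ≫
      ModuleCat.ofHom (LinearMap.single R M i) := by
    refine ModuleCat.hom_ext (LinearMap.ext fun x => ?_)
    rw [ModuleCat.hom_sum, LinearMap.sum_apply]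
    exact (Finset.univ_sum_single x).symm
  rw [← e.comp_mk₀_id, hid, Abelian.Ext.mk₀_sum, Abelian.Ext.comp_sum]
  refine Finset.sum_eq_zero fun i _ => ?_
  rw [← Abelian.Ext.mk₀_comp_mk₀,
    ← Abelian.Ext.comp_assoc (a₁₂ := 1) _ _ _ (by simp) (by simp) (by simp),
    (h i).eq_zero (e.comp (Abelian.Ext.mk₀ (ModuleCat.ofHom (LinearMap.proj i)))
      (add_zero 1)), Abelian.Ext.zero_comp]

theorem IsSES.projective_of_pdLEOne (h : IsSES f g) [Module.Projective R B] (hC : PdLEOne R C) :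
    Module.Projective R A :=
  projective_of_extZero fun _ => h.extZero_left hC extZero_of_projective

theorem IsSES.pdLEOne_of_projective (h : IsSES f g) [Module.Projective R A]
    [Module.Projective R B] : PdLEOne R C := by
  have hA : Projective (ModuleCat.of R A) := (IsProjective.iff_projective A).1 ‹_›
  have hB : Projective (ModuleCat.of R B) := (IsProjective.iff_projective B).1 ‹_›
  exact h.shortExact.hasProjectiveDimensionLT_X₃ 1
    (inferInstanceAs (HasProjectiveDimensionLT (ModuleCat.of R A) 1))
    (inferInstanceAs (HasProjectiveDimensionLT (ModuleCat.of R B) (1 + 1)))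

theorem IsSES.pdLEOne_middle (h : IsSES f g) (hA : PdLEOne R A) (hC : PdLEOne R C) :
    PdLEOne R B :=
  h.shortExact.hasProjectiveDimensionLT_X₂ 2 hA hC

end ExtVanishing

/-! ### Retracts, `add`, `Gen` and indecomposable modules -/

section Notions

variable (R : Type t) [Ring R]

/-- `X` is a direct summand of `Y`. -/
def IsRetract (X Y : Type*) [AddCommGroup X] [AddCommGroup Y] [Module R X] [Module R Y] : Prop :=
  ∃ (i : X →ₗ[R] Y) (r : Y →ₗ[R] X), r ∘ₗ i = LinearMap.id

/-- `X` belongs to `add T`. -/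
def IsAdd (T X : Type*) [AddCommGroup T] [AddCommGroup X] [Module R T] [Module R X] : Prop :=
  ∃ n : ℕ, IsRetract R X (Fin n → T)

/-- `X` belongs to `Gen T`. -/
def IsGen (T X : Type*) [AddCommGroup T] [AddCommGroup X] [Module R T] [Module R X] : Prop :=
  ∃ (n : ℕ) (p : (Fin n → T) →ₗ[R] X), Function.Surjective p

/-- `X` is nonzero and has no idempotent endomorphisms but `0` and `1`. -/
def Indec (X : Type*) [AddCommGroup X] [Module R X] : Prop :=
  Nontrivial X ∧ ∀ e : Module.End R X, e * e = e → e = 0 ∨ e = 1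

end Notions

section Basic

variable {R : Type t} [Ring R]
variable {S T X Y Z : Type*} [AddCommGroup S] [AddCommGroup T] [AddCommGroup X] [AddCommGroup Y]
  [AddCommGroup Z] [Module R S] [Module R T] [Module R X] [Module R Y] [Module R Z]

theorem IsRetract.refl : IsRetract R X X := ⟨LinearMap.id, LinearMap.id, rfl⟩

theorem IsRetract.trans (h : IsRetract R X Y) (h' : IsRetract R Y Z) : IsRetract R X Z := by
  obtain ⟨i, r, h⟩ := h
  obtain ⟨i', r', h'⟩ := h'
  refine ⟨i' ∘ₗ i, r ∘ₗ r', LinearMap.ext fun x => ?_⟩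
  change r (r' (i' (i x))) = x
  rw [show r' (i' (i x)) = i x from LinearMap.congr_fun h' (i x)]
  exact LinearMap.congr_fun h x

theorem IsRetract.of_equiv (e : X ≃ₗ[R] Y) : IsRetract R X Y :=
  ⟨e, e.symm, LinearMap.ext fun x => e.symm_apply_apply x⟩

theorem IsRetract.fst : IsRetract R X (X × Y) :=
  ⟨LinearMap.inl R X Y, LinearMap.fst R X Y, rfl⟩

theorem IsRetract.snd : IsRetract R Y (X × Y) :=
  ⟨LinearMap.inr R X Y, LinearMap.snd R X Y, rfl⟩

theorem IsRetract.prod (h : IsRetract R X Z) (h' : IsRetract R Y T) :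
    IsRetract R (X × Y) (Z × T) := by
  obtain ⟨i, r, h⟩ := h
  obtain ⟨i', r', h'⟩ := h'
  exact ⟨i.prodMap i', r.prodMap r', LinearMap.ext fun x =>
    Prod.ext (LinearMap.congr_fun h x.1) (LinearMap.congr_fun h' x.2)⟩

theorem IsRetract.pi_mono {ι : Type*} {M N : ι → Type*} [∀ i, AddCommGroup (M i)]
    [∀ i, Module R (M i)] [∀ i, AddCommGroup (N i)] [∀ i, Module R (N i)]
    (h : ∀ i, IsRetract R (M i) (N i)) : IsRetract R (∀ i, M i) (∀ i, N i) := by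
  choose i r h using h
  exact ⟨LinearMap.pi fun j => i j ∘ₗ LinearMap.proj j,
    LinearMap.pi fun j => r j ∘ₗ LinearMap.proj j, LinearMap.ext fun x => funext fun j =>
      LinearMap.congr_fun (h j) (x j)⟩

theorem IsRetract.single {ι : Type*} {M : ι → Type*} [∀ i, AddCommGroup (M i)]
    [∀ i, Module R (M i)] (i : ι) : IsRetract R (M i) (∀ i, M i) := by
  classical
  exact ⟨LinearMap.single R M i, LinearMap.proj i, LinearMap.ext fun x => by simp⟩

theorem IsRetract.surjective (h : IsRetract R X Y) :
    ∃ r : Y →ₗ[R] X, Function.Surjective r := by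
  obtain ⟨i, r, h⟩ := h
  exact ⟨r, fun x => ⟨i x, LinearMap.congr_fun h x⟩⟩

theorem IsRetract.injective (h : IsRetract R X Y) :
    ∃ i : X →ₗ[R] Y, Function.Injective i := by
  obtain ⟨i, r, h⟩ := h
  exact ⟨i, Function.LeftInverse.injective (g := r) fun x => LinearMap.congr_fun h x⟩

theorem IsRetract.isAdd (h : IsRetract R X T) : IsAdd R T X :=
  ⟨1, h.trans (IsRetract.of_equiv (LinearEquiv.funUnique (Fin 1) R T).symm)⟩

theorem IsAdd.refl : IsAdd R T T := IsRetract.refl.isAdd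

theorem IsAdd.of_retract (h : IsRetract R X Y) (hY : IsAdd R T Y) : IsAdd R T X := by
  obtain ⟨n, hn⟩ := hY
  exact ⟨n, h.trans hn⟩

theorem IsAdd.pow (h : IsAdd R T X) (m : ℕ) : IsAdd R T (Fin m → X) := by
  obtain ⟨n, hn⟩ := h
  refine ⟨m * n, (IsRetract.pi_mono fun _ : Fin m => hn).trans (IsRetract.of_equiv ?_)⟩
  exact (LinearEquiv.curry R T (Fin m) (Fin n)).symm.trans
    (LinearEquiv.funCongrLeft R T finProdFinEquiv.symm)

theorem IsAdd.trans (h : IsAdd R T X) (h' : IsAdd R S T) : IsAdd R S X := by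
  obtain ⟨n, hn⟩ := h
  exact (h'.pow n).of_retract hn

theorem IsAdd.prod (hX : IsAdd R T X) (hY : IsAdd R T Y) : IsAdd R T (X × Y) := by
  obtain ⟨n, hn⟩ := hX
  obtain ⟨m, hm⟩ := hY
  refine ⟨n + m, (hn.prod hm).trans (IsRetract.of_equiv ?_)⟩
  exact (LinearEquiv.sumArrowLequivProdArrow (Fin n) (Fin m) R T).symm.trans
    (LinearEquiv.funCongrLeft R T finSumFinEquiv.symm)

theorem IsAdd.of_subsingleton [Subsingleton X] : IsAdd R T X :=
  ⟨0, 0, 0, LinearMap.ext fun _ => Subsingleton.elim _ _⟩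

theorem IsAdd.isGen (h : IsAdd R T X) : IsGen R T X := by
  obtain ⟨n, hn⟩ := h
  exact ⟨n, hn.surjective⟩

theorem IsGen.of_surjective {p : X →ₗ[R] Y} (hp : Function.Surjective p) (h : IsGen R T X) :
    IsGen R T Y := by
  obtain ⟨n, q, hq⟩ := h
  exact ⟨n, p ∘ₗ q, hp.comp hq⟩

theorem IsGen.pow (h : IsGen R T X) (m : ℕ) : IsGen R T (Fin m → X) := by
  obtain ⟨n, p, hp⟩ := h
  refine (((IsAdd.refl : IsAdd R T T).pow n).pow m).isGen.of_surjective
    (p := LinearMap.pi fun j => p ∘ₗ LinearMap.proj j) fun y => ?_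
  choose x hx using fun j => hp (y j)
  exact ⟨x, funext hx⟩

theorem IsGen.trans (h : IsGen R T X) (h' : IsGen R S T) : IsGen R S X := by
  obtain ⟨n, p, hp⟩ := h
  exact (h'.pow n).of_surjective hp

theorem IsGen.finite [Module.Finite R T] (h : IsGen R T X) : Module.Finite R X := by
  obtain ⟨n, p, hp⟩ := h
  exact Module.Finite.of_surjective p hp

theorem IsRetract.finite [Module.Finite R Y] (h : IsRetract R X Y) : Module.Finite R X :=
  h.isAdd.isGen.finite

theorem IsGen.annihilator_le (h : IsGen R T X) : Module.annihilator R T ≤ Module.annihilator R X := by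
  obtain ⟨n, p, hp⟩ := h
  intro r hr
  rw [Module.mem_annihilator] at hr ⊢
  intro x
  obtain ⟨y, rfl⟩ := hp x
  rw [← map_smul, show r • y = 0 from funext fun i => hr (y i), map_zero]

end Basic

section Translation

attribute [local instance] Abelian.hasFiniteBiproducts

variable {R : Type t} [Ring R]

theorem nonempty_retract_iff {X Y : ModuleCat.{t} R} :
    Nonempty (Retract X Y) ↔ IsRetract R X Y :=
  ⟨fun ⟨h⟩ => ⟨h.i.hom, h.r.hom, congrArg ModuleCat.Hom.hom h.retract⟩,
    fun ⟨i, r, h⟩ => ⟨⟨ModuleCat.ofHom i, ModuleCat.ofHom r, ModuleCat.hom_ext h⟩⟩⟩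

theorem nonempty_iso_iff {X Y : ModuleCat.{t} R} : Nonempty (X ≅ Y) ↔ Nonempty (X ≃ₗ[R] Y) :=
  ⟨fun ⟨h⟩ => ⟨h.toLinearEquiv⟩, fun ⟨h⟩ => ⟨h.toModuleIso⟩⟩

/-- The biproduct of a family of modules is its product. -/
def biproductEquivPi {ι : Type} [Finite ι] (Y : ι → ModuleCat.{t} R) :
    (⨁ Y : ModuleCat.{t} R) ≃ₗ[R] (∀ i, Y i) :=
  (ModuleCat.biproductIsoPi Y).toLinearEquiv

theorem addClosure_iff {T X : ModuleCat.{t} R} : addClosure T X ↔ IsAdd R T X := by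
  refine exists_congr fun n => nonempty_retract_iff.trans ?_
  exact ⟨fun h => h.trans (.of_equiv (biproductEquivPi _)),
    fun h => h.trans (.of_equiv (biproductEquivPi _).symm)⟩

theorem gen_iff {T X : ModuleCat.{t} R} : Gen T X ↔ IsGen R T X := by
  constructor
  · rintro ⟨Y, f, hY, hf⟩
    exact (addClosure_iff.1 hY).isGen.of_surjective ((ModuleCat.epi_iff_surjective f).1 hf)
  · rintro ⟨n, p, hp⟩
    exact ⟨ModuleCat.of R (Fin n → T), ModuleCat.ofHom p, addClosure_iff.2 (IsAdd.refl.pow n),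
      (ModuleCat.epi_iff_surjective _).2 hp⟩

theorem indecomposable_iff {X : ModuleCat.{t} R} : Indecomposable X ↔ Indec R X := by
  rw [Indecomposable, Indec, ModuleCat.isZero_iff_subsingleton, not_subsingleton_iff_nontrivial]
  refine and_congr_right fun _ => ⟨fun h e he => ?_, fun h Y Z φ => ?_⟩
  · have hc := LinearMap.IsIdempotentElem.isCompl (f := e) he
    have φ := (Submodule.prodEquivOfIsCompl _ _ hc).symm.toModuleIso ≪≫
      (ModuleCat.biprodIsoProd (ModuleCat.of R (LinearMap.range e))
        (ModuleCat.of R (LinearMap.ker e))).symm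
    rcases h _ _ φ with h | h <;> rw [ModuleCat.isZero_iff_subsingleton] at h
    · exact .inl (LinearMap.range_eq_bot.1 ((Submodule.subsingleton_iff_eq_bot).1 h))
    · have hk : LinearMap.ker e = ⊥ := (Submodule.subsingleton_iff_eq_bot).1 h
      refine .inr (LinearMap.ext fun x => LinearMap.ker_eq_bot.1 hk ?_)
      exact LinearMap.congr_fun he x
  · let a : X ⟶ X := φ.hom ≫ biprod.fst ≫ biprod.inl ≫ φ.inv
    have ha : a ≫ a = a := by simp [a]
    rcases h a.hom (congrArg ModuleCat.Hom.hom ha) with h | h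
    · refine .inl ((IsZero.iff_id_eq_zero Y).2 ?_)
      have h0 : a = 0 := ModuleCat.hom_ext h
      have : biprod.inl ≫ φ.inv ≫ a ≫ φ.hom ≫ biprod.fst = 𝟙 Y := by simp [a]
      rw [← this, h0]
      simp
    · refine .inr ((IsZero.iff_id_eq_zero Z).2 ?_)
      have h1 : a = 𝟙 X := ModuleCat.hom_ext h
      have : biprod.inr ≫ φ.inv ≫ a ≫ φ.hom ≫ biprod.snd = 0 := by simp [a]
      rw [← this, h1]
      simp

end Translation

/-! ### The Krull–Schmidt theorem -/

section KrullSchmidt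

variable {R : Type t} [Ring R]

section

variable {X Y Z : Type*} [AddCommGroup X] [AddCommGroup Y]
  [AddCommGroup Z] [Module R X] [Module R Y] [Module R Z]

theorem length_lt_of_surjective [IsArtinian R X] [IsNoetherian R X] {f : X →ₗ[R] Y}
    (hf : Function.Surjective f) (hi : ¬ Function.Injective f) :
    Module.length R Y < Module.length R X := by
  have h := Module.length_eq_add_of_exact (LinearMap.ker f).subtype f
    (Submodule.subtype_injective _) hf (LinearMap.exact_subtype_ker_map f)
  have hk : 0 < Module.length R (LinearMap.ker f) := by
    rw [Module.length_pos_iff, Submodule.nontrivial_iff_ne_bot]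
    exact fun h => hi (LinearMap.ker_eq_bot.1 h)
  have hX : Module.length R X ≠ ⊤ := Module.length_ne_top
  rw [h] at hX ⊢
  have := (ENat.add_lt_add_iff_right (WithTop.add_ne_top.1 hX).2).2 hk
  rwa [zero_add] at this

theorem length_lt_of_injective [IsArtinian R Y] [IsNoetherian R Y] {f : X →ₗ[R] Y}
    (hf : Function.Injective f) (hs : ¬ Function.Surjective f) :
    Module.length R X < Module.length R Y := by
  rw [(LinearEquiv.ofInjective f hf).length_eq]
  exact Submodule.length_lt fun h => hs (LinearMap.range_eq_top.1 h)

/-- Fitting's lemma. -/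
theorem Indec.isNilpotent_or_isUnit [IsArtinian R X] [IsNoetherian R X] (hX : Indec R X)
    (f : Module.End R X) : IsNilpotent f ∨ IsUnit f := by
  obtain ⟨n, hn, hn0⟩ :=
    (f.eventually_isCompl_ker_pow_range_pow.and (Filter.eventually_gt_atTop 0)).exists
  let e : Module.End R X := Submodule.projection _ _ hn
  rcases hX.2 e (Submodule.isIdempotentElem_projection hn) with h | h
  · have hk : LinearMap.ker (f ^ n) = ⊥ := by
      rw [← Submodule.range_projection hn]
      exact LinearMap.range_eq_bot.2 h
    have hr : LinearMap.range (f ^ n) = ⊤ := by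
      have := hn.sup_eq_top
      rwa [hk, bot_sup_eq] at this
    have : IsUnit (f ^ n) := (Module.End.isUnit_iff _).2
      ⟨LinearMap.ker_eq_bot.1 hk, LinearMap.range_eq_top.1 hr⟩
    exact .inr ((isUnit_pow_iff hn0.ne').1 this)
  · have hk : LinearMap.ker (f ^ n) = ⊤ := by
      rw [← Submodule.range_projection hn]
      exact LinearMap.range_eq_top.2 fun x => ⟨x, LinearMap.congr_fun h x⟩
    exact .inl ⟨n, LinearMap.ker_eq_top.1 hk⟩

theorem Indec.isLocalRing [IsArtinian R X] [IsNoetherian R X] (hX : Indec R X) :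
    IsLocalRing (Module.End R X) where
  exists_pair_ne := by
    have := hX.1
    exact ⟨0, 1, zero_ne_one⟩
  isUnit_or_isUnit_of_add_one {a b} h := by
    rcases hX.isNilpotent_or_isUnit a with ha | ha
    · right
      rw [eq_sub_of_add_eq' h]
      exact ha.isUnit_one_sub
    · exact .inl ha

theorem exists_isUnit_of_sum {E ι : Type*} [Ring E] [IsLocalRing E] (s : Finset ι) (f : ι → E)
    (h : IsUnit (∑ i ∈ s, f i)) : ∃ i ∈ s, IsUnit (f i) := by
  classical
  induction s using Finset.induction_on with
  | empty => simp at h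
  | insert a s ha ih =>
    rw [Finset.sum_insert ha] at h
    obtain ⟨u, hu⟩ := h
    have h1 : (↑u⁻¹ * f a) + ↑u⁻¹ * ∑ i ∈ s, f i = 1 := by
      rw [← mul_add, ← hu, Units.inv_mul]
    rcases IsLocalRing.isUnit_or_isUnit_of_add_one h1 with h2 | h2
    · exact ⟨a, by simp, (Units.isUnit_units_mul _ _).1 h2⟩
    · obtain ⟨i, hi, hi'⟩ := ih ((Units.isUnit_units_mul _ _).1 h2)
      exact ⟨i, by simp [hi], hi'⟩

theorem IsRetract.of_isUnit {i : X →ₗ[R] Y} {r : Y →ₗ[R] X}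
    (h : IsUnit (M := Module.End R X) (r ∘ₗ i)) : IsRetract R X Y := by
  obtain ⟨u, hu⟩ := h
  refine ⟨i, (↑u⁻¹ : Module.End R X) ∘ₗ r, ?_⟩
  have : (↑u⁻¹ : Module.End R X) * ↑u = 1 := u.inv_mul
  rw [hu] at this
  exact this

/-- An indecomposable summand of a finite product is a summand of one of the factors. -/
theorem IsRetract.exists_of_pi [IsArtinian R X] [IsNoetherian R X] (hX : Indec R X) {ι : Type*}
    [Finite ι] {M : ι → Type*} [∀ i, AddCommGroup (M i)] [∀ i, Module R (M i)]
    (h : IsRetract R X (∀ i, M i)) : ∃ i, IsRetract R X (M i) := by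
  classical
  have := Fintype.ofFinite ι
  have := hX.isLocalRing
  obtain ⟨i, r, h⟩ := h
  have hs : ∑ j, (r ∘ₗ LinearMap.single R M j) ∘ₗ (LinearMap.proj j ∘ₗ i) =
      (1 : Module.End R X) := by
    rw [Module.End.one_eq_id, ← h]
    refine LinearMap.ext fun x => ?_
    rw [LinearMap.sum_apply]
    change ∑ j, r (Pi.single j (i x j)) = r (i x)
    rw [← map_sum, Finset.univ_sum_single]
  obtain ⟨j, -, hj⟩ := exists_isUnit_of_sum (E := Module.End R X) Finset.univ _
    (hs ▸ isUnit_one)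
  exact ⟨j, .of_isUnit hj⟩

theorem IsRetract.of_prod [IsArtinian R X] [IsNoetherian R X] (hX : Indec R X)
    (h : IsRetract R X (Y × Z)) : IsRetract R X Y ∨ IsRetract R X Z := by
  have := hX.isLocalRing
  obtain ⟨i, r, h⟩ := h
  have hs : ((r ∘ₗ LinearMap.inl R Y Z) ∘ₗ (LinearMap.fst R Y Z ∘ₗ i) : Module.End R X) +
      (r ∘ₗ LinearMap.inr R Y Z) ∘ₗ (LinearMap.snd R Y Z ∘ₗ i) = 1 := by
    rw [Module.End.one_eq_id, ← h]
    refine LinearMap.ext fun x => ?_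
    change r ((i x).1, 0) + r (0, (i x).2) = r (i x)
    rw [← map_add]
    simp
  exact (IsLocalRing.isUnit_or_isUnit_of_add_one hs).imp .of_isUnit .of_isUnit

/-- An indecomposable module has no nonzero direct summands but itself. -/
theorem IsRetract.nonempty_equiv (h : IsRetract R X Y) [Nontrivial X] (hY : Indec R Y) :
    Nonempty (X ≃ₗ[R] Y) := by
  obtain ⟨i, r, h⟩ := h
  have h' : ∀ x, r (i x) = x := fun x => LinearMap.congr_fun h x
  rcases hY.2 (i ∘ₗ r) (LinearMap.ext fun y => by simp [h']) with h0 | h1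
  · obtain ⟨x, hx⟩ := exists_ne (0 : X)
    refine absurd ?_ hx
    rw [← h' x, ← h' (r (i x)), show i (r (i x)) = 0 from LinearMap.congr_fun h0 (i x), map_zero]
  · exact ⟨LinearEquiv.ofLinearMap i r h1 h⟩

end

section

variable {T X : Type t} [AddCommGroup T] [AddCommGroup X] [Module R T] [Module R X]

theorem exists_indec_summand [IsArtinian R X] [Nontrivial X] :
    ∃ Z X' : ModuleCat.{t} R, Indec R Z ∧ Nonempty (X ≃ₗ[R] Z × X') := by
  obtain ⟨N, ⟨hN, N', hc⟩, hmin⟩ := WellFounded.has_min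
    (wellFounded_lt (α := Submodule R X)) {N | N ≠ ⊥ ∧ ∃ N', IsCompl N N'}
    ⟨⊤, top_ne_bot, ⊥, isCompl_top_bot⟩
  refine ⟨ModuleCat.of R N, ModuleCat.of R N', ⟨?_, fun e he => ?_⟩,
    ⟨(Submodule.prodEquivOfIsCompl N N' hc).symm⟩⟩
  · exact (Submodule.nontrivial_iff_ne_bot).2 hN
  -- a nontrivial idempotent of `N` would cut out a smaller complemented submodule
  by_contra! hcon
  change Module.End R N at e
  have hc' := LinearMap.IsIdempotentElem.isCompl (f := e) he
  refine hmin ((LinearMap.range e).map N.subtype) ⟨?_, (LinearMap.ker e).map N.subtype ⊔ N',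
    ?_, ?_⟩ ?_
  · exact fun h => hcon.1 (LinearMap.range_eq_bot.1
      ((Submodule.map_injective_of_injective N.injective_subtype) (h.trans (Submodule.map_bot _).symm)))
  · rw [Submodule.disjoint_def]
    rintro _ ⟨a, ha, rfl⟩ h
    obtain ⟨_, ⟨b, hb, rfl⟩, c, hc1, h⟩ := Submodule.mem_sup.1 h
    have h0 : c = 0 := by
      refine Submodule.disjoint_def.1 hc.disjoint c ?_ hc1
      rw [← eq_sub_iff_add_eq'] at h
      rw [h]
      exact (a - b).2
    rw [h0, add_zero] at h
    have hab : b = a := N.injective_subtype h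
    rw [hab] at hb
    rw [Submodule.disjoint_def.1 hc'.disjoint a ha hb, map_zero]
  · rw [codisjoint_iff, ← sup_assoc, ← Submodule.map_sup, hc'.sup_eq_top, Submodule.map_top,
      Submodule.range_subtype, hc.sup_eq_top]
  · refine lt_of_le_of_ne ((Submodule.map_le_iff_le_comap).2 fun x _ => x.2) fun h => hcon.2 ?_
    have hr : LinearMap.range e = ⊤ := by
      refine Submodule.map_injective_of_injective N.injective_subtype ?_
      rw [h, Submodule.map_top, Submodule.range_subtype]
    refine LinearMap.ext fun x => ?_
    obtain ⟨y, rfl⟩ := LinearMap.range_eq_top.1 hr x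
    exact LinearMap.congr_fun he y

/-- Induction over finitely generated modules, splitting off one indecomposable direct summand
at a time. -/
theorem indec_induction [IsArtinianRing R] {P : ModuleCat.{t} R → Prop}
    (h0 : ∀ X : ModuleCat.{t} R, Subsingleton X → P X)
    (h1 : ∀ X Z X' : ModuleCat.{t} R, Module.Finite R X → Indec R Z →
      (X ≃ₗ[R] Z × X') → P X' → P X) (X : ModuleCat.{t} R) (hX : Module.Finite R X) : P X := by
  induction hn : Module.length R X using WellFoundedLT.induction generalizing X with
  | ind n ih =>
    rcases subsingleton_or_nontrivial X with hs | hs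
    · exact h0 X hs
    obtain ⟨Z, X', hZ, ⟨e⟩⟩ := exists_indec_summand (R := R) (X := X)
    let f : X →ₗ[R] X' := LinearMap.snd R Z X' ∘ₗ e.toLinearMap
    have hf : Function.Surjective f :=
      (LinearMap.snd_surjective (R := R) (M := Z) (M₂ := X')).comp e.surjective
    have hf' : ¬ Function.Injective f := fun h => by
      have := hZ.1
      obtain ⟨z, hz⟩ := exists_ne (0 : Z)
      refine hz ?_
      have h2 : f (e.symm (z, 0)) = f 0 := by simp [f]
      have : e.symm (z, 0) = 0 := h h2
      simpa using this
    exact h1 X Z X' hX hZ e (ih _ (hn ▸ length_lt_of_surjective hf hf') X'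
      (Module.Finite.of_surjective f hf) rfl)

/-- A finite family of pairwise non-isomorphic indecomposable modules. -/
structure IsBasicFamily {n : ℕ} (Y : Fin n → ModuleCat.{t} R) : Prop where
  indec : ∀ i, Indec R (Y i)
  eq_of_equiv : ∀ i j, Nonempty (Y i ≃ₗ[R] Y j) → i = j

theorem IsBasicFamily.cons {n : ℕ} {Y : Fin n → ModuleCat.{t} R} (hY : IsBasicFamily Y)
    {Z : ModuleCat.{t} R} (hZ : Indec R Z) (h : ∀ i, ¬ Nonempty (Y i ≃ₗ[R] Z)) :
    IsBasicFamily (Fin.cons Z Y : Fin (n + 1) → ModuleCat.{t} R) where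
  indec i := by
    refine Fin.cases ?_ (fun j => ?_) i
    · exact hZ
    · exact hY.indec j
  eq_of_equiv i j := by
    refine Fin.cases ?_ (fun i => ?_) i <;> refine Fin.cases ?_ (fun j => ?_) j
    · exact fun _ => rfl
    · exact fun ⟨e⟩ => absurd ⟨e.symm⟩ (h j)
    · exact fun ⟨e⟩ => absurd ⟨e⟩ (h i)
    · exact fun he => congrArg Fin.succ (hY.eq_of_equiv i j he)

theorem IsAdd.pi {ι : Type} [Finite ι] {M : ι → Type t} [∀ i, AddCommGroup (M i)]
    [∀ i, Module R (M i)] (h : ∀ i, IsAdd R T (M i)) : IsAdd R T (∀ i, M i) := by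
  have := Fintype.ofFinite ι
  choose n hn using h
  refine ⟨Fintype.card (Σ i, Fin (n i)), (IsRetract.pi_mono hn).trans (.of_equiv ?_)⟩
  exact (LinearEquiv.piCurry R (fun (i : ι) (_ : Fin (n i)) => T)).symm.trans
    (LinearEquiv.funCongrLeft R T (Fintype.equivFin _).symm)

/-- Every finitely generated module `X` over an Artinian ring is a direct sum of copies of
pairwise non-isomorphic indecomposable direct summands of `X`. -/
theorem exists_basicFamily [IsArtinianRing R] (X : ModuleCat.{t} R) [Module.Finite R X] :
    ∃ (n : ℕ) (Y : Fin n → ModuleCat.{t} R), IsBasicFamily Y ∧ (∀ i, IsRetract R (Y i) X) ∧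
      IsAdd R (∀ i, Y i) X := by
  refine indec_induction (P := fun X => ∃ (n : ℕ) (Y : Fin n → ModuleCat.{t} R),
    IsBasicFamily Y ∧ (∀ i, IsRetract R (Y i) X) ∧ IsAdd R (∀ i, Y i) X) ?_ ?_ X ‹_›
  · intro X _
    exact ⟨0, Fin.elim0, ⟨fun i => i.elim0, fun i => i.elim0⟩, fun i => i.elim0,
      .of_subsingleton⟩
  · rintro X Z X' _ hZ e ⟨n, Y, hY, hr, ha⟩
    have hr' : ∀ i, IsRetract R (Y i) X := fun i =>
      ((hr i).trans .snd).trans (.of_equiv e.symm)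
    by_cases h : ∃ i, Nonempty (Y i ≃ₗ[R] Z)
    · obtain ⟨i, ⟨φ⟩⟩ := h
      exact ⟨n, Y, hY, hr', .of_retract (.of_equiv e)
        ((((IsRetract.of_equiv φ.symm).trans (.single (M := fun i => Y i) i)).isAdd).prod ha)⟩
    · refine ⟨n + 1, Fin.cons Z Y, hY.cons hZ fun i hi => h ⟨i, hi⟩, fun i => ?_, ?_⟩
      · refine Fin.cases ?_ (fun j => ?_) i
        · exact IsRetract.fst.trans (.of_equiv e.symm)
        · exact hr' j
      · have hs := fun i => IsRetract.single (R := R)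
          (M := fun i => (Fin.cons Z Y : Fin (n + 1) → ModuleCat.{t} R) i) i
        refine .of_retract (.of_equiv e) (.prod (hs 0).isAdd (ha.trans ?_))
        exact .pi fun i => (hs i.succ).isAdd

/-- The indecomposable modules in `add X` are the members of a basic family that generates it. -/
theorem IsBasicFamily.exists_equiv [IsArtinianRing R] {n : ℕ} {Y : Fin n → ModuleCat.{t} R}
    (hY : IsBasicFamily Y) {Z : ModuleCat.{t} R} [Module.Finite R Z] (hZ : Indec R Z)
    (h : IsAdd R (∀ i, Y i) Z) : ∃ i, Nonempty (Z ≃ₗ[R] Y i) := by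
  obtain ⟨m, hm⟩ := h
  obtain ⟨j, hj⟩ := hm.exists_of_pi hZ
  obtain ⟨i, hi⟩ := hj.exists_of_pi hZ
  have := hZ.1
  exact ⟨i, hi.nonempty_equiv (hY.indec i)⟩

end

end KrullSchmidt

/-! ### Rigid modules and their torsion classes -/

section Rigid

variable {R : Type t} [Ring R]

variable (R) in
/-- Every finitely generated `R`-module has projective dimension at most one. -/
def IsHereditaryFG : Prop := ∀ X : ModuleCat.{t} R, Module.Finite R X → PdLEOne R X

variable (R) in
/-- `X` is an `Ext`-projective object of `Gen M`. -/
def IsGenExtProjective (M X : Type t) [AddCommGroup M] [Module R M] [AddCommGroup X]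
    [Module R X] : Prop :=
  IsGen R M X ∧ ∀ Y : ModuleCat.{t} R, IsGen R M Y → ExtZero R X Y

variable (R) in
/-- There is a short exact sequence `0 ⟶ R / ann M ⟶ A ⟶ C ⟶ 0` with `A` and `C` in `add M`. -/
def HasTiltingSequence (M : Type t) [AddCommGroup M] [Module R M] : Prop :=
  ∃ (A C : ModuleCat.{t} R) (f : (R ⧸ Module.annihilator R M) →ₗ[R] A) (g : A →ₗ[R] C),
    IsSES f g ∧ IsAdd R M A ∧ IsAdd R M C

section Approximation

variable (R) (k : Type w) [Field k] [Algebra k R] [Module.Finite k R]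
variable (X M : Type t) [AddCommGroup X] [AddCommGroup M] [Module R X] [Module R M]
  [Module.Finite R X] [Module.Finite R M]

include k in
/-- `Hom(X, M)` is finite dimensional over `k`, and the coefficients of a linear combination of a
spanning family can be read as endomorphisms of `M` or of `X`. -/
theorem exists_hom_span : ∃ (n : ℕ) (h : Fin n → X →ₗ[R] M), ∀ g : X →ₗ[R] M,
    ∃ (c : Fin n → Module.End R M) (c' : Fin n → Module.End R X),
      (g = ∑ i, c i ∘ₗ h i) ∧ g = ∑ i, h i ∘ₗ c' i := by
  let : Module k X := Module.compHom X (algebraMap k R)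
  let : Module k M := Module.compHom M (algebraMap k R)
  have : IsScalarTower k R X := IsScalarTower.of_algebraMap_smul fun _ _ => rfl
  have : IsScalarTower k R M := IsScalarTower.of_algebraMap_smul fun _ _ => rfl
  have : Module.Finite k X := Module.Finite.trans R X
  have : Module.Finite k M := Module.Finite.trans R M
  have : SMulCommClass R k M := IsScalarTower.to_smulCommClass'
  have : SMulCommClass R k X := IsScalarTower.to_smulCommClass'
  have : Module.Finite k (X →ₗ[R] M) := Module.Finite.of_injective
    (LinearMap.restrictScalarsₗ k R X M k) (LinearMap.restrictScalars_injective k)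
  obtain ⟨n, h, hh⟩ := Module.Finite.exists_fin (R := k) (M := X →ₗ[R] M)
  refine ⟨n, h, fun g => ?_⟩
  have hg : g ∈ Submodule.span k (Set.range h) := hh ▸ Submodule.mem_top
  obtain ⟨c, rfl⟩ := (Submodule.mem_span_range_iff_exists_fun k).1 hg
  exact ⟨fun i => c i • 1, fun i => c i • 1, Finset.sum_congr rfl fun i _ => rfl,
    Finset.sum_congr rfl fun i _ => LinearMap.ext fun x => (LinearMap.map_smul_of_tower _ _ _).symm⟩

include k in
/-- Left approximations by powers of `M`: every map to `M` factors through `φ`. -/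
theorem exists_left_approximation : ∃ (n : ℕ) (φ : X →ₗ[R] (Fin n → M)),
    ∀ g : X →ₗ[R] M, ∃ g' : (Fin n → M) →ₗ[R] M, g' ∘ₗ φ = g := by
  obtain ⟨n, h, hh⟩ := exists_hom_span R k X M
  refine ⟨n, LinearMap.pi h, fun g => ?_⟩
  obtain ⟨c, -, hc, -⟩ := hh g
  refine ⟨∑ i, c i ∘ₗ LinearMap.proj i, LinearMap.ext fun x => ?_⟩
  rw [hc]
  simp

include k in
/-- Right approximations by powers of `M`: every map from `M` factors through `ψ`. -/
theorem exists_right_approximation : ∃ (n : ℕ) (ψ : (Fin n → M) →ₗ[R] X),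
    ∀ g : M →ₗ[R] X, ∃ g' : M →ₗ[R] (Fin n → M), ψ ∘ₗ g' = g := by
  obtain ⟨n, h, hh⟩ := exists_hom_span R k M X
  refine ⟨n, ∑ i, h i ∘ₗ LinearMap.proj i, fun g => ?_⟩
  obtain ⟨-, c, -, hc⟩ := hh g
  refine ⟨LinearMap.pi c, LinearMap.ext fun x => ?_⟩
  rw [hc]
  simp

include k in
/-- The kernel of a left approximation of `R` by powers of `M` is the annihilator of `M`. -/
theorem exists_injective_quotient_annihilator :
    ∃ (n : ℕ) (φ : (R ⧸ Module.annihilator R M) →ₗ[R] (Fin n → M)), Function.Injective φ := by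
  obtain ⟨n, φ, hφ⟩ := exists_left_approximation R k R M
  have hk : LinearMap.ker φ = Module.annihilator R M := by
    ext r
    rw [LinearMap.mem_ker, Module.mem_annihilator]
    constructor
    · intro hr m
      obtain ⟨g, hg⟩ := hφ (LinearMap.toSpanSingleton R M m)
      have := LinearMap.congr_fun hg r
      rw [LinearMap.comp_apply, hr, map_zero, LinearMap.toSpanSingleton_apply] at this
      exact this.symm
    · intro hr
      have : φ r = r • φ 1 := by rw [← map_smul, smul_eq_mul, mul_one]
      rw [this]
      exact funext fun i => hr _
  exact ⟨n, (Module.annihilator R M).liftQ φ hk.ge, by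
    rw [← LinearMap.ker_eq_bot, Submodule.ker_liftQ_eq_bot' _ _ hk.symm]⟩

end Approximation

section

variable {M X Y N : Type t} [AddCommGroup M] [Module R M] [AddCommGroup X] [Module R X]
  [AddCommGroup Y] [Module R Y] [AddCommGroup N] [Module R N]

theorem ExtZero.of_isAdd (h : ExtZero R M Y) (hX : IsAdd R M X) : ExtZero R X Y := by
  obtain ⟨n, i, r, hir⟩ := hX
  exact .of_retract_left hir (.pi_left fun _ => h)

theorem ExtZero.of_isGen (hX : PdLEOne R X) (h : ExtZero R X M) (hY : IsGen R M Y) :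
    ExtZero R X Y := by
  obtain ⟨n, p, hp⟩ := hY
  exact (IsSES.of_surjective hp).extZero_right hX (.pi_right fun _ => h)

theorem IsGenExtProjective.self (hpd : PdLEOne R M) (h : ExtZero R M M) :
    IsGenExtProjective R M M :=
  ⟨IsAdd.refl.isGen, fun _ hY => h.of_isGen hpd hY⟩

theorem IsGenExtProjective.of_isAdd (h : IsGenExtProjective R M X) (hY : IsAdd R X Y) :
    IsGenExtProjective R M Y :=
  ⟨hY.isGen.trans h.1, fun Z hZ => (h.2 Z hZ).of_isAdd hY⟩

theorem IsGenExtProjective.prod (h : IsGenExtProjective R M X) (h' : IsGenExtProjective R M Y) :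
    IsGenExtProjective R M (X × Y) := by
  refine ⟨?_, fun Z hZ => (⟨LinearMap.inl_injective, .inl_snd, LinearMap.snd_surjective⟩ :
    IsSES (LinearMap.inl R X Y) (LinearMap.snd R X Y)).extZero_middle_left (h.2 Z hZ) (h'.2 Z hZ)⟩
  obtain ⟨n, p, hp⟩ := h.1
  obtain ⟨m, q, hq⟩ := h'.1
  exact ((IsAdd.refl.pow n).prod (IsAdd.refl.pow m)).isGen.of_surjective
    (p := p.prodMap q) (hp.prodMap hq)

/-- `Gen M` is closed under extensions if `M` is `Ext`-projective in it: a surjection from a power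
of `M` onto the quotient lifts. -/
theorem IsGen.of_isSES {f : X →ₗ[R] N} {g : N →ₗ[R] Y} (h : IsSES f g)
    (hM : ExtZero R M X) (hX : IsGen R M X) (hY : IsGen R M Y) : IsGen R M N := by
  obtain ⟨n, p, hp⟩ := hX
  obtain ⟨m, q, hq⟩ := hY
  obtain ⟨q', hq'⟩ := h.exists_lift (.pi_left (M := fun _ : Fin m => M) fun _ => hM) q
  refine ((IsAdd.refl.pow n).prod (IsAdd.refl.pow m)).isGen.of_surjective
    (p := LinearMap.coprod (f ∘ₗ p) q') fun x => ?_
  obtain ⟨b, hb⟩ := hq (g x)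
  have h0 : g (x - q' b) = 0 := by
    rw [map_sub, ← hb, ← hq', LinearMap.comp_apply, sub_self]
  obtain ⟨y, hy⟩ := (h.exact _).1 h0
  obtain ⟨a, rfl⟩ := hp y
  exact ⟨(a, b), by simp [hy]⟩

theorem exists_surjective_of_annihilator_le [Module.Finite R X] {K : Ideal R}
    (hK : K ≤ Module.annihilator R X) :
    ∃ (n : ℕ) (p : (Fin n → R ⧸ K) →ₗ[R] X), Function.Surjective p := by
  obtain ⟨n, s, hs⟩ := Module.Finite.exists_fin (R := R) (M := X)
  let q : Fin n → (R ⧸ K) →ₗ[R] X := fun i => K.liftQ (LinearMap.toSpanSingleton R X (s i))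
    fun r hr => Module.mem_annihilator.1 (hK hr) (s i)
  refine ⟨n, ∑ i, q i ∘ₗ LinearMap.proj i, fun x => ?_⟩
  obtain ⟨c, hc⟩ := (Submodule.mem_span_range_iff_exists_fun R).1 (hs ▸ Submodule.mem_top :
    x ∈ Submodule.span R (Set.range s))
  refine ⟨fun i => K.mkQ (c i), ?_⟩
  rw [← hc, LinearMap.sum_apply]
  rfl

end

section Hereditary

variable (k : Type w) [Field k] [Algebra k R] [Module.Finite k R]
variable {M X Y N : Type t} [AddCommGroup M] [Module R M] [AddCommGroup X] [Module R X]
  [AddCommGroup Y] [Module R Y] [AddCommGroup N] [Module R N]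

theorem projective_annihilator (hR : IsHereditaryFG R) :
    Module.Projective R (Module.annihilator R M) :=
  (IsSES.of_submodule (Module.annihilator R M)).projective_of_pdLEOne
    (hR (ModuleCat.of R (R ⧸ Module.annihilator R M)) inferInstance)

variable [Module.Finite R M]

include k

/-- As `R / ann M` embeds into a power of `M`, it has no extensions by `M`; so a homomorphism from
`ann M` to `M` extends to `R`, and the extension vanishes on `ann M`. -/
theorem hom_annihilator_eq_zero_of_rigid (hR : IsHereditaryFG R) (hM : ExtZero R M M)
    (f : Module.annihilator R M →ₗ[R] M) : f = 0 := by
  obtain ⟨n, φ, hφ⟩ := exists_injective_quotient_annihilator R k M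
  have : IsArtinianRing R := IsArtinianRing.of_finite k R
  have h1 : ExtZero R (R ⧸ Module.annihilator R M) M :=
    (IsSES.of_injective hφ).extZero_left
      (hR (ModuleCat.of R ((Fin n → M) ⧸ LinearMap.range φ)) inferInstance)
      (.pi_left fun _ => hM)
  obtain ⟨q, rfl⟩ := (IsSES.of_submodule (Module.annihilator R M)).exists_extend h1 f
  refine LinearMap.ext fun x => ?_
  have : q x.1 = x.1 • q 1 := by rw [← map_smul, smul_eq_mul, mul_one]
  exact this.trans (Module.mem_annihilator.1 x.2 _)

/-- There are no nonzero homomorphisms from the annihilator of a rigid module to modules over the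
quotient by it: the annihilator is projective, and such homomorphisms factor through submodules of
powers of `M`. -/
theorem hom_annihilator_eq_zero (hR : IsHereditaryFG R) (hM : ExtZero R M M)
    (hN : Module.annihilator R M ≤ Module.annihilator R N)
    (f : Module.annihilator R M →ₗ[R] N) : f = 0 := by
  have : IsArtinianRing R := IsArtinianRing.of_finite k R
  have := projective_annihilator hR (M := M)
  have hle : Module.annihilator R M ≤ Module.annihilator R (LinearMap.range f) := fun r hr =>
    Module.mem_annihilator.2 fun x => Subtype.ext (Module.mem_annihilator.1 (hN hr) x.1)
  obtain ⟨n, p, hp⟩ := exists_surjective_of_annihilator_le hle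
  obtain ⟨m, φ, hφ⟩ := exists_injective_quotient_annihilator R k M
  obtain ⟨g, hg⟩ := Module.projective_lifting_property p f.rangeRestrict hp
  have hg0 : g = 0 := by
    refine LinearMap.ext fun x => funext fun i => hφ (funext fun j => ?_)
    have := hom_annihilator_eq_zero_of_rigid k hR hM
      (LinearMap.proj j ∘ₗ φ ∘ₗ LinearMap.proj i ∘ₗ g)
    simpa using LinearMap.congr_fun this x
  refine LinearMap.ext fun x => ?_
  have := LinearMap.congr_fun hg x
  rw [hg0, LinearMap.comp_zero, LinearMap.zero_apply] at this
  exact congrArg Subtype.val this.symm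

theorem extZero_quotient_annihilator (hR : IsHereditaryFG R) (hM : ExtZero R M M)
    (hN : Module.annihilator R M ≤ Module.annihilator R N) :
    ExtZero R (R ⧸ Module.annihilator R M) N :=
  (IsSES.of_submodule (Module.annihilator R M)).extZero_of_extend extZero_of_projective
    fun p => ⟨0, by rw [hom_annihilator_eq_zero k hR hM hN p, LinearMap.zero_comp]⟩

/-- If `R / ann M` has a coresolution in `add M`, then `add M` contains every `Ext`-projective
object of `Gen M`. -/
theorem HasTiltingSequence.isAdd_of_isGenExtProjective (hs : HasTiltingSequence R M)
    (hM : ExtZero R M M) (hX : IsGenExtProjective R M X) : IsAdd R M X := by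
  have : IsArtinianRing R := IsArtinianRing.of_finite k R
  obtain ⟨A, C, f, g, hfg, hA, hC⟩ := hs
  have := hX.1.finite
  obtain ⟨n, ψ, hψ⟩ := exists_right_approximation R k X M
  have hsurj : Function.Surjective ψ := by
    obtain ⟨m, p, hp⟩ := hX.1
    choose q hq using fun i => hψ (p ∘ₗ LinearMap.single R (fun _ : Fin m => M) i)
    intro x
    obtain ⟨y, rfl⟩ := hp x
    refine ⟨∑ i, q i (y i), ?_⟩
    rw [map_sum]
    conv_rhs => rw [← Finset.univ_sum_single y, map_sum]
    exact Finset.sum_congr rfl fun i _ => LinearMap.congr_fun (hq i) (y i)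
  have hses := IsSES.of_surjective hsurj
  -- the kernel `L` of the approximation satisfies `Ext¹(M, L) = 0`
  have hL : ExtZero R M (LinearMap.ker ψ) :=
    hses.extZero_of_lift (.pi_right fun _ => hM) hψ
  have hKL : Module.annihilator R M ≤ Module.annihilator R (LinearMap.ker ψ) := fun r hr =>
    Module.mem_annihilator.2 fun x => Subtype.ext (funext fun i =>
      Module.mem_annihilator.1 hr (x.1 i))
  obtain ⟨m, p, hp⟩ := exists_surjective_of_annihilator_le hKL
  -- hence a surjection from a power of `R / ann M` onto `L` extends to a power of `A`
  have hpow : IsSES (LinearMap.pi fun i => f ∘ₗ LinearMap.proj i :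
      (Fin m → R ⧸ Module.annihilator R M) →ₗ[R] (Fin m → A))
      (LinearMap.pi fun i => g ∘ₗ LinearMap.proj i : (Fin m → A) →ₗ[R] (Fin m → C)) := by
    refine ⟨fun x y h => funext fun i => hfg.inj (congrFun h i), fun x => ⟨fun h => ?_, ?_⟩,
      fun y => ?_⟩
    · choose z hz using fun i => (hfg.exact (x i)).1 (congrFun h i)
      exact ⟨z, funext hz⟩
    · rintro ⟨z, rfl⟩
      exact funext fun i => hfg.exact.apply_apply_eq_zero (z i)
    · choose x hx using fun i => hfg.surj (y i)
      exact ⟨x, funext hx⟩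
  obtain ⟨q, hq⟩ := hpow.exists_extend (hL.of_isAdd (hC.pow m)) p
  have hLgen : IsGen R M (LinearMap.ker ψ) :=
    (hA.pow m).isGen.of_surjective (p := q) fun x => by
      obtain ⟨y, rfl⟩ := hp x
      exact ⟨_, LinearMap.congr_fun hq y⟩
  obtain ⟨s, hs⟩ := hses.exists_lift (hX.2 (ModuleCat.of R (LinearMap.ker ψ)) hLgen) LinearMap.id
  exact ⟨n, s, ψ, hs⟩

/-- A module that embeds into a power of `M`, and whose maps to objects of `Gen M` lift along
quotients of powers of `M`, is the kernel of a surjection from a power of `M` to an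
`Ext`-projective object of `Gen M`. -/
theorem exists_coresolution [Module.Finite R X] (hM : IsGenExtProjective R M M)
    {r : ℕ} {j : X →ₗ[R] (Fin r → M)} (hj : Function.Injective j)
    (hl : ∀ (Y : ModuleCat.{t} R) (l : ℕ) (p : (Fin l → M) →ₗ[R] Y), Function.Surjective p →
      ∀ f : X →ₗ[R] Y, ∃ f' : X →ₗ[R] (Fin l → M), p ∘ₗ f' = f) :
    ∃ (m : ℕ) (C : ModuleCat.{t} R) (f : X →ₗ[R] (Fin m → M)) (g : (Fin m → M) →ₗ[R] C),
      IsSES f g ∧ IsGenExtProjective R M C := by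
  obtain ⟨m, φ, hφ⟩ := exists_left_approximation R k X M
  have hinj : Function.Injective φ := by
    intro x y hxy
    refine hj (funext fun i => ?_)
    obtain ⟨g, hg⟩ := hφ (LinearMap.proj i ∘ₗ j)
    have h1 := LinearMap.congr_fun hg x
    have h2 := LinearMap.congr_fun hg y
    rw [LinearMap.comp_apply] at h1 h2
    rw [← hxy] at h2
    exact h1.symm.trans h2
  have hses := IsSES.of_injective hinj
  refine ⟨m, ModuleCat.of R ((Fin m → M) ⧸ LinearMap.range φ), φ, _, hses,
    (IsAdd.refl.pow m).isGen.of_surjective hses.surj, fun Y hY => ?_⟩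
  refine hses.extZero_of_extend (.pi_left fun _ => hM.2 Y hY) fun f => ?_
  obtain ⟨l, p, hp⟩ := hY
  obtain ⟨f', rfl⟩ := hl Y l p hp f
  choose q hq using fun i => hφ (LinearMap.proj i ∘ₗ f')
  exact ⟨p ∘ₗ LinearMap.pi q, LinearMap.ext fun x => congrArg p (funext fun i =>
    LinearMap.congr_fun (hq i) x)⟩

/-- The left approximation of `R / ann M` by a power of `M` has an `Ext`-projective cokernel. If
`M` is support tilting then this cokernel is in `add M`; in general it completes `M` to a support
tilting module. -/
theorem exists_coresolution_quotient_annihilator (hM : IsGenExtProjective R M M) :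
    ∃ (m : ℕ) (C : ModuleCat.{t} R) (f : (R ⧸ Module.annihilator R M) →ₗ[R] (Fin m → M))
      (g : (Fin m → M) →ₗ[R] C), IsSES f g ∧ IsGenExtProjective R M C := by
  obtain ⟨n, j, hj⟩ := exists_injective_quotient_annihilator R k M
  refine exists_coresolution k hM hj fun Y l p hp f => ?_
  obtain ⟨y, hy⟩ := hp (f (Submodule.Quotient.mk 1))
  refine ⟨(Module.annihilator R M).liftQ (LinearMap.toSpanSingleton R _ y) fun a ha =>
    funext fun i => Module.mem_annihilator.1 ha (y i), Submodule.linearMap_qext _ ?_⟩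
  refine LinearMap.ext_ring ?_
  change p ((1 : R) • y) = _
  rw [one_smul]
  exact hy

end Hereditary

end Rigid

/-! ### Tilting modules over the quotient by the annihilator -/

section Quotient

variable {R : Type t} [Ring R] {K : Ideal R} [K.IsTwoSided]

section

variable {X Y Z : Type t} [AddCommGroup X] [AddCommGroup Y] [AddCommGroup Z] [Module R X]
  [Module R Y] [Module R Z] [Module (R ⧸ K) X] [Module (R ⧸ K) Y] [Module (R ⧸ K) Z]
  [IsScalarTower R (R ⧸ K) X] [IsScalarTower R (R ⧸ K) Y] [IsScalarTower R (R ⧸ K) Z]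

theorem mk_smul_eq (r : R) (x : X) : (Ideal.Quotient.mk K r) • x = r • x := by
  rw [← one_smul (R ⧸ K) x, ← smul_assoc, ← smul_assoc, smul_eq_mul, mul_one]
  congr 1
  change _ = Ideal.Quotient.mk K (r * 1)
  rw [mul_one]

/-- An `R`-linear map between `R ⧸ K`-modules is linear over `R ⧸ K`. -/
def LinearMap.toQuotientScalars (f : X →ₗ[R] Y) : X →ₗ[R ⧸ K] Y where
  toFun := f
  map_add' := f.map_add
  map_smul' b x := by
    obtain ⟨r, rfl⟩ := Ideal.Quotient.mk_surjective b
    rw [mk_smul_eq, RingHom.id_apply, mk_smul_eq, map_smul]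

variable (K) in
theorem isRetract_quotient_iff : IsRetract (R ⧸ K) X Y ↔ IsRetract R X Y :=
  ⟨fun ⟨i, r, h⟩ => ⟨i.restrictScalars R, r.restrictScalars R,
    LinearMap.ext fun x => LinearMap.congr_fun h x⟩,
   fun ⟨i, r, h⟩ => ⟨i.toQuotientScalars, r.toQuotientScalars,
    LinearMap.ext fun x => LinearMap.congr_fun h x⟩⟩

variable (K) in
theorem isAdd_quotient_iff : IsAdd (R ⧸ K) X Y ↔ IsAdd R X Y :=
  exists_congr fun _ => isRetract_quotient_iff K

theorem IsSES.restrictScalars {f : X →ₗ[R ⧸ K] Y} {g : Y →ₗ[R ⧸ K] Z} (h : IsSES f g) :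
    IsSES (f.restrictScalars R) (g.restrictScalars R) :=
  ⟨h.inj, h.exact, h.surj⟩

theorem IsSES.toQuotientScalars {f : X →ₗ[R] Y} {g : Y →ₗ[R] Z} (h : IsSES f g) :
    IsSES (f.toQuotientScalars (K := K)) (g.toQuotientScalars (K := K)) :=
  ⟨h.inj, h.exact, h.surj⟩

/-- An extension that splits over `R` splits over `R ⧸ K`. -/
theorem ExtZero.toQuotient (h : ExtZero R X Y) : ExtZero (R ⧸ K) X Y := by
  have hs : Function.Surjective (Finsupp.linearCombination (R ⧸ K) (id : X → X)) :=
    fun x => ⟨Finsupp.single x 1, by simp⟩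
  refine (IsSES.of_surjective hs).extZero_of_extend extZero_of_projective fun p => ?_
  obtain ⟨q, hq⟩ := (IsSES.of_surjective hs).restrictScalars.exists_extend (R := R) h
    (p.restrictScalars R)
  exact ⟨q.toQuotientScalars, LinearMap.ext fun x => LinearMap.congr_fun hq x⟩

end

/-- Projective dimension at most one passes from `R` to `R ⧸ K` if `R ⧸ K` has no extensions
over `R` by `R ⧸ K`-modules. -/
theorem pdLEOne_quotient (h : ∀ N : ModuleCat.{t} R, K ≤ Module.annihilator R N →
      ExtZero R (R ⧸ K) N) {M : Type t} [AddCommGroup M] [Module R M] [Module (R ⧸ K) M]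
    [IsScalarTower R (R ⧸ K) M] [Module.Finite (R ⧸ K) M] (hM : PdLEOne R M) :
    PdLEOne (R ⧸ K) M := by
  obtain ⟨n, p, hp⟩ := Module.Finite.exists_fin' (R ⧸ K) M
  have hses := IsSES.of_surjective hp
  -- the kernel is projective because its extensions over `R` by `R ⧸ K`-modules split
  have : Module.Projective (R ⧸ K) (LinearMap.ker p) := projective_of_extZero fun N => by
    let : Module R N := Module.compHom N (Ideal.Quotient.mk K)
    have : IsScalarTower R (R ⧸ K) N := ⟨fun r b x => by
      obtain ⟨s, rfl⟩ := Ideal.Quotient.mk_surjective b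
      exact mul_smul (Ideal.Quotient.mk K r) (Ideal.Quotient.mk K s) x⟩
    have hN : K ≤ Module.annihilator R N := fun r hr => Module.mem_annihilator.2 fun x => by
      change Ideal.Quotient.mk K r • x = 0
      rw [Ideal.Quotient.eq_zero_iff_mem.2 hr, zero_smul]
    exact (hses.restrictScalars.extZero_left (R := R) hM
      (.pi_left fun _ => h (ModuleCat.of R N) hN)).toQuotient
  exact hses.pdLEOne_of_projective

/-- For a rigid module, only the exact sequence in the definition of tilting modules over
`R / ann M` is a condition, and it can be checked over `R`. -/
theorem isTiltingModule_iff_hasTiltingSequence (k : Type w) [Field k] [Algebra k R]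
    [Module.Finite k R] (hR : IsHereditaryFG R) (M : ModuleCat.{t} R) [Module.Finite R M]
    (hM : ExtZero R M M) :
    IsTiltingModule (overAnnihilatorQuotient M) ↔ HasTiltingSequence R M := by
  let K := Module.annihilator R M
  let : Module (R ⧸ K) M := Module.quotientAnnihilator
  have : IsScalarTower R (R ⧸ K) M := (Module.isTorsionBySet_annihilator R M).isScalarTower
  constructor
  · rintro ⟨-, S, hS, ⟨e⟩, h₂, h₃⟩
    let hR (N : ModuleCat.{t} (R ⧸ K)) : Module R N := Module.compHom N (Ideal.Quotient.mk K)
    have (N : ModuleCat.{t} (R ⧸ K)) : IsScalarTower R (R ⧸ K) N := ⟨fun r b x => by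
      obtain ⟨s, rfl⟩ := Ideal.Quotient.mk_surjective b
      exact mul_smul (Ideal.Quotient.mk K r) (Ideal.Quotient.mk K s) x⟩
    have h := (IsSES.of_shortExact hS).restrictScalars (R := R) (K := K)
    let φ : (R ⧸ K) →ₗ[R] S.X₁ := e.symm.toLinearEquiv.toLinearMap.restrictScalars R
    have hφ : Function.Bijective φ := e.symm.toLinearEquiv.bijective
    refine ⟨ModuleCat.of R S.X₂, ModuleCat.of R S.X₃, (S.f.hom.restrictScalars R) ∘ₗ φ,
      S.g.hom.restrictScalars R, ⟨h.inj.comp hφ.1, fun x => ?_, h.surj⟩,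
      (isAdd_quotient_iff K (X := M) (Y := S.X₂)).1 (addClosure_iff.1 h₂),
      (isAdd_quotient_iff K (X := M) (Y := S.X₃)).1 (addClosure_iff.1 h₃)⟩
    refine (h.exact x).trans ⟨?_, ?_⟩
    · rintro ⟨y, rfl⟩
      obtain ⟨z, rfl⟩ := hφ.2 y
      exact ⟨z, rfl⟩
    · rintro ⟨z, rfl⟩
      exact ⟨φ z, rfl⟩
  · rintro ⟨A, C, f, g, h, hA, hC⟩
    have : Module.Finite (R ⧸ K) M := Module.Finite.of_restrictScalars_finite R _ _
    refine ⟨⟨hM.toQuotient (K := K), pdLEOne_quotient (K := K) (fun N hN =>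
      extZero_quotient_annihilator k hR hM hN) (hR M ‹_›)⟩, ?_⟩
    have hAt : Module.IsTorsionBySet R A K := fun x r =>
      Module.mem_annihilator.1 (hA.isGen.annihilator_le r.2) x
    have hCt : Module.IsTorsionBySet R C K := fun x r =>
      Module.mem_annihilator.1 (hC.isGen.annihilator_le r.2) x
    let : Module (R ⧸ K) A := hAt.module
    let : Module (R ⧸ K) C := hCt.module
    have : IsScalarTower R (R ⧸ K) A := hAt.isScalarTower
    have : IsScalarTower R (R ⧸ K) C := hCt.isScalarTower
    have h' := IsSES.toQuotientScalars (K := K) h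
    exact ⟨_, h'.shortExact, ⟨Iso.refl _⟩,
      addClosure_iff.2 ((isAdd_quotient_iff K (X := M) (Y := A)).2 hA),
      addClosure_iff.2 ((isAdd_quotient_iff K (X := M) (Y := C)).2 hC)⟩

end Quotient

/-! ### Generators of torsion classes -/

section Generators

variable {R : Type t} [Ring R]

/-- Nakayama's lemma over the local ring of endomorphisms of an indecomposable module. -/
theorem Indec.eq_top_of_sup_eq_top (k : Type w) [Field k] [Algebra k R] [Module.Finite k R]
    {X : Type t} [AddCommGroup X] [Module R X] [Module.Finite R X] (hX : Indec R X)
    (N : Submodule R X) (hN : ∀ (u : Module.End R X), ∀ x ∈ N, u x ∈ N)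
    (h : ∀ x : X, x ∈ N ⊔ ⨆ u : {u : Module.End R X // ¬ IsUnit u}, LinearMap.range u.1) :
    N = ⊤ := by
  have : IsArtinianRing R := IsArtinianRing.of_finite k R
  let : Module k X := Module.compHom X (algebraMap k R)
  have : IsScalarTower k R X := IsScalarTower.of_algebraMap_smul fun _ _ => rfl
  have : Module.Finite k X := Module.Finite.trans R X
  have : SMulCommClass R k X := IsScalarTower.to_smulCommClass'
  have : IsScalarTower k (Module.End R X) X := ⟨fun _ _ _ => rfl⟩
  have : Module.Finite (Module.End R X) X := Module.Finite.of_restrictScalars_finite k _ _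
  let N' : Submodule (Module.End R X) X := { N.toAddSubmonoid with smul_mem' := fun u x => hN u x }
  have hJ : ∀ u : Module.End R X, ¬ IsUnit u → u ∈ Ring.jacobson (Module.End R X) := by
    intro u hu
    rw [← Ideal.jacobson_bot, Ideal.mem_jacobson_iff]
    intro y
    have hyu : ¬ IsUnit (y * u) := fun h => hu <| by
      have hinj : Function.Injective u := Function.Injective.of_comp (f := y)
        ((Module.End.isUnit_iff _).1 h).1
      exact (Module.End.isUnit_iff _).2
        ⟨hinj, IsArtinian.surjective_of_injective_endomorphism u hinj⟩
    obtain ⟨z, hz⟩ := ((hX.isNilpotent_or_isUnit (y * u)).resolve_right hyu).isUnit_one_add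
    refine ⟨↑z⁻¹, ?_⟩
    rw [Ideal.mem_bot, mul_assoc, sub_eq_zero, ← z.inv_mul, hz, mul_add, mul_one, add_comm]
  by_contra hne
  have hne' : N' ≠ ⊤ := fun h => hne (SetLike.ext fun x => SetLike.ext_iff.1 h x)
  have : Nontrivial (X ⧸ N') := Submodule.Quotient.nontrivial_iff.2 hne'
  refine (Submodule.jacobson_smul_lt_top (R := Module.End R X) (M := X ⧸ N') ⊤).ne
    (Submodule.eq_top_iff'.2 fun q => ?_)
  obtain ⟨x, rfl⟩ := N'.mkQ_surjective q
  obtain ⟨a, ha, b, hb, rfl⟩ := Submodule.mem_sup.1 (h x)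
  rw [map_add, N'.mkQ_apply a, (Submodule.Quotient.mk_eq_zero N').2 ha, zero_add]
  induction hb using Submodule.iSup_induction' with
  | mem u y hy =>
    obtain ⟨z, rfl⟩ := hy
    have : N'.mkQ (u.1 z) = u.1 • N'.mkQ z := (map_smul N'.mkQ u.1 z)
    rw [this]
    exact Submodule.smul_mem_smul (hJ u.1 u.2) Submodule.mem_top
  | zero => rw [map_zero]; exact Submodule.zero_mem _
  | add y z _ _ hy hz => rw [map_add]; exact Submodule.add_mem _ hy hz

/-- The modules of the family `X` generate `Z`: the images of their homomorphisms to `Z` span it. -/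
def GeneratedBy {n : ℕ} (X : Fin n → ModuleCat.{t} R) (Z : Type t) [AddCommGroup Z]
    [Module R Z] : Prop :=
  (⨆ i, ⨆ f : X i →ₗ[R] Z, LinearMap.range f) = ⊤

theorem range_le_trace {n : ℕ} (X : Fin n → ModuleCat.{t} R) {Z : Type t} [AddCommGroup Z]
    [Module R Z] (i : Fin n) (f : X i →ₗ[R] Z) :
    LinearMap.range f ≤ ⨆ i, ⨆ f : X i →ₗ[R] Z, LinearMap.range f :=
  le_iSup_of_le i (le_iSup (fun f : X i →ₗ[R] Z => LinearMap.range f) f)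

theorem map_trace_le {n : ℕ} (X : Fin n → ModuleCat.{t} R) {Y Z : Type t} [AddCommGroup Y]
    [Module R Y] [AddCommGroup Z] [Module R Z] (g : Y →ₗ[R] Z) :
    (⨆ i, ⨆ f : X i →ₗ[R] Y, LinearMap.range f).map g ≤
      ⨆ i, ⨆ f : X i →ₗ[R] Z, LinearMap.range f := by
  simp only [Submodule.map_iSup]
  refine iSup_le fun i => iSup_le fun f => ?_
  rw [← LinearMap.range_comp]
  exact range_le_trace X i (g ∘ₗ f)

theorem generatedBy_iff (k : Type w) [Field k] [Algebra k R] [Module.Finite k R] {n : ℕ}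
    (X : Fin n → ModuleCat.{t} R) [∀ i, Module.Finite R (X i)] (Z : Type t) [AddCommGroup Z]
    [Module R Z] [Module.Finite R Z] : GeneratedBy X Z ↔ IsGen R (∀ i, X i) Z := by
  classical
  constructor
  · intro h
    choose m ψ hψ using fun i => exists_right_approximation R k Z (X i)
    refine IsGen.of_surjective (p := ∑ i, ψ i ∘ₗ LinearMap.proj i) (X := ∀ i, Fin (m i) → X i) ?_
      (IsAdd.pi fun i => (IsRetract.single (M := fun i => X i) i).isAdd.pow (m i)).isGen
    rw [← LinearMap.range_eq_top, eq_top_iff, ← h]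
    refine iSup_le fun i => iSup_le fun f => ?_
    obtain ⟨g, rfl⟩ := hψ i f
    rintro _ ⟨x, rfl⟩
    refine ⟨Pi.single i (g x), ?_⟩
    rw [LinearMap.sum_apply, Finset.sum_eq_single i]
    · simp
    · intro j _ hj
      simp [Pi.single_eq_of_ne hj]
    · simp
  · rintro ⟨m, p, hp⟩
    refine eq_top_iff.2 fun z _ => ?_
    obtain ⟨y, rfl⟩ := hp z
    rw [← Finset.univ_sum_single y, map_sum]
    refine Submodule.sum_mem _ fun j _ => ?_
    rw [← Finset.univ_sum_single (y j)]
    have : (Pi.single j (∑ i, Pi.single i (y j i)) : Fin m → ∀ i, X i) =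
      ∑ i, Pi.single j (Pi.single i (y j i)) :=
      map_sum (LinearMap.single R (fun _ : Fin m => ∀ i, X i) j) _ _
    rw [this, map_sum]
    refine Submodule.sum_mem _ fun i _ => range_le_trace X i
      (p ∘ₗ LinearMap.single R (fun _ : Fin m => ∀ i, X i) j ∘ₗ
        LinearMap.single R (fun i => X i) i) ⟨y j i, rfl⟩

/-- A torsion class of finitely generated modules that is generated by finitely many of its
indecomposable modules. -/
structure IsFinGenTorsion (T : ObjectProperty (ModuleCat.{t} R)) : Prop where
  finite : ∀ X, T X → Module.Finite R X
  zero : ∀ X : ModuleCat.{t} R, Subsingleton X → T X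
  quotients : ∀ X Y : ModuleCat.{t} R, T X → ∀ f : X →ₗ[R] Y, Function.Surjective f → T Y
  extensions : ∀ (X Y Z : ModuleCat.{t} R) (f : X →ₗ[R] Y) (g : Y →ₗ[R] Z), IsSES f g →
    T X → T Z → T Y
  generators : ∃ (n : ℕ) (X : Fin n → ModuleCat.{t} R), (∀ i, Indec R (X i)) ∧ (∀ i, T (X i)) ∧
    ∀ Z, T Z → IsGen R (∀ i, X i) Z

namespace IsFinGenTorsion

variable {T : ObjectProperty (ModuleCat.{t} R)} (hT : IsFinGenTorsion T)
include hT

theorem pi {n : ℕ} (X : Fin n → ModuleCat.{t} R) (hX : ∀ i, T (X i)) :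
    T (ModuleCat.of R (∀ i, X i)) := by
  induction n with
  | zero => exact hT.zero _ (inferInstanceAs (Subsingleton (∀ i : Fin 0, X i)))
  | succ n ih =>
    refine hT.extensions (ModuleCat.of R (∀ i : Fin n, X i.succ)) _ (X 0)
      (LinearMap.pi (Fin.cases 0 fun i => LinearMap.proj i)) (LinearMap.proj 0) ⟨?_, ?_, ?_⟩
      (ih _ fun i => hX i.succ) (hX 0)
    · exact fun x y h => funext fun i => congrFun h i.succ
    · intro x
      constructor
      · intro h
        refine ⟨fun i => x i.succ, funext fun i => ?_⟩
        refine Fin.cases ?_ (fun j => ?_) i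
        · exact h.symm
        · rfl
      · rintro ⟨y, rfl⟩
        rfl
    · exact LinearMap.proj_surjective 0

theorem of_isGen {M Y : ModuleCat.{t} R} (hM : T M) (h : IsGen R M Y) : T Y := by
  obtain ⟨n, p, hp⟩ := h
  exact hT.quotients _ _ (hT.pi (fun _ : Fin n => M) fun _ => hM) p hp

/-- A family of indecomposable generators of minimal size consists of `Ext`-projective modules:
by Nakayama's lemma, surjections from objects of the torsion class onto members of such a family
split. -/
theorem exists_extProjective_generators (k : Type w) [Field k] [Algebra k R] [Module.Finite k R] :
    ∃ (n : ℕ) (X : Fin n → ModuleCat.{t} R), (∀ i, T (X i)) ∧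
      (∀ Z, T Z → IsGen R (∀ i, X i) Z) ∧ ∀ i, ∀ Y, T Y → ExtZero R (X i) Y := by
  classical
  have hex : ∃ (n : ℕ) (X : Fin n → ModuleCat.{t} R), (∀ i, Indec R (X i)) ∧ (∀ i, T (X i)) ∧
      ∀ Z, T Z → GeneratedBy X Z := by
    obtain ⟨n, X, hX, hXT, h⟩ := hT.generators
    have := fun i => hT.finite _ (hXT i)
    exact ⟨n, X, hX, hXT, fun Z hZ => have := hT.finite _ hZ
      (generatedBy_iff k X Z).2 (h Z hZ)⟩
  obtain ⟨X, hX, hXT, hgen⟩ := Nat.find_spec hex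
  have hmin := fun m => Nat.find_min hex (m := m)
  generalize Nat.find hex = n at X hX hXT hgen hmin
  have hfin := fun i => hT.finite _ (hXT i)
  refine ⟨n, X, hXT, fun Z hZ => have := hT.finite _ hZ
    (generatedBy_iff k X Z).1 (hgen Z hZ), fun i Y hY => extZero_of_split fun E a p hap => ?_⟩
  have hE : T E := hT.extensions (ModuleCat.of R Y) E (X i) a p hap hY (hXT i)
  by_contra hcon
  obtain _ | m := n
  · exact i.elim0
  have hnu : ∀ f : X i →ₗ[R] E, ¬ IsUnit (M := Module.End R (X i)) (p ∘ₗ f) := by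
    rintro f ⟨u, hu⟩
    refine hcon ⟨f ∘ₗ (↑u⁻¹ : Module.End R (X i)), ?_⟩
    have : (↑u : Module.End R (X i)) * ↑u⁻¹ = 1 := u.mul_inv
    rw [hu] at this
    exact this
  -- As `p` does not split, no map `X i ⟶ E ⟶ X i` is invertible, so `X i` is the sum of the images of
  -- its non-invertible endomorphisms and of `N`, the part of `X i` that is generated by the other members of the family
  let X' : Fin m → ModuleCat.{t} R := fun j => X (i.succAbove j)
  let N : Submodule R (X i) := ⨆ j, ⨆ f : X' j →ₗ[R] X i, LinearMap.range f
  have hNtop : N = ⊤ := by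
    refine (hX i).eq_top_of_sup_eq_top k N
      (fun u x hx => map_trace_le X' u ⟨x, hx, rfl⟩) fun x => ?_
    obtain ⟨e, rfl⟩ := hap.surj x
    have he : e ∈ (⨆ j, ⨆ f : X j →ₗ[R] E, LinearMap.range f) := by
      rw [show _ = ⊤ from hgen E hE]
      exact Submodule.mem_top
    suffices h : (⨆ j, ⨆ f : X j →ₗ[R] E, LinearMap.range f).map p ≤
        N ⊔ ⨆ u : {u : Module.End R (X i) // ¬ IsUnit u}, LinearMap.range u.1 from
      h ⟨e, he, rfl⟩
    simp only [Submodule.map_iSup]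
    refine iSup_le fun j => iSup_le fun f => ?_
    rw [← LinearMap.range_comp]
    rcases Fin.eq_self_or_eq_succAbove i j with rfl | ⟨j, rfl⟩
    · exact le_sup_of_le_right (le_iSup
        (fun u : {u : Module.End R (X j) // ¬ IsUnit u} => LinearMap.range u.1) ⟨_, hnu f⟩)
    · exact le_sup_of_le_left (range_le_trace X' j (p ∘ₗ f))
  -- so `X i` can be left out, against minimality
  refine hmin m (Nat.lt_succ_self m) ⟨X', fun j => hX _, fun j => hXT _, fun Z hZ => ?_⟩
  refine eq_top_iff.2 ?_
  rw [← show _ = ⊤ from hgen Z hZ]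
  refine iSup_le fun j => iSup_le fun f => ?_
  rcases Fin.eq_self_or_eq_succAbove i j with rfl | ⟨j, rfl⟩
  · rw [LinearMap.range_eq_map, ← hNtop]
    exact map_trace_le X' f
  · exact range_le_trace X' j f

theorem exists_extProjective_generator (k : Type w) [Field k] [Algebra k R] [Module.Finite k R] :
    ∃ P : ModuleCat.{t} R, T P ∧ (∀ Z, T Z ↔ IsGen R P Z) ∧ IsGenExtProjective R P P := by
  obtain ⟨n, X, hXT, hgen, hext⟩ := hT.exists_extProjective_generators k
  have hP := hT.pi X hXT
  exact ⟨ModuleCat.of R (∀ i, X i), hP, fun Z => ⟨hgen Z, hT.of_isGen hP⟩, IsAdd.refl.isGen,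
    fun Y hY => .pi_left fun i => hext i Y (hT.of_isGen hP hY)⟩

end IsFinGenTorsion

theorem HasTiltingSequence.of_isAdd {M N : Type t} [AddCommGroup M] [Module R M]
    [AddCommGroup N] [Module R N] (hM : HasTiltingSequence R M) (h : IsAdd R N M)
    (h' : IsGen R M N) : HasTiltingSequence R N := by
  have hann : Module.annihilator R N = Module.annihilator R M :=
    le_antisymm h.isGen.annihilator_le h'.annihilator_le
  rw [HasTiltingSequence, hann]
  obtain ⟨A, C, f, g, hfg, hA, hC⟩ := hM
  exact ⟨A, C, f, g, hfg, hA.trans h, hC.trans h⟩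

/-- A finitely generated torsion class is `Gen M` for a support tilting module `M`: the sum of an
`Ext`-projective generator `P` and the cokernel of a left approximation of `R / ann P`. -/
theorem IsFinGenTorsion.exists_supportTilting {T : ObjectProperty (ModuleCat.{t} R)}
    (hT : IsFinGenTorsion T) (k : Type w) [Field k] [Algebra k R] [Module.Finite k R] :
    ∃ (n : ℕ) (Y : Fin n → ModuleCat.{t} R), IsBasicFamily Y ∧
      (∀ Z, T Z ↔ IsGen R (∀ i, Y i) Z) ∧ ExtZero R (∀ i, Y i) (∀ i, Y i) ∧
      HasTiltingSequence R (∀ i, Y i) := by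
  have : IsArtinianRing R := IsArtinianRing.of_finite k R
  obtain ⟨P, hPT, hP, hext⟩ := hT.exists_extProjective_generator k
  have := hT.finite P hPT
  obtain ⟨m, C, f, g, hfg, hC⟩ := exists_coresolution_quotient_annihilator k hext
  have hN := hext.prod hC
  have hPN : IsAdd R (P × C) P := IsRetract.fst.isAdd
  have hts : HasTiltingSequence R (P × C) := by
    have hann : Module.annihilator R (P × C) = Module.annihilator R P :=
      le_antisymm hPN.isGen.annihilator_le hN.1.annihilator_le
    rw [HasTiltingSequence, hann]
    exact ⟨ModuleCat.of R (Fin m → P), C, f, g, hfg, hPN.pow m, IsRetract.snd.isAdd⟩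
  have hfinN : Module.Finite R (ModuleCat.of R (P × C)) := hN.1.finite
  obtain ⟨n, Y, hY, hr, ha⟩ := exists_basicFamily (ModuleCat.of R (P × C))
  have ha' : IsAdd R (P × C) (∀ i, Y i) := .pi fun i => (hr i).isAdd
  refine ⟨n, Y, hY, fun Z => (hP Z).trans ⟨fun h => (h.trans hPN.isGen).trans ha.isGen,
    fun h => (h.trans ha'.isGen).trans hN.1⟩, ?_, hts.of_isAdd ha ha'.isGen⟩
  exact ((hN.of_isAdd ha').2 (ModuleCat.of R (∀ i, Y i)) (ha'.isGen.trans hN.1))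

end Generators

/-! ### Homomorphisms between indecomposable modules without extensions -/

section HappelRingel

variable {R : Type t} [Ring R]

theorem LinearMap.exists_factor_of_surjective {A B C : Type*} [AddCommGroup A] [AddCommGroup B]
    [AddCommGroup C] [Module R A] [Module R B] [Module R C] {s : A →ₗ[R] B}
    (hs : Function.Surjective s) (g : A →ₗ[R] C) (h : LinearMap.ker s ≤ LinearMap.ker g) :
    ∃ r : B →ₗ[R] C, r ∘ₗ s = g := by
  refine ⟨(LinearMap.ker s).liftQ g h ∘ₗ (s.quotKerEquivOfSurjective hs).symm.toLinearMap,
    LinearMap.ext fun a => ?_⟩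
  have : (s.quotKerEquivOfSurjective hs).symm (s a) = (LinearMap.ker s).mkQ a := by
    rw [LinearEquiv.symm_apply_eq]
    rfl
  change (LinearMap.ker s).liftQ g h ((s.quotKerEquivOfSurjective hs).symm (s a)) = g a
  rw [this]
  rfl

variable {X Y : Type t} [AddCommGroup X] [Module R X] [AddCommGroup Y] [Module R Y]

/-- If `Ext¹(Y, X) = 0`, then the image `I` of a homomorphism `X ⟶ Y` is a direct summand of `X × Y`.
Indeed, lifting a presentation `p : R^n ⟶ Y / I` to `Y` makes `Y` the cokernel of a map
`ker p ⟶ I × R^n`. As `ker p` is projective, its component in `I` lifts to `X`, and this lift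
extends to `I × R^n`; so the sequence `0 ⟶ ker (X ⟶ I) ⟶ X ⟶ I ⟶ 0` comes from one that ends
in `Y`. -/
theorem isRetract_range [Module.Finite R Y] (hR : IsHereditaryFG R) (hE : ExtZero R Y X)
    (f : X →ₗ[R] Y) : IsRetract R (LinearMap.range f) (X × Y) := by
  set I := LinearMap.range f
  let f' : X →ₗ[R] I := f.rangeRestrict
  obtain ⟨n, p, hp⟩ := Module.Finite.exists_fin' R (Y ⧸ I)
  have hses := IsSES.of_surjective hp
  have := hses.projective_of_pdLEOne (hR (ModuleCat.of R (Y ⧸ I)) inferInstance)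
  obtain ⟨ψ, hψ⟩ := Module.projective_lifting_property I.mkQ p I.mkQ_surjective
  have hψI : ∀ l : LinearMap.ker p, ψ l ∈ I := fun l => by
    rw [← Submodule.Quotient.mk_eq_zero, ← Submodule.mkQ_apply, ← LinearMap.comp_apply, hψ]
    exact l.2
  let ψ' : LinearMap.ker p →ₗ[R] I := (ψ ∘ₗ (LinearMap.ker p).subtype).codRestrict I hψI
  obtain ⟨φ, hφ⟩ := Module.projective_lifting_property f' ψ' f.surjective_rangeRestrict
  let ι : LinearMap.ker p →ₗ[R] I × (Fin n → R) := LinearMap.prod (-ψ') (LinearMap.ker p).subtype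
  let s : I × (Fin n → R) →ₗ[R] Y := LinearMap.coprod I.subtype ψ
  have hs : IsSES ι s := by
    refine ⟨fun a b h => Subtype.ext (congrArg Prod.snd h), fun z => ⟨fun hz => ?_, ?_⟩,
      fun y => ?_⟩
    · obtain ⟨i, q⟩ := z
      have hz' : (i : Y) + ψ q = 0 := hz
      have hq : p q = 0 := by
        rw [← hψ, LinearMap.comp_apply, Submodule.mkQ_apply, Submodule.Quotient.mk_eq_zero,
          eq_neg_of_add_eq_zero_right hz']
        exact I.neg_mem i.2
      refine ⟨⟨q, hq⟩, Prod.ext (Subtype.ext ?_) rfl⟩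
      change -ψ q = i
      exact (eq_neg_of_add_eq_zero_left hz').symm
    · rintro ⟨l, rfl⟩
      change -ψ l + ψ l = 0
      exact neg_add_cancel _
    · obtain ⟨q, hq⟩ := hp (I.mkQ y)
      rw [← hψ] at hq
      exact ⟨(⟨y - ψ q, (Submodule.Quotient.eq I).1 hq.symm⟩, q), sub_add_cancel _ _⟩
  obtain ⟨h, hh⟩ := hs.exists_extend hE φ
  obtain ⟨r, hr⟩ := LinearMap.exists_factor_of_surjective hs.surj
    (LinearMap.fst R I (Fin n → R) + f' ∘ₗ h) (by
      intro z hz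
      obtain ⟨l, rfl⟩ := (hs.exact z).1 hz
      change -ψ' l + f' (h (ι l)) = 0
      rw [show h (ι l) = φ l from LinearMap.congr_fun hh l,
        show f' (φ l) = ψ' l from LinearMap.congr_fun hφ l, neg_add_cancel])
  refine ⟨LinearMap.prod (-(h ∘ₗ LinearMap.inl R I _)) I.subtype, LinearMap.coprod f' r,
    LinearMap.ext fun i => ?_⟩
  have h1 : r (i : Y) = i + f' (h (i, 0)) := by
    have := LinearMap.congr_fun hr (i, 0)
    have h2 : s (i, 0) = i := by simp [s]
    rw [LinearMap.comp_apply, h2] at this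
    exact this
  change f' (-h (i, 0)) + r (i : Y) = i
  rw [h1, map_neg]
  abel

/-- The Happel–Ringel lemma: by the Krull–Schmidt theorem, an indecomposable summand of the image is
isomorphic to `X` or to `Y`, so the image has the length of `X` or of `Y`. -/
theorem Indec.injective_or_surjective [IsArtinianRing R] [Module.Finite R X] [Module.Finite R Y]
    (hR : IsHereditaryFG R) (hX : Indec R X) (hY : Indec R Y) (hE : ExtZero R Y X)
    {f : X →ₗ[R] Y} (hf : f ≠ 0) : Function.Injective f ∨ Function.Surjective f := by
  have hI := isRetract_range hR hE f
  have : Nontrivial (LinearMap.range f) := by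
    rw [Submodule.nontrivial_iff_ne_bot]
    exact fun h => hf (LinearMap.range_eq_bot.1 h)
  obtain ⟨Z, Z', hZ, ⟨e⟩⟩ := exists_indec_summand (R := R) (X := LinearMap.range f)
  have hZI : IsRetract R Z (LinearMap.range f) := IsRetract.fst.trans (.of_equiv e.symm)
  have := hZI.finite
  have := hZ.1
  obtain ⟨i, hi⟩ := hZI.injective
  have hlen := Module.length_le_of_injective i hi
  refine ((hZI.trans hI).of_prod hZ).imp (fun h => ?_) (fun h => ?_)
  · obtain ⟨φ⟩ := h.nonempty_equiv hX
    rw [φ.length_eq] at hlen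
    by_contra hinj
    refine (length_lt_of_surjective (f := f.rangeRestrict) f.surjective_rangeRestrict ?_).not_ge
      hlen
    exact fun h => hinj fun a b hab => h (Subtype.ext hab)
  · obtain ⟨φ⟩ := h.nonempty_equiv hY
    rw [φ.length_eq] at hlen
    by_contra hsurj
    refine (length_lt_of_injective (f := (LinearMap.range f).subtype)
      (Submodule.injective_subtype _) ?_).not_ge hlen
    intro h
    refine hsurj (LinearMap.range_eq_top.1 ?_)
    rw [← LinearMap.range_eq_top, Submodule.range_subtype] at h
    exact h

/-- There are no oriented cycles of nonzero homomorphisms between pairwise non-isomorphic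
indecomposable modules without extensions: by the Happel–Ringel lemma, a proper epimorphism can
only be followed by proper epimorphisms. -/
theorem IsBasicFamily.exists_no_homs [IsArtinianRing R] (hR : IsHereditaryFG R) {n : ℕ}
    {Y : Fin n → ModuleCat.{t} R} (hY : IsBasicFamily Y) [∀ i, Module.Finite R (Y i)]
    (hE : ∀ i j, ExtZero R (Y i) (Y j)) {S : Set (Fin n)} (hS : S.Nonempty) :
    ∃ j ∈ S, ∀ i ∈ S, i ≠ j → ∀ f : Y j →ₗ[R] Y i, f = 0 := by
  by_contra! hcon
  have hbij : ∀ {i j} {f : Y j →ₗ[R] Y i}, i ≠ j → Function.Injective f →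
      ¬ Function.Surjective f := fun hij hi hs =>
    hij (hY.eq_of_equiv _ _ ⟨(LinearEquiv.ofBijective _ ⟨hi, hs⟩).symm⟩)
  have hepi : ∀ (l : ℕ∞) (j i : Fin n) (f : Y j →ₗ[R] Y i), j ∈ S → i ∈ S → i ≠ j →
      Function.Surjective f → Module.length R (Y i) = l → False := by
    intro l
    induction l using WellFoundedLT.induction with
    | ind l ih =>
      rintro j i f hj hi hij hf rfl
      obtain ⟨m, hm, hmi, g, hg⟩ := hcon i hi
      have hgs : Function.Surjective g := by
        refine ((hY.indec i).injective_or_surjective hR (hY.indec m) (hE m i) hg).resolve_left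
          fun hgi => ?_
        have hgf : g ∘ₗ f ≠ 0 := fun h0 => hg (LinearMap.ext fun y => by
          obtain ⟨x, rfl⟩ := hf y
          exact LinearMap.congr_fun h0 x)
        rcases (hY.indec j).injective_or_surjective hR (hY.indec m) (hE m j) hgf with h | h
        · exact hbij hij (Function.Injective.of_comp (f := g) h) hf
        · exact hbij hmi hgi (Function.Surjective.of_comp (g := f) h)
      exact ih _ (length_lt_of_surjective hgs fun h => hbij hmi h hgs) i m g hi hm hmi hgs rfl
  -- start with a member of maximal length
  obtain ⟨j, hj, hmax⟩ := S.toFinite.exists_maximalFor (fun i => Module.length R (Y i)) S hS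
  obtain ⟨i, hi, hij, f, hf⟩ := hcon j hj
  refine hepi _ j i f hj hi hij ?_ rfl
  refine ((hY.indec j).injective_or_surjective hR (hY.indec i) (hE i j) hf).resolve_left
    fun hinj => ?_
  have hlt := length_lt_of_injective hinj (hbij hij hinj)
  exact hlt.not_ge (hmax hi hlt.le)

end HappelRingel

/-! ### Dimension vectors -/

section DimensionVectors

variable {R : Type t} [Ring R] (k : Type w) [Field k] [Algebra k R]

section

variable (R) in
/-- The dimension over `k` of `Hom_R(P, X)`, where `k` acts on `X` through `R`. -/
def homDim (P X : Type t) [AddCommGroup P] [Module R P] [AddCommGroup X] [Module R X] : ℕ :=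
  letI : Module k X := Module.compHom X (algebraMap k R)
  haveI : IsScalarTower k R X := IsScalarTower.of_algebraMap_smul fun _ _ => rfl
  haveI : SMulCommClass R k X := IsScalarTower.to_smulCommClass'
  Module.finrank k (P →ₗ[R] X)

variable {A B C P X : Type t} [AddCommGroup A] [Module R A] [AddCommGroup B] [Module R B]
  [AddCommGroup C] [Module R C] [AddCommGroup P] [Module R P] [AddCommGroup X] [Module R X]

theorem finite_linearMap [Module.Finite k R] [Module.Finite R P] [Module.Finite R X] [Module k X]
    [IsScalarTower k R X] [SMulCommClass R k X] : Module.Finite k (P →ₗ[R] X) := by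
  let : Module k P := Module.compHom P (algebraMap k R)
  have : IsScalarTower k R P := IsScalarTower.of_algebraMap_smul fun _ _ => rfl
  have : Module.Finite k X := Module.Finite.trans R X
  have : Module.Finite k P := Module.Finite.trans R P
  exact Module.Finite.of_injective
    (LinearMap.restrictScalarsₗ k R P X k) (LinearMap.restrictScalars_injective k)

theorem homDim_ne_zero_iff [Module.Finite k R] [Module.Finite R P] [Module.Finite R X] :
    homDim R k P X ≠ 0 ↔ ∃ f : P →ₗ[R] X, f ≠ 0 := by
  let : Module k X := Module.compHom X (algebraMap k R)
  have : IsScalarTower k R X := IsScalarTower.of_algebraMap_smul fun _ _ => rfl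
  have : SMulCommClass R k X := IsScalarTower.to_smulCommClass'
  have hfin : Module.Finite k (P →ₗ[R] X) := finite_linearMap k
  exact Nat.pos_iff_ne_zero.symm.trans
    (Module.finrank_pos_iff_exists_ne_zero (R := k) (M := P →ₗ[R] X))

theorem homDim_congr_right (e : A ≃ₗ[R] B) : homDim R k P A = homDim R k P B := by
  let : Module k A := Module.compHom A (algebraMap k R)
  have : IsScalarTower k R A := IsScalarTower.of_algebraMap_smul fun _ _ => rfl
  have : SMulCommClass R k A := IsScalarTower.to_smulCommClass'
  let : Module k B := Module.compHom B (algebraMap k R)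
  have : IsScalarTower k R B := IsScalarTower.of_algebraMap_smul fun _ _ => rfl
  have : SMulCommClass R k B := IsScalarTower.to_smulCommClass'
  refine LinearEquiv.finrank_eq (R := k)
    { toFun := fun h => e.toLinearMap ∘ₗ h
      invFun := fun h => e.symm.toLinearMap ∘ₗ h
      map_add' := fun a b => LinearMap.comp_add _ _ _
      map_smul' := fun c a => LinearMap.ext fun x => e.map_smul (algebraMap k R c) (a x)
      left_inv := fun h => LinearMap.ext fun x => e.symm_apply_apply (h x)
      right_inv := fun h => LinearMap.ext fun x => e.apply_symm_apply (h x) }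

theorem homDim_eq_zero_of_subsingleton [Subsingleton X] : homDim R k P X = 0 := by
  let : Module k X := Module.compHom X (algebraMap k R)
  have : IsScalarTower k R X := IsScalarTower.of_algebraMap_smul fun _ _ => rfl
  have : SMulCommClass R k X := IsScalarTower.to_smulCommClass'
  have : Subsingleton (P →ₗ[R] X) := ⟨fun a b => LinearMap.ext fun x => Subsingleton.elim _ _⟩
  exact Module.finrank_zero_of_subsingleton (R := k) (M := P →ₗ[R] X)

theorem finrank_eq_add_of_exact {U V W : Type*} [AddCommGroup U] [Module k U] [AddCommGroup V]
    [Module k V] [AddCommGroup W] [Module k W] [Module.Finite k V] (f : U →ₗ[k] V) (g : V →ₗ[k] W)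
    (hf : Function.Injective f) (hg : Function.Surjective g) (h : Function.Exact f g) :
    Module.finrank k V = Module.finrank k U + Module.finrank k W := by
  rw [← g.finrank_range_add_finrank_ker, LinearMap.range_eq_top.2 hg, finrank_top,
    LinearMap.exact_iff.1 h, LinearMap.finrank_range_of_inj hf, add_comm]

variable [Module.Finite k R] {f : A →ₗ[R] B} {g : B →ₗ[R] C}

theorem IsSES.homDim_right (h : IsSES f g) (hE : ExtZero R P A) [Module.Finite R P]
    [Module.Finite R B] : homDim R k P B = homDim R k P A + homDim R k P C := by
  let : Module k A := Module.compHom A (algebraMap k R)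
  have : IsScalarTower k R A := IsScalarTower.of_algebraMap_smul fun _ _ => rfl
  have : SMulCommClass R k A := IsScalarTower.to_smulCommClass'
  let : Module k B := Module.compHom B (algebraMap k R)
  have : IsScalarTower k R B := IsScalarTower.of_algebraMap_smul fun _ _ => rfl
  have : SMulCommClass R k B := IsScalarTower.to_smulCommClass'
  let : Module k C := Module.compHom C (algebraMap k R)
  have : IsScalarTower k R C := IsScalarTower.of_algebraMap_smul fun _ _ => rfl
  have : SMulCommClass R k C := IsScalarTower.to_smulCommClass'
  have := finite_linearMap k (P := P) (X := B) (R := R)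
  refine finrank_eq_add_of_exact k (U := P →ₗ[R] A) (V := P →ₗ[R] B) (W := P →ₗ[R] C)
    { toFun := fun h => f ∘ₗ h
      map_add' := fun a b => LinearMap.comp_add _ _ _
      map_smul' := fun c a => LinearMap.ext fun x => f.map_smul (algebraMap k R c) (a x) }
    { toFun := fun h => g ∘ₗ h
      map_add' := fun a b => LinearMap.comp_add _ _ _
      map_smul' := fun c a => LinearMap.ext fun x => g.map_smul (algebraMap k R c) (a x) }
    (fun a b hab => LinearMap.ext fun x => h.inj (LinearMap.congr_fun hab x))
    (fun p => h.exists_lift hE p) fun p => ⟨fun hp => ?_, ?_⟩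
  · have hp' : ∀ x, p x ∈ LinearMap.range f := fun x =>
      (h.exact (p x)).1 (LinearMap.congr_fun hp x)
    refine ⟨(LinearEquiv.ofInjective f h.inj).symm.toLinearMap ∘ₗ
      p.codRestrict (LinearMap.range f) hp', LinearMap.ext fun x => ?_⟩
    exact congrArg Subtype.val
      ((LinearEquiv.ofInjective f h.inj).apply_symm_apply (p.codRestrict _ hp' x))
  · rintro ⟨q, rfl⟩
    exact LinearMap.ext fun x => h.exact.apply_apply_eq_zero (q x)

theorem IsSES.homDim_left (h : IsSES f g) (hE : ExtZero R C X) [Module.Finite R B]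
    [Module.Finite R X] : homDim R k B X = homDim R k A X + homDim R k C X := by
  let : Module k X := Module.compHom X (algebraMap k R)
  have : IsScalarTower k R X := IsScalarTower.of_algebraMap_smul fun _ _ => rfl
  have : SMulCommClass R k X := IsScalarTower.to_smulCommClass'
  have := finite_linearMap k (P := B) (X := X) (R := R)
  rw [add_comm]
  refine finrank_eq_add_of_exact k (U := C →ₗ[R] X) (V := B →ₗ[R] X) (W := A →ₗ[R] X)
    { toFun := fun h => h ∘ₗ g
      map_add' := fun a b => LinearMap.add_comp _ _ _
      map_smul' := fun c a => rfl }
    { toFun := fun h => h ∘ₗ f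
      map_add' := fun a b => LinearMap.add_comp _ _ _
      map_smul' := fun c a => rfl }
    (fun a b hab => LinearMap.ext fun x => ?_)
    (fun p => h.exists_extend hE p) fun p => ⟨fun hp => ?_, ?_⟩
  · obtain ⟨y, rfl⟩ := h.surj x
    exact LinearMap.congr_fun hab y
  · refine LinearMap.exists_factor_of_surjective h.surj p fun x hx => ?_
    obtain ⟨a, rfl⟩ := (h.exact x).1 hx
    exact LinearMap.congr_fun hp a
  · rintro ⟨q, rfl⟩
    refine LinearMap.ext fun x => ?_
    change q (g (f x)) = 0
    rw [h.exact.apply_apply_eq_zero, map_zero]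

end

/-- Induction over finitely generated modules, along a composition series. -/
theorem simple_induction [IsArtinianRing R] {p : ModuleCat.{t} R → Prop}
    (h0 : ∀ X : ModuleCat.{t} R, Subsingleton X → p X)
    (h1 : ∀ (X : ModuleCat.{t} R) (N : Submodule R X), Module.Finite R X →
      IsSimpleModule R (X ⧸ N) → p (ModuleCat.of R N) → p X)
    (X : ModuleCat.{t} R) (hX : Module.Finite R X) : p X := by
  have key : ∀ (M : Type t) [AddCommGroup M] [Module R M], IsFiniteLength R M →
      p (ModuleCat.of R M) := by
    intro M _ _ hM
    induction hM with
    | of_subsingleton => exact h0 _ ‹_›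
    | @of_simple_quotient M _ _ N _ hN ih =>
      have := (isFiniteLength_iff_isNoetherian_isArtinian.1 hN).1
      have : IsNoetherian R M := (isNoetherian_iff_submodule_quotient N).2
        ⟨this, inferInstance⟩
      exact h1 (ModuleCat.of R M) N (inferInstanceAs (Module.Finite R M)) ‹_› ih
  exact key X (isFiniteLength_iff_isNoetherian_isArtinian.2 ⟨inferInstance, inferInstance⟩)

variable {V : Type u}

/-- The projective modules `P x` separate the simple modules: every simple module `S` is the target
of a nonzero homomorphism from exactly one of them, it is determined up to isomorphism by this
`x`, and `Hom(P x, S)` is one-dimensional. -/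
structure SeparatesSimples (P : V → ModuleCat.{t} R) : Prop where
  projective : ∀ x, Module.Projective R (P x)
  finite : ∀ x, Module.Finite R (P x)
  homDim_simple : ∀ S : ModuleCat.{t} R, IsSimpleModule R S →
    ∃ x, homDim R k (P x) S = 1 ∧ ∀ y, y ≠ x → homDim R k (P y) S = 0
  equiv_of_ne_zero : ∀ S S' : ModuleCat.{t} R, IsSimpleModule R S → IsSimpleModule R S' →
    ∀ x, homDim R k (P x) S ≠ 0 → homDim R k (P x) S' ≠ 0 → Nonempty (S ≃ₗ[R] S')

/-- The dimension vector of a module `X`, with entries `dim Hom(P x, X)`. It takes its values in `ℚ`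
to make linear algebra over a field available. -/
def dimVector (P : V → ModuleCat.{t} R) (X : Type t) [AddCommGroup X] [Module R X] : V → ℚ :=
  fun x => homDim R k (P x) X

namespace SeparatesSimples

variable {k} [Module.Finite k R] {P : V → ModuleCat.{t} R} (hP : SeparatesSimples k P)
include hP

theorem dimVector_add {A B C : Type t} [AddCommGroup A] [Module R A] [AddCommGroup B]
    [Module R B] [AddCommGroup C] [Module R C] {f : A →ₗ[R] B} {g : B →ₗ[R] C} (h : IsSES f g)
    [Module.Finite R B] : dimVector k P B = dimVector k P A + dimVector k P C := by
  refine funext fun x => ?_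
  have := hP.projective x
  have := hP.finite x
  simp only [dimVector, Pi.add_apply]
  rw [h.homDim_right k extZero_of_projective]
  push_cast
  rfl

omit hP [Module.Finite k R] in
theorem dimVector_congr {A B : Type t} [AddCommGroup A] [Module R A] [AddCommGroup B]
    [Module R B] (e : A ≃ₗ[R] B) : dimVector k P A = dimVector k P B :=
  funext fun _ => congrArg Nat.cast (homDim_congr_right k e)

omit hP [Module.Finite k R] in
theorem dimVector_of_subsingleton {A : Type t} [AddCommGroup A] [Module R A] [Subsingleton A] :
    dimVector k P A = 0 :=
  funext fun _ => congrArg Nat.cast (homDim_eq_zero_of_subsingleton k) |>.trans Nat.cast_zero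

omit [Module.Finite k R] in
theorem dimVector_simple [DecidableEq V] (S : ModuleCat.{t} R) (hS : IsSimpleModule R S) :
    ∃ x, dimVector k P S = Pi.single x 1 := by
  obtain ⟨x, hx, hx'⟩ := hP.homDim_simple S hS
  refine ⟨x, funext fun y => ?_⟩
  rcases eq_or_ne y x with rfl | hy
  · rw [dimVector, hx, Pi.single_eq_same, Nat.cast_one]
  · rw [dimVector, hx' y hy, Pi.single_eq_of_ne hy, Nat.cast_zero]

omit [Module.Finite k R] in
theorem dimVector_eq_single [DecidableEq V] (S : ModuleCat.{t} R) (hS : IsSimpleModule R S) {x : V}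
    (hx : homDim R k (P x) S ≠ 0) : dimVector k P S = Pi.single x 1 := by
  obtain ⟨y, hy⟩ := hP.dimVector_simple S hS
  have := congrFun hy x
  rcases eq_or_ne x y with rfl | hxy
  · exact hy
  · rw [Pi.single_eq_of_ne hxy, dimVector, Nat.cast_eq_zero] at this
    exact absurd this hx

/-- The dimension of `Hom(Q, X)` is a linear function of the dimension vector of `X`
if `Q` is projective. -/
theorem exists_homDim_eq_sum [Fintype V] (Q : ModuleCat.{t} R) [Module.Finite R Q]
    [Module.Projective R Q] : ∃ c : V → ℚ, ∀ X : ModuleCat.{t} R, Module.Finite R X →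
      (homDim R k Q X : ℚ) = ∑ x, c x * dimVector k P X x := by
  classical
  have : IsArtinianRing R := IsArtinianRing.of_finite k R
  -- the value of `c` at `x` is the dimension of `Hom(Q, S)` for the simple module `S` at `x`
  have hc : ∀ x, ∃ c : ℚ, ∀ S : ModuleCat.{t} R, IsSimpleModule R S →
      homDim R k (P x) S ≠ 0 → (homDim R k Q S : ℚ) = c := fun x => by
    by_cases h : ∃ S : ModuleCat.{t} R, IsSimpleModule R S ∧ homDim R k (P x) S ≠ 0
    · obtain ⟨S, hS, hx⟩ := h
      refine ⟨homDim R k Q S, fun S' hS' hx' => ?_⟩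
      obtain ⟨e⟩ := hP.equiv_of_ne_zero S' S hS' hS x hx' hx
      rw [homDim_congr_right k e]
    · exact ⟨0, fun S hS hx => absurd ⟨S, hS, hx⟩ h⟩
  choose c hc using hc
  refine ⟨c, simple_induction (fun X _ => ?_) fun X N _ hS ih => ?_⟩
  · simp [homDim_eq_zero_of_subsingleton, dimVector_of_subsingleton]
  · have hses := IsSES.of_submodule N
    have h1 := hses.homDim_right k (P := Q) extZero_of_projective
    rw [h1, hP.dimVector_add hses]
    simp only [Pi.add_apply, mul_add, Finset.sum_add_distrib]
    push_cast
    refine congrArg₂ _ ih ?_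
    obtain ⟨x, hx, hx'⟩ := hP.homDim_simple (ModuleCat.of R (X ⧸ N)) hS
    have hx0 : homDim R k (P x) (ModuleCat.of R (X ⧸ N)) ≠ 0 := by rw [hx]; exact one_ne_zero
    have hd := hP.dimVector_eq_single (ModuleCat.of R (X ⧸ N)) hS hx0
    have hd' : dimVector k P (X ⧸ N) = Pi.single x 1 := hd
    rw [hd', Finset.sum_eq_single x, Pi.single_eq_same, mul_one]
    · exact hc x (ModuleCat.of R (X ⧸ N)) hS hx0
    · intro y _ hy
      rw [Pi.single_eq_of_ne hy, mul_zero]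
    · simp

/-- For a fixed module `Z`, the Euler form `dim Hom(Z, X) - dim Ext¹(Z, X)` is a linear function
of the dimension vector of `X`; here it is evaluated at those `X` with `Ext¹(Z, X) = 0`. -/
theorem exists_homDim_eq_sum_of_extZero [Fintype V] (hR : IsHereditaryFG R) (Z : ModuleCat.{t} R)
    [Module.Finite R Z] : ∃ c : V → ℚ, ∀ X : ModuleCat.{t} R, Module.Finite R X →
      ExtZero R Z X → (homDim R k Z X : ℚ) = ∑ x, c x * dimVector k P X x := by
  have : IsArtinianRing R := IsArtinianRing.of_finite k R
  obtain ⟨n, p, hp⟩ := Module.Finite.exists_fin' R Z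
  have hses := IsSES.of_surjective hp
  have := hses.projective_of_pdLEOne (hR Z ‹_›)
  obtain ⟨c, hc⟩ := hP.exists_homDim_eq_sum (ModuleCat.of R (Fin n → R))
  obtain ⟨c', hc'⟩ := hP.exists_homDim_eq_sum (ModuleCat.of R (LinearMap.ker p))
  refine ⟨c - c', fun X hX hE => ?_⟩
  have h1 := hses.homDim_left k hE
  have h2 := hc X hX
  have h3 := hc' X hX
  simp only [Pi.sub_apply, sub_mul, Finset.sum_sub_distrib]
  rw [← h2, ← h3]
  change _ = (homDim R k (Fin n → R) X : ℚ) - homDim R k (LinearMap.ker p) X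
  rw [h1]
  push_cast
  ring

/-- The dimension vectors of pairwise non-isomorphic indecomposable modules without extensions are
linearly independent: among the modules in a linear relation there is one, `Y j`, without nonzero
homomorphisms to the others, and the Euler form with `Y j` isolates its coefficient. -/
theorem linearIndependent_dimVector [Fintype V] (hR : IsHereditaryFG R) {n : ℕ}
    {Y : Fin n → ModuleCat.{t} R} (hY : IsBasicFamily Y) [∀ i, Module.Finite R (Y i)]
    (hE : ∀ i j, ExtZero R (Y i) (Y j)) :
    LinearIndependent ℚ fun i => dimVector k P (Y i) := by
  have : IsArtinianRing R := IsArtinianRing.of_finite k R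
  rw [Fintype.linearIndependent_iff]
  intro a ha
  by_contra! hne
  obtain ⟨j, hj, hmin⟩ := hY.exists_no_homs hR hE (S := {i | a i ≠ 0}) hne
  obtain ⟨c, hc⟩ := hP.exists_homDim_eq_sum_of_extZero hR (Y j)
  have h1 : ∑ i, a i * (homDim R k (Y j) (Y i) : ℚ) = 0 := by
    have h2 : ∀ i, a i * (homDim R k (Y j) (Y i) : ℚ) =
        ∑ x, c x * (a i * dimVector k P (Y i) x) := fun i => by
      rw [hc (Y i) inferInstance (hE j i), Finset.mul_sum]
      exact Finset.sum_congr rfl fun x _ => by ring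
    rw [Finset.sum_congr rfl fun i _ => h2 i, Finset.sum_comm]
    refine Finset.sum_eq_zero fun x _ => ?_
    rw [← Finset.mul_sum]
    have := congrFun ha x
    rw [Finset.sum_apply] at this
    simp only [Pi.smul_apply, smul_eq_mul, Pi.zero_apply] at this
    rw [this, mul_zero]
  rw [Finset.sum_eq_single j] at h1
  · refine (mul_ne_zero hj ?_) h1
    rw [Nat.cast_ne_zero, homDim_ne_zero_iff]
    have := (hY.indec j).1
    exact ⟨LinearMap.id, fun h => by
      obtain ⟨x, hx⟩ := exists_ne (0 : Y j)
      exact hx (LinearMap.congr_fun h x)⟩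
  · intro i _ hij
    by_cases hi : a i = 0
    · rw [hi, zero_mul]
    · rw [show homDim R k (Y j) (Y i) = 0 from by
        by_contra h
        obtain ⟨f, hf⟩ := (homDim_ne_zero_iff k).1 h
        exact hf (hmin i hi hij f), Nat.cast_zero, mul_zero]
  · simp

end SeparatesSimples

end DimensionVectors

/-! ### Counting indecomposable summands -/

section Counting

namespace SeparatesSimples

variable {R : Type t} [Ring R] {k : Type w} [Field k] [Algebra k R] [Module.Finite k R]
  {V : Type u} {P : V → ModuleCat.{t} R} (hP : SeparatesSimples k P)
include hP

section

variable {M Z : Type t} [AddCommGroup M] [Module R M] [AddCommGroup Z] [Module R Z]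
  [Module.Finite R M]

theorem homDim_ne_zero_of_isGen (h : IsGen R M Z) {x : V} (hx : homDim R k (P x) Z ≠ 0) :
    homDim R k (P x) M ≠ 0 := by
  have := hP.finite x
  have := hP.projective x
  have := h.finite
  obtain ⟨f, hf⟩ := (homDim_ne_zero_iff k).1 hx
  obtain ⟨n, p, hp⟩ := h
  obtain ⟨g, rfl⟩ := Module.projective_lifting_property p f hp
  rw [homDim_ne_zero_iff]
  by_contra! h
  refine hf (LinearMap.ext fun y => ?_)
  have : g y = 0 := funext fun i => LinearMap.congr_fun (h (LinearMap.proj i ∘ₗ g)) y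
  rw [LinearMap.comp_apply, this, map_zero, LinearMap.zero_apply]

theorem homDim_ne_zero_of_subquotient {N : Type t} [AddCommGroup N] [Module R N] {i : N →ₗ[R] M}
    (hi : Function.Injective i) {p : N →ₗ[R] Z} (hp : Function.Surjective p) {x : V}
    (hx : homDim R k (P x) Z ≠ 0) : homDim R k (P x) M ≠ 0 := by
  have : IsArtinianRing R := IsArtinianRing.of_finite k R
  have := hP.finite x
  have := hP.projective x
  have : Module.Finite R N := Module.Finite.of_injective i hi
  have : Module.Finite R Z := Module.Finite.of_surjective p hp
  obtain ⟨f, hf⟩ := (homDim_ne_zero_iff k).1 hx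
  obtain ⟨g, rfl⟩ := Module.projective_lifting_property p f hp
  refine (homDim_ne_zero_iff k).2 ⟨i ∘ₗ g, fun h => hf (LinearMap.ext fun y => ?_)⟩
  have : g y = 0 := hi ((LinearMap.congr_fun h y).trans (map_zero i).symm)
  rw [LinearMap.comp_apply, this, map_zero, LinearMap.zero_apply]

end

theorem exists_simple_subquotient {x : V} (M : ModuleCat.{t} R) (hM : Module.Finite R M) :
    homDim R k (P x) M ≠ 0 → ∃ (S N : ModuleCat.{t} R) (i : N →ₗ[R] M) (p : N →ₗ[R] S),
      IsSimpleModule R S ∧ Function.Injective i ∧ Function.Surjective p ∧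
      homDim R k (P x) S ≠ 0 := by
  have : IsArtinianRing R := IsArtinianRing.of_finite k R
  have := hP.finite x
  have := hP.projective x
  refine simple_induction (p := fun M => homDim R k (P x) M ≠ 0 →
    ∃ (S N : ModuleCat.{t} R) (i : N →ₗ[R] M) (p : N →ₗ[R] S),
      IsSimpleModule R S ∧ Function.Injective i ∧ Function.Surjective p ∧
      homDim R k (P x) S ≠ 0) (fun X _ h => ?_) (fun X N _ hS ih h => ?_) M hM
  · exact absurd (homDim_eq_zero_of_subsingleton k) h
  · by_cases hN : homDim R k (P x) (X ⧸ N) = 0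
    · rw [(IsSES.of_submodule N).homDim_right k extZero_of_projective, hN, add_zero] at h
      obtain ⟨S, N', i, p, hS', hi, hp, hx⟩ := ih h
      exact ⟨S, N', N.subtype ∘ₗ i, p, hS', N.injective_subtype.comp hi, hp, hx⟩
    · exact ⟨ModuleCat.of R (X ⧸ N), X, LinearMap.id, N.mkQ, hS, fun _ _ => id,
        N.mkQ_surjective, hN⟩

variable [Fintype V] (hR : IsHereditaryFG R)
include hR

/-- The dimension vectors of the members of a basic family without extensions in `Gen M` are
linearly independent, and they are supported where that of `M` is. -/
theorem card_le_of_isGen {M : ModuleCat.{t} R} [Module.Finite R M] {n : ℕ}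
    {Y : Fin n → ModuleCat.{t} R} (hY : IsBasicFamily Y) (hE : ∀ i j, ExtZero R (Y i) (Y j))
    (hg : ∀ i, IsGen R M (Y i)) : n ≤ Nat.card {x // homDim R k (P x) M ≠ 0} := by
  classical
  have : ∀ i, Module.Finite R (Y i) := fun i => (hg i).finite
  have hli := Fintype.linearIndependent_iff.1 (hP.linearIndependent_dimVector hR hY hE)
  have hli' : LinearIndependent ℚ fun (i : Fin n) (x : {x // homDim R k (P x) M ≠ 0}) =>
      dimVector k P (Y i) x := by
    refine Fintype.linearIndependent_iff.2 fun a ha => hli a (funext fun x => ?_)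
    by_cases hx : homDim R k (P x) M = 0
    · rw [Finset.sum_apply]
      refine Finset.sum_eq_zero fun i _ => ?_
      have : homDim R k (P x) (Y i) = 0 := by
        by_contra h
        exact hP.homDim_ne_zero_of_isGen (hg i) h hx
      rw [Pi.smul_apply, dimVector, this, Nat.cast_zero, smul_zero]
    · have := congrFun ha ⟨x, hx⟩
      rw [Finset.sum_apply] at this ⊢
      exact this
  have := hli'.fintype_card_le_finrank
  rwa [Fintype.card_fin, Module.finrank_fintype_fun_eq_card, ← Nat.card_eq_fintype_card] at this

omit hR [Fintype V] in
theorem dimVector_mem_span_of_isAdd {n : ℕ} {Y : Fin n → ModuleCat.{t} R} (hY : IsBasicFamily Y)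
    (A : ModuleCat.{t} R) (hA : Module.Finite R A) : IsAdd R (∀ i, Y i) A →
    dimVector k P A ∈ Submodule.span ℚ (Set.range fun i => dimVector k P (Y i)) := by
  have : IsArtinianRing R := IsArtinianRing.of_finite k R
  refine indec_induction (P := fun A => IsAdd R (∀ i, Y i) A →
    dimVector k P A ∈ Submodule.span ℚ (Set.range fun i => dimVector k P (Y i)))
    (fun X _ _ => ?_) (fun X Z X' _ hZ e ih h => ?_) A hA
  · rw [dimVector_of_subsingleton]
    exact Submodule.zero_mem _
  · have hZX : IsRetract R Z X := IsRetract.fst.trans (.of_equiv e.symm)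
    have : Module.Finite R Z := hZX.finite
    have : Module.Finite R (Z × X') := Module.Finite.of_surjective _ e.surjective
    have hses : IsSES (LinearMap.inl R Z X') (LinearMap.snd R Z X') :=
      ⟨LinearMap.inl_injective, .inl_snd, LinearMap.snd_surjective⟩
    rw [dimVector_congr e, hP.dimVector_add hses]
    refine Submodule.add_mem _ ?_ (ih (.of_retract (IsRetract.snd.trans (.of_equiv e.symm)) h))
    obtain ⟨i, ⟨φ⟩⟩ := hY.exists_equiv hZ (.of_retract hZX h)
    rw [dimVector_congr φ]
    exact Submodule.subset_span ⟨i, rfl⟩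

/-- If `R / ann M` has a coresolution in `add M`, then so has the kernel of every surjection from
`R / ann M` to a simple module `S`, and the class of `S` in the Grothendieck group is a
combination of classes of summands of `M`. -/
theorem card_le_of_hasTiltingSequence {M : ModuleCat.{t} R} [Module.Finite R M]
    (hE : ExtZero R M M) (hs : HasTiltingSequence R M) {n : ℕ}
    {Y : Fin n → ModuleCat.{t} R} (hY : IsBasicFamily Y) (hM : IsAdd R (∀ i, Y i) M) :
    Nat.card {x // homDim R k (P x) M ≠ 0} ≤ n := by
  classical
  have : IsArtinianRing R := IsArtinianRing.of_finite k R
  set W := Submodule.span ℚ (Set.range fun i => dimVector k P (Y i)) with hW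
  have hadd : ∀ A : ModuleCat.{t} R, IsAdd R M A → dimVector k P A ∈ W := fun A hA =>
    hP.dimVector_mem_span_of_isAdd hY A hA.isGen.finite (hA.trans hM)
  have hsub : ∀ (X A C : Type t) [AddCommGroup X] [Module R X] [AddCommGroup A] [Module R A]
      [AddCommGroup C] [Module R C] (f : X →ₗ[R] A) (g : A →ₗ[R] C), IsSES f g →
      IsAdd R M A → IsAdd R M C → dimVector k P X ∈ W := by
    intro X A C _ _ _ _ _ _ f g h hA hC
    have := hA.isGen.finite
    rw [eq_sub_of_add_eq (hP.dimVector_add h).symm]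
    exact Submodule.sub_mem _ (hadd (ModuleCat.of R A) hA) (hadd (ModuleCat.of R C) hC)
  have hself := IsGenExtProjective.self (hR M ‹_›) hE
  have hquot : dimVector k P (R ⧸ Module.annihilator R M) ∈ W := by
    obtain ⟨A, C, f, g, h, hA, hC⟩ := hs
    exact hsub _ A C f g h hA hC
  have hsimple : ∀ x : {x // homDim R k (P x) M ≠ 0}, Pi.single x.1 (1 : ℚ) ∈ W := by
    rintro ⟨x, hx⟩
    obtain ⟨S, N, i, p, hS, hi, hp, hxS⟩ := hP.exists_simple_subquotient M ‹_› hx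
    have hann : Module.annihilator R M ≤ Module.annihilator R S := fun r hr =>
      Module.mem_annihilator.2 fun s => by
        obtain ⟨y, rfl⟩ := hp s
        rw [← map_smul, show r • y = 0 from hi (by
          rw [map_smul, Module.mem_annihilator.1 hr, map_zero]), map_zero]
    have := IsSimpleModule.nontrivial R S
    obtain ⟨s, hs0⟩ := exists_ne (0 : S)
    let q : (R ⧸ Module.annihilator R M) →ₗ[R] S :=
      (Module.annihilator R M).liftQ (LinearMap.toSpanSingleton R S s) fun r hr =>
        Module.mem_annihilator.1 (hann hr) s
    have hq : Function.Surjective q := fun y => by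
      obtain ⟨r, hr⟩ := IsSimpleModule.toSpanSingleton_surjective R hs0 y
      exact ⟨Submodule.Quotient.mk r, hr⟩
    have hses := IsSES.of_surjective hq
    obtain ⟨r, j, hj⟩ := exists_injective_quotient_annihilator R k M
    obtain ⟨m, C, f, g, hfg, hC⟩ := exists_coresolution k hself
      (j := j ∘ₗ (LinearMap.ker q).subtype) (hj.comp (Submodule.injective_subtype _))
      fun Z l p' hp' => (IsSES.of_surjective hp').exists_lift <|
        hses.extZero_left (hR S inferInstance) (extZero_quotient_annihilator k hR hE fun r hr =>
          Module.mem_annihilator.2 fun z => Subtype.ext (funext fun i =>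
            Module.mem_annihilator.1 hr (z.1 i)))
    have hker := hsub _ _ C f g hfg (IsAdd.refl.pow m) (hs.isAdd_of_isGenExtProjective k hE hC)
    rw [← hP.dimVector_eq_single S hS hxS,
      eq_sub_of_add_eq' (hP.dimVector_add hses).symm]
    exact Submodule.sub_mem _ hquot hker
  have hli : LinearIndependent ℚ fun x : {x // homDim R k (P x) M ≠ 0} =>
      (Pi.single x.1 1 : V → ℚ) := by
    have := (Pi.basisFun ℚ V).linearIndependent.comp
      (Subtype.val : {x // homDim R k (P x) M ≠ 0} → V) Subtype.val_injective
    convert this with x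
    simp
  have h1 := finrank_span_eq_card hli
  have h2 : Module.finrank ℚ W ≤ n := by
    have := finrank_range_le_card (R := ℚ) (b := fun i => dimVector k P (Y i))
    rwa [Fintype.card_fin] at this
  rw [Nat.card_eq_fintype_card, ← h1]
  refine (Submodule.finrank_mono ?_).trans h2
  rw [Submodule.span_le]
  rintro _ ⟨x, rfl⟩
  exact hsimple x

/-- The cokernel of a left approximation of `R / ann M` adds no new indecomposable summands to `M`
if the number of those of `M` is already the maximal one. -/
theorem hasTiltingSequence_of_card_le {M : ModuleCat.{t} R} [Module.Finite R M]
    (hE : ExtZero R M M) {n : ℕ}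
    {Y : Fin n → ModuleCat.{t} R} (hY : IsBasicFamily Y) (hr : ∀ i, IsRetract R (Y i) M)
    (hn : Nat.card {x // homDim R k (P x) M ≠ 0} ≤ n) :
    HasTiltingSequence R M := by
  have : IsArtinianRing R := IsArtinianRing.of_finite k R
  have hself := IsGenExtProjective.self (hR M ‹_›) hE
  obtain ⟨m, C, f, g, hfg, hC⟩ := exists_coresolution_quotient_annihilator k hself
  refine ⟨ModuleCat.of R (Fin m → M), C, f, g, hfg, IsAdd.refl.pow m, ?_⟩
  have := hC.1.finite
  obtain ⟨l, Z, hZ, hZr, hZC⟩ := exists_basicFamily C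
  refine hZC.trans (.pi fun j => ?_)
  by_cases h : ∃ i, Nonempty (Y i ≃ₗ[R] Z j)
  · obtain ⟨i, ⟨φ⟩⟩ := h
    exact .of_retract (.of_equiv φ.symm) (hr i).isAdd
  · have hproj : ∀ i, IsGenExtProjective R M
        ((Fin.cons (Z j) Y : Fin (n + 1) → ModuleCat.{t} R) i) := fun i => by
      refine Fin.cases ?_ (fun i => ?_) i
      · exact hC.of_isAdd (hZr j).isAdd
      · exact hself.of_isAdd (hr i).isAdd
    have := hP.card_le_of_isGen hR (hY.cons (hZ.indec j) fun i hi => h ⟨i, hi⟩)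
      (fun i i' => (hproj i).2 _ (hproj i').1) fun i => (hproj i).1
    exact absurd (this.trans hn) (Nat.not_succ_le_self n)

omit hR [Fintype V] in
/-- The simple modules in the support of `M` correspond to the `x` with `Hom(P x, M) ≠ 0`. -/
theorem encard_simpleSupport [Finite V] (M : ModuleCat.{t} R) [Module.Finite R M] :
    (simpleSupport M).encard = Nat.card {x // homDim R k (P x) M ≠ 0} := by
  choose S N i p hS hi hp hx using fun x : {x // homDim R k (P x) M ≠ 0} =>
    hP.exists_simple_subquotient M ‹_› x.2
  have hinj : Function.Injective fun x => (Quotient.mk (isIsomorphicSetoid _) (S x)) := by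
    intro x y hxy
    obtain ⟨φ⟩ := nonempty_iso_iff.1 (Quotient.exact hxy)
    obtain ⟨z, -, hz⟩ := hP.homDim_simple (S x) (hS x)
    have h1 : x.1 = z := by
      by_contra h
      exact hx x (hz _ h)
    have h2 : y.1 = z := by
      by_contra h
      refine hx y ?_
      rw [← homDim_congr_right k φ]
      exact hz _ h
    exact Subtype.ext (h1.trans h2.symm)
  have hrange : simpleSupport M =
      Set.range fun x => (Quotient.mk (isIsomorphicSetoid _) (S x)) := by
    refine Set.Subset.antisymm ?_ ?_
    · rintro _ ⟨S', hS', ⟨N', i', p', hi', hp'⟩, rfl⟩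
      have hs := (simple_iff_isSimpleModule' _).1 hS'
      obtain ⟨x, hx', -⟩ := hP.homDim_simple S' hs
      have hx0 : homDim R k (P x) S' ≠ 0 := by rw [hx']; exact one_ne_zero
      have hxM : homDim R k (P x) M ≠ 0 := hP.homDim_ne_zero_of_subquotient
        ((ModuleCat.mono_iff_injective i').1 hi') ((ModuleCat.epi_iff_surjective p').1 hp') hx0
      exact ⟨⟨x, hxM⟩, Quotient.sound (nonempty_iso_iff.2
        (hP.equiv_of_ne_zero _ _ (hS _) hs x (hx ⟨x, hxM⟩) hx0))⟩
    · rintro _ ⟨x, rfl⟩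
      exact ⟨S x, (simple_iff_isSimpleModule' _).2 (hS x), ⟨N x, ModuleCat.ofHom (i x),
        ModuleCat.ofHom (p x), (ModuleCat.mono_iff_injective _).2 (hi x),
        (ModuleCat.epi_iff_surjective _).2 (hp x)⟩, rfl⟩
  rw [hrange, ← Set.image_univ, hinj.encard_image, Set.encard_univ, ENat.card_eq_coe_natCard]

end SeparatesSimples

theorem IsBasicFamily.encard_indecomposableSummands {R : Type t} [Ring R] [IsArtinianRing R]
    {M : ModuleCat.{t} R} [Module.Finite R M] {n : ℕ} {Y : Fin n → ModuleCat.{t} R}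
    (hY : IsBasicFamily Y) (hr : ∀ i, IsRetract R (Y i) M) (hM : IsAdd R (∀ i, Y i) M) :
    (indecomposableSummands M).encard = n := by
  have hinj : Function.Injective fun i => (Quotient.mk (isIsomorphicSetoid _) (Y i)) :=
    fun i j hij => hY.eq_of_equiv i j (nonempty_iso_iff.1 (Quotient.exact hij))
  have hrange : indecomposableSummands M =
      Set.range fun i => (Quotient.mk (isIsomorphicSetoid _) (Y i)) := by
    refine Set.Subset.antisymm ?_ ?_
    · rintro _ ⟨Z, hZ, hZM, rfl⟩
      have hret := nonempty_retract_iff.1 hZM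
      have := hret.finite
      obtain ⟨i, hi⟩ := hY.exists_equiv (indecomposable_iff.1 hZ) (hM.of_retract hret)
      exact ⟨i, (Quotient.sound (nonempty_iso_iff.2 hi)).symm⟩
    · rintro _ ⟨i, rfl⟩
      exact ⟨Y i, indecomposable_iff.2 (hY.indec i), nonempty_retract_iff.2 (hr i), rfl⟩
  rw [hrange, ← Set.image_univ, hinj.encard_image, Set.encard_univ, ENat.card_eq_coe_natCard,
    Nat.card_fin]

/-- A rigid module `M` over a hereditary algebra has a coresolution of `R / ann M` in `add M` if
and only if it has as many indecomposable summands as there are simple modules in its support. -/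
theorem SeparatesSimples.hasTiltingSequence_iff {R : Type t} [Ring R] {k : Type w} [Field k]
    [Algebra k R] [Module.Finite k R] {V : Type u} [Fintype V] {P : V → ModuleCat.{t} R}
    (hP : SeparatesSimples k P) (hR : IsHereditaryFG R) (M : ModuleCat.{t} R) [Module.Finite R M]
    (hE : ExtZero R M M) :
    HasTiltingSequence R M ↔ (indecomposableSummands M).encard = (simpleSupport M).encard := by
  have : IsArtinianRing R := IsArtinianRing.of_finite k R
  obtain ⟨n, Y, hY, hr, hM⟩ := exists_basicFamily M
  have hself := IsGenExtProjective.self (hR M ‹_›) hE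
  rw [hY.encard_indecomposableSummands hr hM, hP.encard_simpleSupport, Nat.cast_inj]
  refine ⟨fun hs => le_antisymm ?_ (hP.card_le_of_hasTiltingSequence hR hE hs hY hM),
    fun h => hP.hasTiltingSequence_of_card_le hR hE hY hr h.ge⟩
  have hproj := fun i => hself.of_isAdd (hr i).isAdd
  exact hP.card_le_of_isGen hR hY (fun i j => (hproj i).2 _ (hproj j).1) fun i => (hproj i).1

end Counting

/-! ### Paths in an acyclic quiver -/

section Paths

variable {V : Type u} [Quiver.{v} V]

/-- A nontrivial path has a unique first arrow. -/
theorem toPath_comp_injective {x y y' z : V} (a : x ⟶ y) (a' : x ⟶ y') (q : Quiver.Path y z)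
    (q' : Quiver.Path y' z) (h : a.toPath.comp q = a'.toPath.comp q') :
    (⟨y, a, q⟩ : Σ y, (x ⟶ y) × Quiver.Path y z) = ⟨y', a', q'⟩ := by
  induction q with
  | nil =>
    cases q' with
    | nil =>
      have := Quiver.Path.hom_heq_of_cons_eq_cons h
      cases this
      rfl
    | cons q' c =>
      have := congrArg Quiver.Path.length h
      simp [Quiver.Path.length_comp, Quiver.Hom.toPath] at this
  | cons q b ih =>
    cases q' with
    | nil =>
      have := congrArg Quiver.Path.length h
      simp [Quiver.Path.length_comp, Quiver.Hom.toPath] at this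
    | cons q' c =>
      rw [Quiver.Path.comp_cons, Quiver.Path.comp_cons] at h
      obtain rfl := Quiver.Path.obj_eq_of_cons_eq_cons h
      obtain rfl := eq_of_heq (Quiver.Path.hom_heq_of_cons_eq_cons h)
      have := ih q' (eq_of_heq (Quiver.Path.heq_of_cons_eq_cons h))
      cases this
      rfl

/-- The path given by a first arrow and a remaining path. -/
def QuiverPath.ofFirst {x : V} (a : Σ y, x ⟶ y) {z : V} (q : Quiver.Path a.1 z) : QuiverPath V :=
  ⟨x, z, a.2.toPath.comp q⟩

theorem QuiverPath.ofFirst_injective {x : V} {a a' : Σ y, x ⟶ y} {z z' : V}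
    {q : Quiver.Path a.1 z} {q' : Quiver.Path a'.1 z'} (h : ofFirst a q = ofFirst a' q') :
    a = a' ∧ (⟨a.1, z, q⟩ : QuiverPath V) = ⟨a'.1, z', q'⟩ := by
  obtain ⟨y, a⟩ := a
  obtain ⟨y', a'⟩ := a'
  rw [ofFirst, ofFirst, QuiverPath.mk.injEq] at h
  obtain ⟨-, rfl, h⟩ := h
  have := toPath_comp_injective a a' q q' (eq_of_heq h)
  cases this
  exact ⟨rfl, rfl⟩

theorem QuiverPath.eq_triv_or_ofFirst (p : QuiverPath V) :
    p = triv p.src ∨ ∃ (a : Σ y, p.src ⟶ y) (z : V) (q : Quiver.Path a.1 z), p = ofFirst a q := by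
  obtain ⟨x, z, p⟩ := p
  by_cases h : p.length = 0
  · obtain rfl := p.eq_of_length_zero h
    rw [p.eq_nil_of_length_zero h]
    exact .inl rfl
  · obtain ⟨y, a, q, -, rfl⟩ := p.eq_toPath_comp_of_length_eq_succ (Nat.succ_pred h).symm
    exact .inr ⟨⟨y, a⟩, z, q, rfl⟩

variable [Finite V] (hV : QuiverAcyclic V)
include hV

/-- Reachability by nontrivial paths is a well-founded order on the vertices. -/
theorem QuiverAcyclic.wellFounded :
    WellFounded fun y x : V => ∃ p : Quiver.Path x y, p.length ≠ 0 := by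
  have : IsTrans V fun y x : V => ∃ p : Quiver.Path x y, p.length ≠ 0 :=
    ⟨fun _ _ _ ⟨p, hp⟩ ⟨q, _⟩ => ⟨q.comp p, by rw [Quiver.Path.length_comp]; omega⟩⟩
  have : Std.Irrefl fun y x : V => ∃ p : Quiver.Path x y, p.length ≠ 0 :=
    ⟨fun x ⟨p, hp⟩ => hp (by rw [hV x p]; rfl)⟩
  exact Finite.wellFounded_of_trans_of_irrefl _

theorem QuiverAcyclic.finite_quiverPath [∀ x y : V, Finite (x ⟶ y)] : Finite (QuiverPath V) := by
  classical
  have h : ∀ x : V, {p : QuiverPath V | p.src = x}.Finite := fun x => by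
    induction x using hV.wellFounded.induction with
    | _ x ih =>
      have : {p : QuiverPath V | p.src = x} ⊆ {QuiverPath.triv x} ∪
          ⋃ a : Σ y, x ⟶ y, (fun p : QuiverPath V => if h : p.src = a.1 then
            QuiverPath.ofFirst a (p.path.cast h rfl) else p) '' {p | p.src = a.1} := by
        rintro p rfl
        rcases p.eq_triv_or_ofFirst with h | ⟨a, z, q, h⟩
        · exact .inl h
        · refine .inr (Set.mem_iUnion.2 ⟨a, ⟨a.1, z, q⟩, rfl, ?_⟩)
          exact (dif_pos rfl).trans h.symm
      refine Set.Finite.subset ((Set.finite_singleton _).union (Set.finite_iUnion fun a : Σ y, x ⟶ y =>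
        (ih a.1 ⟨a.2.toPath, one_ne_zero⟩).image _)) this
  have : (⋃ x : V, {p : QuiverPath V | p.src = x}).Finite := Set.finite_iUnion h
  refine Set.finite_univ_iff.1 (this.subset fun p _ => ?_)
  exact Set.mem_iUnion.2 ⟨p.src, rfl⟩

end Paths

/-! ### Simple modules over the path algebra of an acyclic quiver -/

namespace PathAlgebra

variable {k : Type w} [Field k] {V : Type u} [Quiver.{v} V]

/-- The idempotent of the path algebra given by the trivial path at a vertex. -/
def idem (x : V) : PathAlgebra k V := ofPath (QuiverPath.triv x)

/-- The element of the path algebra given by an arrow. -/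
def ofArrow {x : V} (a : Σ y, x ⟶ y) : PathAlgebra k V := ofPath ⟨x, a.1, a.2.toPath⟩

theorem ofPath_mul_ofPath {x y z : V} (p : Quiver.Path y z) (q : Quiver.Path x y) :
    (ofPath ⟨y, z, p⟩ * ofPath ⟨x, y, q⟩ : PathAlgebra k V) = ofPath ⟨x, z, q.comp p⟩ := by
  rw [mul_eq, mulBilin_ofPath]
  simp [pathMul]

theorem ofPath_mul_ofPath_of_ne {p q : QuiverPath V} (h : q.tgt ≠ p.src) :
    (ofPath p * ofPath q : PathAlgebra k V) = 0 := by
  rw [mul_eq, mulBilin_ofPath]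
  exact dif_neg h

theorem ofPath_mul_idem (p : QuiverPath V) :
    (ofPath p * idem p.src : PathAlgebra k V) = ofPath p := by
  refine (ofPath_mul_ofPath p.path .nil).trans ?_
  rw [Quiver.Path.nil_comp]

theorem ofPath_mul_idem_of_ne {p : QuiverPath V} {x : V} (h : x ≠ p.src) :
    (ofPath p * idem x : PathAlgebra k V) = 0 :=
  ofPath_mul_ofPath_of_ne h

theorem idem_mul_idem (x : V) : (idem x * idem x : PathAlgebra k V) = idem x :=
  ofPath_mul_idem (QuiverPath.triv x)

theorem idem_mul_ofArrow {x : V} (a : Σ y, x ⟶ y) :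
    (idem a.1 * ofArrow a : PathAlgebra k V) = ofArrow a :=
  ofPath_mul_ofPath .nil a.2.toPath

theorem ofArrow_mul_idem {x : V} (a : Σ y, x ⟶ y) :
    (ofArrow a * idem x : PathAlgebra k V) = ofArrow a :=
  ofPath_mul_idem _

theorem ofPath_mul_ofArrow {x : V} (a : Σ y, x ⟶ y) {z : V} (q : Quiver.Path a.1 z) :
    (ofPath ⟨a.1, z, q⟩ * ofArrow a : PathAlgebra k V) = ofPath (QuiverPath.ofFirst a q) :=
  ofPath_mul_ofPath q a.2.toPath

variable [Fintype V]

theorem sum_idem : ∑ x, (idem x : PathAlgebra k V) = 1 := rfl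

theorem repr_mul_ofArrow {x : V} (a : Σ y, x ⟶ y) {z : V} (q : Quiver.Path a.1 z)
    (r : PathAlgebra k V) : pathBasis.repr (r * ofArrow a) (QuiverPath.ofFirst a q) =
      pathBasis.repr r ⟨a.1, z, q⟩ := by
  classical
  induction r using induction_on with
  | h0 => simp
  | hadd r s hr hs => rw [add_mul, map_add, map_add, Finsupp.add_apply, Finsupp.add_apply, hr, hs]
  | hs c p =>
    rw [smul_mul_assoc, map_smul, map_smul, Finsupp.smul_apply, Finsupp.smul_apply]
    congr 1
    by_cases h : a.1 = p.src
    · obtain ⟨y, z', p⟩ := p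
      obtain rfl : a.1 = y := h
      rw [ofPath_mul_ofArrow, ofPath, ofPath, pathBasis.repr_self, pathBasis.repr_self,
        Finsupp.single_apply, Finsupp.single_apply]
      refine if_congr ⟨fun h => (QuiverPath.ofFirst_injective h).2, fun h => ?_⟩ rfl rfl
      cases h
      rfl
    · rw [ofArrow, ofPath_mul_ofPath_of_ne h, ofPath, pathBasis.repr_self,
        Finsupp.single_eq_of_ne (fun h' => h (congrArg QuiverPath.src h')), map_zero,
        Finsupp.zero_apply]

theorem repr_mul_ofArrow_of_ne {x : V} {a b : Σ y, x ⟶ y} (hab : a ≠ b) {z : V}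
    (q : Quiver.Path a.1 z) (r : PathAlgebra k V) :
    pathBasis.repr (r * ofArrow b) (QuiverPath.ofFirst a q) = 0 := by
  classical
  induction r using induction_on with
  | h0 => simp
  | hadd r s hr hs => rw [add_mul, map_add, Finsupp.add_apply, hr, hs, add_zero]
  | hs c p =>
    rw [smul_mul_assoc, map_smul, Finsupp.smul_apply]
    by_cases h : b.1 = p.src
    · obtain ⟨y, z', p⟩ := p
      obtain rfl : b.1 = y := h
      rw [ofPath_mul_ofArrow, ofPath, pathBasis.repr_self, Finsupp.single_eq_of_ne
        (fun h => hab (QuiverPath.ofFirst_injective h).1), smul_zero]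
    · rw [ofArrow, ofPath_mul_ofPath_of_ne h, map_zero, Finsupp.zero_apply, smul_zero]

theorem repr_mul_idem_of_ne {p : QuiverPath V} {x : V} (h : x ≠ p.src) (r : PathAlgebra k V) :
    pathBasis.repr (r * idem x) p = 0 := by
  classical
  induction r using induction_on with
  | h0 => simp
  | hadd r s hr hs => rw [add_mul, map_add, Finsupp.add_apply, hr, hs, add_zero]
  | hs c q =>
    rw [smul_mul_assoc, map_smul, Finsupp.smul_apply]
    by_cases hq : x = q.src
    · subst hq
      rw [ofPath_mul_idem, ofPath, pathBasis.repr_self,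
        Finsupp.single_eq_of_ne (fun h' => h (congrArg QuiverPath.src h'.symm)), smul_zero]
    · rw [ofPath_mul_idem_of_ne hq, map_zero, Finsupp.zero_apply, smul_zero]

/-- The projective module spanned by the paths that start at `x`. -/
def vertexProjective (x : V) : Submodule (PathAlgebra k V) (PathAlgebra k V) where
  carrier := {r | r * idem x = r}
  add_mem' {r s} hr hs := by
    change (r + s) * idem x = r + s
    rw [add_mul, show r * idem x = r from hr, show s * idem x = s from hs]
  zero_mem' := zero_mul _
  smul_mem' c r hr := by
    change c * r * idem x = c * r
    rw [mul_assoc, show r * idem x = r from hr]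

theorem mul_idem_mem (r : PathAlgebra k V) (x : V) : r * idem x ∈ vertexProjective (k := k) x := by
  change r * idem x * idem x = r * idem x
  rw [mul_assoc, idem_mul_idem]

/-- Right multiplication by the idempotent at `x`. -/
def mulIdem (x : V) : PathAlgebra k V →ₗ[PathAlgebra k V] vertexProjective (k := k) x where
  toFun r := ⟨r * idem x, mul_idem_mem r x⟩
  map_add' _ _ := Subtype.ext (add_mul _ _ _)
  map_smul' _ _ := Subtype.ext (mul_assoc _ _ _)

theorem mulIdem_apply_coe {x : V} (r : vertexProjective (k := k) x) : mulIdem x r.1 = r :=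
  Subtype.ext r.2

instance (x : V) : Module.Projective (PathAlgebra k V) (vertexProjective (k := k) x) :=
  .of_split (vertexProjective x).subtype (mulIdem x) (LinearMap.ext mulIdem_apply_coe)

instance (x : V) : Module.Finite (PathAlgebra k V) (vertexProjective (k := k) x) :=
  .of_surjective (mulIdem x) fun r => ⟨r.1, mulIdem_apply_coe r⟩

variable [∀ x y : V, Fintype (x ⟶ y)]

/-- The sum of right multiplications by the arrows that start at `x`. -/
def mulArrows (x : V) : (∀ a : Σ y, x ⟶ y, vertexProjective (k := k) a.1) →ₗ[PathAlgebra k V]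
    vertexProjective (k := k) x where
  toFun r := ⟨∑ a, (r a).1 * ofArrow a, by
    change (∑ a, _) * idem x = _
    rw [Finset.sum_mul]
    exact Finset.sum_congr rfl fun a _ => by rw [mul_assoc, ofArrow_mul_idem]⟩
  map_add' r s := Subtype.ext <| by
    change ∑ a, ((r a).1 + (s a).1) * _ = _ + _
    simp only [add_mul, Finset.sum_add_distrib]
  map_smul' c r := Subtype.ext <| by
    change ∑ a, (c * (r a).1) * _ = c * _
    simp only [mul_assoc, Finset.mul_sum]

theorem mulArrows_injective (x : V) : Function.Injective (mulArrows (k := k) x) := by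
  rw [← LinearMap.ker_eq_bot, LinearMap.ker_eq_bot']
  intro r hr
  have hr' : ∑ a, (r a).1 * ofArrow a = 0 := congrArg Subtype.val hr
  refine funext fun a => Subtype.ext (pathBasis.repr.injective (Finsupp.ext fun p => ?_))
  rw [Pi.zero_apply, ZeroMemClass.coe_zero, map_zero, Finsupp.zero_apply]
  by_cases h : a.1 = p.src
  · obtain ⟨y, z, q⟩ := p
    obtain rfl : a.1 = y := h
    have h1 := congrArg (fun s => pathBasis.repr s (QuiverPath.ofFirst a q)) hr'
    simp only [map_sum, Finsupp.finsetSum_apply, map_zero, Finsupp.zero_apply] at h1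
    rwa [Finset.sum_eq_single a, repr_mul_ofArrow] at h1
    · exact fun b _ hb => repr_mul_ofArrow_of_ne hb.symm q _
    · simp
  · rw [← (r a).2]
    exact repr_mul_idem_of_ne h _

/-- The nontrivial paths that start at `x` have a first arrow, so they span the image
of `mulArrows`. -/
theorem exists_eq_smul_add (x : V) (r : PathAlgebra k V) :
    ∃ (c : k) (s : _), mulIdem x r = mulIdem x (c • 1) + mulArrows x s := by
  classical
  induction r using induction_on with
  | h0 => exact ⟨0, 0, by simp⟩
  | hadd r r' hr hr' =>
    obtain ⟨c, s, h⟩ := hr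
    obtain ⟨c', s', h'⟩ := hr'
    refine ⟨c + c', s + s', ?_⟩
    rw [map_add, h, h', add_smul, map_add, map_add]
    abel
  | hs c p =>
    by_cases hx : x = p.src
    · subst hx
      rcases p.eq_triv_or_ofFirst with h | ⟨a, z, q, h⟩
      · refine ⟨c, 0, ?_⟩
        rw [map_zero, add_zero]
        refine Subtype.ext ?_
        change c • ofPath p * idem p.src = c • 1 * idem p.src
        rw [smul_mul_assoc, ofPath_mul_idem, smul_mul_assoc, one_mul, idem, ← h]
      · refine ⟨0, Pi.single a ⟨c • ofPath ⟨a.1, z, q⟩, ?_⟩, ?_⟩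
        · change c • ofPath _ * idem a.1 = _
          rw [smul_mul_assoc]
          exact congrArg (c • ·) (ofPath_mul_idem ⟨a.1, z, q⟩)
        · rw [zero_smul, map_zero, zero_add]
          refine Subtype.ext ?_
          change c • ofPath p * idem p.src = ∑ b, _
          rw [Finset.sum_eq_single a, Pi.single_eq_same, smul_mul_assoc, smul_mul_assoc,
            ofPath_mul_idem, ofPath_mul_ofArrow, ← h]
          · intro b _ hb
            rw [Pi.single_eq_of_ne hb, ZeroMemClass.coe_zero, zero_mul]
          · simp
    · refine ⟨0, 0, ?_⟩
      rw [zero_smul, map_zero, map_zero, add_zero]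
      refine Subtype.ext ?_
      change c • ofPath p * idem x = 0
      rw [smul_mul_assoc, ofPath_mul_idem_of_ne hx, smul_zero]

end PathAlgebra

theorem isHereditaryFG_of_isSimpleModule {R : Type t} [Ring R] [IsArtinianRing R]
    (h : ∀ S : ModuleCat.{t} R, IsSimpleModule R S → PdLEOne R S) : IsHereditaryFG R := by
  refine simple_induction (p := fun X => PdLEOne R X) (fun X hX => ?_) fun X N _ hS ih =>
    (IsSES.of_submodule N).pdLEOne_middle ih (h (ModuleCat.of R (X ⧸ N)) hS)
  have : Module.Free R X := Module.Free.of_subsingleton R X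
  have : Module.Projective R X := Module.Projective.of_free
  have : IsSES (LinearMap.id : X →ₗ[R] X) (LinearMap.id : X →ₗ[R] X) :=
    ⟨fun _ _ => id, fun x => ⟨fun _ => ⟨x, rfl⟩, fun _ => Subsingleton.elim _ _⟩,
      fun x => ⟨x, rfl⟩⟩
  exact this.pdLEOne_of_projective

namespace PathAlgebra

variable {k : Type w} [Field k] {V : Type u} [Quiver.{v} V] [Fintype V]

section

variable {S S' : Type (max u v w)} [AddCommGroup S] [Module (PathAlgebra k V) S]
  [AddCommGroup S'] [Module (PathAlgebra k V) S']

variable (k) in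
/-- The element `s` is a nonzero element at the vertex `x` that is killed by all arrows, and it
generates the module: so `S` is the simple module at `x`. -/
structure IsSimpleAt (x : V) (s : S) : Prop where
  ne_zero : s ≠ 0
  idem_smul : (idem x : PathAlgebra k V) • s = s
  ofArrow_smul : ∀ a : Σ y, x ⟶ y, (ofArrow a : PathAlgebra k V) • s = 0
  surjective : Function.Surjective (LinearMap.toSpanSingleton (PathAlgebra k V) S s)

theorem exists_isSimpleAt (hV : QuiverAcyclic V) [IsSimpleModule (PathAlgebra k V) S] :
    ∃ (x : V) (s : S), IsSimpleAt k x s := by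
  have := IsSimpleModule.nontrivial (PathAlgebra k V) S
  obtain ⟨t, ht⟩ := exists_ne (0 : S)
  have hne : {x : V | ∃ t : S, (idem x : PathAlgebra k V) • t ≠ 0}.Nonempty := by
    by_contra h
    refine ht ?_
    rw [← one_smul (PathAlgebra k V) t, ← sum_idem, Finset.sum_smul]
    refine Finset.sum_eq_zero fun x _ => ?_
    by_contra hx
    exact h ⟨x, t, hx⟩
  -- a vertex of the support of `S` from which no other one can be reached
  obtain ⟨x, ⟨t, ht⟩, hmin⟩ := hV.wellFounded.has_min _ hne
  refine ⟨x, (idem x : PathAlgebra k V) • t, ht, ?_, fun a => ?_,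
    IsSimpleModule.toSpanSingleton_surjective _ ht⟩
  · rw [smul_smul, idem_mul_idem]
  · by_contra h
    refine hmin a.1 ⟨(ofArrow a : PathAlgebra k V) • (idem x : PathAlgebra k V) • t, ?_⟩
      ⟨a.2.toPath, one_ne_zero⟩
    rwa [smul_smul, idem_mul_ofArrow]

namespace IsSimpleAt

variable {x : V} {s : S} {s' : S'} (h : IsSimpleAt k x s) [∀ x y : V, Fintype (x ⟶ y)]
include h

theorem mulArrows_smul (r : ∀ a : Σ y, x ⟶ y, vertexProjective (k := k) a.1) :
    (mulArrows x r).1 • s = 0 := by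
  change (∑ a, _) • s = 0
  rw [Finset.sum_smul]
  refine Finset.sum_eq_zero fun a _ => ?_
  rw [mul_smul, h.ofArrow_smul, smul_zero]

/-- The paths that are not trivial at `x` kill `s`, so the algebra acts on `s` through scalars. -/
theorem exists_smul_eq (r : PathAlgebra k V) : ∃ (c : k) (q : _),
    mulIdem x r = mulIdem x (c • 1) + mulArrows x q ∧ r • s = (c • (1 : PathAlgebra k V)) • s := by
  obtain ⟨c, q, hq⟩ := exists_eq_smul_add x r
  refine ⟨c, q, hq, ?_⟩
  have h1 : ∀ r' : PathAlgebra k V, r' • s = (mulIdem x r').1 • s := fun r' => by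
    change _ = (r' * idem x) • s
    rw [mul_smul, h.idem_smul]
  rw [h1 r, h1 (c • 1), hq]
  change ((mulIdem x (c • 1)).1 + (mulArrows x q).1) • s = _
  rw [add_smul, h.mulArrows_smul, add_zero]

omit [∀ x y : V, Fintype (x ⟶ y)] in
theorem smul_one_smul_eq_zero {c : k} (hc : (c • (1 : PathAlgebra k V)) • s = 0) : c = 0 := by
  by_contra h0
  refine h.ne_zero ?_
  rw [← one_smul (PathAlgebra k V) s, ← inv_smul_smul₀ h0 (1 : PathAlgebra k V),
    ← one_mul (c • (1 : PathAlgebra k V)), ← smul_mul_assoc, mul_smul, hc, smul_zero]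

theorem idem_smul_of_ne {z : V} (hz : z ≠ x) (t : S) : (idem z : PathAlgebra k V) • t = 0 := by
  obtain ⟨r, rfl⟩ := h.surjective t
  obtain ⟨c, -, -, hc⟩ := h.exists_smul_eq r
  change (idem z : PathAlgebra k V) • r • s = 0
  rw [hc, ← h.idem_smul, smul_smul, smul_smul, mul_smul_comm, mul_one, smul_mul_assoc,
    idem, ofPath_mul_idem_of_ne (p := QuiverPath.triv z) hz.symm, smul_zero, zero_smul]

/-- The standard projective resolution of a simple module. -/
theorem isSES : IsSES (mulArrows (k := k) x)
    (LinearMap.toSpanSingleton (PathAlgebra k V) S s ∘ₗ (vertexProjective x).subtype) := by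
  refine ⟨mulArrows_injective x, fun r => ⟨fun hr => ?_, ?_⟩, fun t => ?_⟩
  · obtain ⟨c, q, hq, hc⟩ := h.exists_smul_eq r.1
    have hr' : r.1 • s = 0 := hr
    rw [hr'] at hc
    refine ⟨q, ?_⟩
    rw [← mulIdem_apply_coe r, hq, h.smul_one_smul_eq_zero hc.symm, zero_smul, map_zero, zero_add]
  · rintro ⟨q, rfl⟩
    exact h.mulArrows_smul q
  · obtain ⟨r, rfl⟩ := h.surjective t
    refine ⟨mulIdem x r, ?_⟩
    change (r * idem x) • s = r • s
    rw [mul_smul, h.idem_smul]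

theorem pdLEOne : PdLEOne (PathAlgebra k V) S := by
  classical
  have : Module.Projective (PathAlgebra k V)
      (∀ a : Σ y, x ⟶ y, vertexProjective (k := k) a.1) :=
    .of_equiv (DFinsupp.linearEquivFunOnFintype (R := PathAlgebra k V)
      (M := fun a : Σ y, x ⟶ y => vertexProjective (k := k) a.1))
  exact h.isSES.pdLEOne_of_projective

theorem nonempty_equiv (h' : IsSimpleAt k x s') : Nonempty (S ≃ₗ[PathAlgebra k V] S') := by
  have hker : LinearMap.ker (LinearMap.toSpanSingleton (PathAlgebra k V) S s ∘ₗ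
      (vertexProjective x).subtype) = LinearMap.ker (LinearMap.toSpanSingleton (PathAlgebra k V)
      S' s' ∘ₗ (vertexProjective x).subtype) := by
    rw [LinearMap.exact_iff.1 h.isSES.exact, LinearMap.exact_iff.1 h'.isSES.exact]
  exact ⟨(LinearMap.quotKerEquivOfSurjective _ h.isSES.surj).symm.trans
    ((Submodule.quotEquivOfEq _ _ hker).trans
      (LinearMap.quotKerEquivOfSurjective _ h'.isSES.surj))⟩

omit h [∀ x y : V, Fintype (x ⟶ y)] in
theorem hom_ext {z : V} {f g : vertexProjective (k := k) z →ₗ[PathAlgebra k V] S}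
    (hfg : f (mulIdem z 1) = g (mulIdem z 1)) : f = g := by
  refine LinearMap.ext fun r => ?_
  have hr : r = r.1 • mulIdem z 1 := by
    rw [← map_smul, smul_eq_mul, mul_one, mulIdem_apply_coe]
  rw [hr, map_smul, map_smul, hfg]

omit h [∀ x y : V, Fintype (x ⟶ y)] in
theorem idem_smul_hom {z : V} (f : vertexProjective (k := k) z →ₗ[PathAlgebra k V] S) :
    (idem z : PathAlgebra k V) • f (mulIdem z 1) = f (mulIdem z 1) := by
  rw [← map_smul, ← map_smul, smul_eq_mul, mul_one]
  refine congrArg f (Subtype.ext ?_)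
  change idem z * idem z = 1 * idem z
  rw [idem_mul_idem, one_mul]

theorem homDim_of_ne {z : V} (hz : z ≠ x) :
    homDim (PathAlgebra k V) k (vertexProjective (k := k) z) S = 0 := by
  let : Module k S := Module.compHom S (algebraMap k (PathAlgebra k V))
  have : IsScalarTower k (PathAlgebra k V) S := IsScalarTower.of_algebraMap_smul fun _ _ => rfl
  have : SMulCommClass (PathAlgebra k V) k S := IsScalarTower.to_smulCommClass'
  have hsub : Subsingleton (vertexProjective (k := k) z →ₗ[PathAlgebra k V] S) :=
    ⟨fun f g => hom_ext <| by
      rw [← idem_smul_hom f, ← idem_smul_hom g, h.idem_smul_of_ne hz, h.idem_smul_of_ne hz]⟩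
  exact Module.finrank_zero_of_subsingleton (R := k)
    (M := vertexProjective (k := k) z →ₗ[PathAlgebra k V] S)

theorem homDim_self : homDim (PathAlgebra k V) k (vertexProjective (k := k) x) S = 1 := by
  let : Module k S := Module.compHom S (algebraMap k (PathAlgebra k V))
  have : IsScalarTower k (PathAlgebra k V) S := IsScalarTower.of_algebraMap_smul fun _ _ => rfl
  have : SMulCommClass (PathAlgebra k V) k S := IsScalarTower.to_smulCommClass'
  have h1 : (LinearMap.toSpanSingleton (PathAlgebra k V) S s ∘ₗ
      (vertexProjective x).subtype) (mulIdem x 1) = s := by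
    change (1 * idem x : PathAlgebra k V) • s = s
    rw [one_mul, h.idem_smul]
  refine (finrank_eq_one_iff' (K := k)
    (V := vertexProjective (k := k) x →ₗ[PathAlgebra k V] S)).2
    ⟨LinearMap.toSpanSingleton (PathAlgebra k V) S s ∘ₗ (vertexProjective x).subtype,
      fun h0 => ?_, fun f => ?_⟩
  · rw [h0] at h1
    exact h.ne_zero h1.symm
  · obtain ⟨r, hr⟩ := h.surjective (f (mulIdem x 1))
    obtain ⟨c, -, -, hc⟩ := h.exists_smul_eq r
    refine ⟨c, hom_ext ?_⟩
    rw [LinearMap.smul_apply, h1, ← hr]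
    change _ = r • s
    rw [hc, smul_assoc, one_smul]

end IsSimpleAt

end

variable (hV : QuiverAcyclic V) [∀ x y : V, Finite (x ⟶ y)]
include hV

theorem module_finite : Module.Finite k (PathAlgebra k V) := by
  have := hV.finite_quiverPath
  exact Module.Finite.of_basis pathBasis

theorem separatesSimples : SeparatesSimples k fun x : V =>
    (ModuleCat.of (PathAlgebra k V) (vertexProjective (k := k) x) : PathAlgebraMod k V) := by
  have : ∀ x y : V, Fintype (x ⟶ y) := fun x y => Fintype.ofFinite _
  refine ⟨fun x => inferInstanceAs (Module.Projective _ (vertexProjective (k := k) x)),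
    fun x => inferInstanceAs (Module.Finite _ (vertexProjective (k := k) x)),
    fun S hS => ?_, fun S S' hS hS' x hx hx' => ?_⟩
  · obtain ⟨x, s, h⟩ := exists_isSimpleAt (k := k) (S := S) hV
    exact ⟨x, h.homDim_self, fun y hy => h.homDim_of_ne hy⟩
  · obtain ⟨y, s, h⟩ := exists_isSimpleAt (k := k) (S := S) hV
    obtain ⟨y', s', h'⟩ := exists_isSimpleAt (k := k) (S := S') hV
    obtain rfl : x = y := by
      by_contra hxy
      exact hx (h.homDim_of_ne hxy)
    obtain rfl : x = y' := by
      by_contra hxy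
      exact hx' (h'.homDim_of_ne hxy)
    exact h.nonempty_equiv h'

theorem isHereditaryFG : IsHereditaryFG (PathAlgebra k V) := by
  have : ∀ x y : V, Fintype (x ⟶ y) := fun x y => Fintype.ofFinite _
  have := module_finite (k := k) hV
  have : IsArtinianRing (PathAlgebra k V) := IsArtinianRing.of_finite k _
  refine isHereditaryFG_of_isSimpleModule fun S hS => ?_
  obtain ⟨x, s, h⟩ := exists_isSimpleAt (k := k) (S := S) hV
  exact h.pdLEOne

end PathAlgebra

/-! ### Torsion classes and support tilting modules -/

section Correspondence

attribute [local instance] Abelian.hasFiniteBiproducts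

theorem IsSumOfRepresentatives.nonempty_iso {C : Type u} [Category.{v} C] [Abelian C]
    {P : ObjectProperty C} {X X' : C} (h : IsSumOfRepresentatives P X)
    (h' : IsSumOfRepresentatives P X') : Nonempty (X ≅ X') := by
  obtain ⟨n, Y, hP, hY, hs, ⟨e⟩⟩ := h
  obtain ⟨n', Y', hP', hY', hs', ⟨e'⟩⟩ := h'
  choose σ hσ using fun i => hs' (Y i) (hP i)
  choose τ hτ using fun i => hs (Y' i) (hP' i)
  let φ : Fin n ≃ Fin n' :=
    { toFun := σ
      invFun := τ
      left_inv := fun i => (hY _ _ ⟨(hσ i).some ≪≫ (hτ (σ i)).some⟩).symm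
      right_inv := fun i => (hY' _ _ ⟨(hτ i).some ≪≫ (hσ (τ i)).some⟩).symm }
  exact ⟨e ≪≫ biproduct.whiskerEquiv φ (fun i => (hσ i).some.symm) ≪≫ e'.symm⟩

variable {R : Type t} [Ring R]

theorem gen_eq_of_equiv {M M' : ModuleCat.{t} R} (e : M ≃ₗ[R] M') : Gen M = Gen M' := by
  refine funext fun X => propext ?_
  rw [gen_iff, gen_iff]
  exact ⟨fun h => h.trans (IsRetract.of_equiv e).isAdd.isGen,
    fun h => h.trans (IsRetract.of_equiv e.symm).isAdd.isGen⟩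

theorem isExtProjective_gen_iff {M X : ModuleCat.{t} R} :
    IsExtProjective (Gen M) X ↔ IsGenExtProjective R M X :=
  and_congr gen_iff (forall_congr' fun _ => imp_congr_left gen_iff)

theorem IsBasic.exists_basicFamily {M : ModuleCat.{t} R} (hM : IsBasic M) :
    ∃ (n : ℕ) (Y : Fin n → ModuleCat.{t} R), IsBasicFamily Y ∧ Nonempty (M ≅ ⨁ Y) := by
  obtain ⟨n, Y, hY, hY', hM⟩ := hM
  exact ⟨n, Y, ⟨fun i => indecomposable_iff.1 (hY i),
    fun i j h => hY' i j (nonempty_iso_iff.2 h)⟩, hM⟩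

theorem IsBasicFamily.isBasic {n : ℕ} {Y : Fin n → ModuleCat.{t} R} (hY : IsBasicFamily Y) :
    IsBasic (ModuleCat.of R (∀ i, Y i)) :=
  ⟨n, Y, fun i => indecomposable_iff.2 (hY.indec i),
    fun i j h => hY.eq_of_equiv i j (nonempty_iso_iff.1 h), ⟨(ModuleCat.biproductIsoPi Y).symm⟩⟩

theorem isFinGenTorsion_gen [IsArtinianRing R] {M : ModuleCat.{t} R} [Module.Finite R M]
    (hM : IsGenExtProjective R M M) : IsFinGenTorsion (Gen M) where
  finite X hX := (gen_iff.1 hX).finite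
  zero X _ := gen_iff.2 IsAdd.of_subsingleton.isGen
  quotients X Y hX f hf := gen_iff.2 ((gen_iff.1 hX).of_surjective hf)
  extensions X Y Z f g h hX hZ := gen_iff.2 <|
    IsGen.of_isSES h (hM.2 X (gen_iff.1 hX)) (gen_iff.1 hX) (gen_iff.1 hZ)
  generators := by
    obtain ⟨n, Y, hY, hr, ha⟩ := exists_basicFamily M
    exact ⟨n, Y, hY.indec, fun i => gen_iff.2 (hr i).isAdd.isGen,
      fun Z hZ => (gen_iff.1 hZ).trans ha.isGen⟩

/-- A basic support tilting module `M` is the sum of the indecomposable `Ext`-projectives of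
`Gen M`. -/
theorem HasTiltingSequence.isSumOfExtProjectives (k : Type w) [Field k] [Algebra k R]
    [Module.Finite k R] {M : ModuleCat.{t} R} [Module.Finite R M] (hM : IsGenExtProjective R M M)
    (hs : HasTiltingSequence R M) (hb : IsBasic M) : IsSumOfExtProjectives (Gen M) M := by
  have : IsArtinianRing R := IsArtinianRing.of_finite k R
  obtain ⟨n, Y, hY, ⟨e⟩⟩ := hb.exists_basicFamily
  have φ : M ≃ₗ[R] (∀ i, Y i) := e.toLinearEquiv.trans (biproductEquivPi Y)
  refine ⟨n, Y, fun i => ⟨indecomposable_iff.2 (hY.indec i), isExtProjective_gen_iff.2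
    (hM.of_isAdd ((IsRetract.single i).trans (.of_equiv φ.symm)).isAdd)⟩,
    fun i j h => hY.eq_of_equiv i j (nonempty_iso_iff.1 h), fun Z hZ => ?_, ⟨e⟩⟩
  have hZ' := isExtProjective_gen_iff.1 hZ.2
  have := hZ'.1.finite
  obtain ⟨i, hi⟩ := hY.exists_equiv (indecomposable_iff.1 hZ.1)
    ((hs.isAdd_of_isGenExtProjective k (hM.2 M hM.1) hZ').trans (IsRetract.of_equiv φ).isAdd)
  exact ⟨i, nonempty_iso_iff.2 hi⟩

end Correspondence

section Rep

variable {k : Type w} [Field k] {V : Type u} [Quiver.{v} V] [Fintype V]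
  [∀ x y : V, Finite (x ⟶ y)] (hV : QuiverAcyclic V)
include hV

theorem repQ_iff {M : PathAlgebraMod k V} : repQ k V M ↔ Module.Finite (PathAlgebra k V) M := by
  have := PathAlgebra.module_finite (k := k) hV
  let : Module k M := ModuleCat.moduleOfAlgebraModule M
  have : IsScalarTower k (PathAlgebra k V) M := ModuleCat.isScalarTower_of_algebra_moduleCat M
  exact ⟨fun (_ : Module.Finite k M) => Module.Finite.of_restrictScalars_finite k _ M,
    fun _ => Module.Finite.trans (PathAlgebra k V) M⟩

theorem isFinGenTorsion_iff {T : ObjectProperty (PathAlgebraMod k V)} :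
    IsTorsionClass T ∧ IsFinitelyGenerated T ↔ IsFinGenTorsion T := by
  constructor
  · rintro ⟨hT, n, X, hX, hXT, hgen⟩
    have := hT.containsZero
    have := hT.quotients
    have := hT.extensions
    refine ⟨fun X hX => (repQ_iff hV).1 (hT.le_repQ X hX), fun X _ => ?_, fun X Y hX f hf => ?_,
      fun X Y Z f g h hX hZ => ?_, n, X, fun i => indecomposable_iff.1 (hX i), hXT, fun Z hZ => ?_⟩
    · obtain ⟨Z, hZ, hZT⟩ := T.exists_prop_of_containsZero
      have : Epi (0 : Z ⟶ X) := (ModuleCat.epi_iff_surjective _).2 fun x =>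
        ⟨0, Subsingleton.elim _ _⟩
      exact T.prop_of_epi (0 : Z ⟶ X) hZT
    · have : Epi (ModuleCat.ofHom f) := (ModuleCat.epi_iff_surjective _).2 hf
      exact T.prop_of_epi (ModuleCat.ofHom f) hX
    · exact T.prop_X₂_of_shortExact h.shortExact hX hZ
    · exact (gen_iff.1 (hgen Z hZ)).trans (IsRetract.of_equiv (biproductEquivPi X)).isAdd.isGen
  · intro hT
    obtain ⟨n, X, hX, hXT, hgen⟩ := hT.generators
    refine ⟨⟨fun X hX => (repQ_iff hV).2 (hT.finite X hX),
      ⟨ModuleCat.of _ PUnit, ModuleCat.isZero_of_subsingleton _, hT.zero _ inferInstance⟩,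
      ⟨fun f _ hX => hT.quotients _ _ hX f.hom ((ModuleCat.epi_iff_surjective f).1 ‹_›)⟩,
      ⟨fun hS h₁ h₃ => hT.extensions _ _ _ _ _ (IsSES.of_shortExact hS) h₁ h₃⟩⟩,
      n, X, fun i => indecomposable_iff.2 (hX i), hXT, fun Z hZ => gen_iff.2 ?_⟩
    exact (hgen Z hZ).trans (IsRetract.of_equiv (biproductEquivPi X).symm).isAdd.isGen

theorem isSupportTilting_iff {M : PathAlgebraMod k V} : IsSupportTilting M ↔
    Module.Finite (PathAlgebra k V) M ∧ ExtZero (PathAlgebra k V) M M ∧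
      HasTiltingSequence (PathAlgebra k V) M := by
  have := PathAlgebra.module_finite (k := k) hV
  have hR := PathAlgebra.isHereditaryFG (k := k) hV
  constructor
  · rintro ⟨⟨hM, hE, -⟩, ht⟩
    have hfin := (repQ_iff hV).1 hM
    exact ⟨hfin, hE, (isTiltingModule_iff_hasTiltingSequence k hR M hE).1 ht⟩
  · rintro ⟨hfin, hE, ht⟩
    exact ⟨⟨(repQ_iff hV).2 hfin, hE, hR M hfin⟩,
      (isTiltingModule_iff_hasTiltingSequence k hR M hE).2 ht⟩

theorem IsSupportTilting.isGenExtProjective {M : PathAlgebraMod k V} (hM : IsSupportTilting M) :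
    IsGenExtProjective (PathAlgebra k V) M M := by
  obtain ⟨hfin, hE, -⟩ := (isSupportTilting_iff hV).1 hM
  exact .self (PathAlgebra.isHereditaryFG hV M hfin) hE

theorem BasicSupportTilting.isSumOfExtProjectives (M : BasicSupportTilting k V) :
    IsSumOfExtProjectives (Gen M.1) M.1 := by
  have := PathAlgebra.module_finite (k := k) hV
  obtain ⟨hfin, -, hs⟩ := (isSupportTilting_iff hV).1 M.2.1
  exact hs.isSumOfExtProjectives k (M.2.1.isGenExtProjective hV) M.2.2

/-- The torsion class generated by a basic support tilting module. -/
def BasicSupportTilting.gen (M : BasicSupportTilting k V) : FGTorsionClass k V :=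
  ⟨Gen M.1, (isFinGenTorsion_iff hV).2 <| by
    have := PathAlgebra.module_finite (k := k) hV
    have : IsArtinianRing (PathAlgebra k V) := IsArtinianRing.of_finite k _
    have := ((isSupportTilting_iff hV).1 M.2.1).1
    exact isFinGenTorsion_gen (M.2.1.isGenExtProjective hV)⟩

theorem BasicSupportTilting.exists_gen_eq (T : FGTorsionClass k V) :
    ∃ M : BasicSupportTilting k V, M.gen hV = T := by
  have := PathAlgebra.module_finite (k := k) hV
  have hT := (isFinGenTorsion_iff hV).1 T.2
  obtain ⟨n, Y, hY, hg, hE, hs⟩ := hT.exists_supportTilting k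
  have hfin : Module.Finite (PathAlgebra k V) (ModuleCat.of (PathAlgebra k V) (∀ i, Y i)) :=
    hT.finite _ ((hg _).2 IsAdd.refl.isGen)
  refine ⟨⟨ModuleCat.of _ (∀ i, Y i), (isSupportTilting_iff hV).2 ⟨hfin, hE, hs⟩, hY.isBasic⟩,
    Subtype.ext (funext fun Z => propext (gen_iff.trans (hg Z).symm))⟩

theorem BasicSupportTilting.gen_eq_iff (M M' : BasicSupportTilting k V) :
    M.gen hV = M'.gen hV ↔ Nonempty (M.1 ≅ M'.1) := by
  refine ⟨fun h => ?_, fun h => ?_⟩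
  · have h' : Gen M.1 = Gen M'.1 := congrArg Subtype.val h
    have hM := M.isSumOfExtProjectives hV
    rw [h'] at hM
    exact hM.nonempty_iso (M'.isSumOfExtProjectives hV)
  · obtain ⟨e⟩ := nonempty_iso_iff.1 h
    exact Subtype.ext (gen_eq_of_equiv e)

end Rep

theorem mainTheorem10 {k : Type w} [Field k] [IsAlgClosed k] {V : Type u} [Quiver.{v} V]
    [Fintype V] [∀ x y : V, Finite (x ⟶ y)] (hV : QuiverAcyclic V) :
    (∀ M : PathAlgebraMod k V, IsPartialTilting M →
      (IsTiltingModule (overAnnihilatorQuotient M) ↔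
        (indecomposableSummands M).encard = (simpleSupport M).encard)) ∧
    ∃ e : FGTorsionClass k V ≃ Quotient (basicSupportTiltingSetoid k V),
      (∀ (T : FGTorsionClass k V) (M : BasicSupportTilting k V),
        e T = Quotient.mk _ M ↔ IsSumOfExtProjectives T.1 M.1) ∧
      (∀ M : BasicSupportTilting k V, (e.symm (Quotient.mk _ M)).1 = Gen M.1) := by
  have := PathAlgebra.module_finite (k := k) hV
  have hR := PathAlgebra.isHereditaryFG (k := k) hV
  constructor
  · rintro M ⟨hM, hE, -⟩
    have := (repQ_iff hV).1 hM
    exact (isTiltingModule_iff_hasTiltingSequence k hR M hE).trans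
      ((PathAlgebra.separatesSimples hV).hasTiltingSequence_iff hR M hE)
  · let Φ : Quotient (basicSupportTiltingSetoid k V) → FGTorsionClass k V :=
      Quotient.lift (fun M => M.gen hV) fun M M' h => (M.gen_eq_iff hV M').2 h
    have hΦ : Function.Bijective Φ := by
      refine ⟨fun q q' => Quotient.inductionOn₂ q q' fun M M' h =>
        Quotient.sound ((M.gen_eq_iff hV M').1 h), fun T => ?_⟩
      obtain ⟨M, hM⟩ := BasicSupportTilting.exists_gen_eq hV T
      exact ⟨Quotient.mk _ M, hM⟩
    refine ⟨(Equiv.ofBijective Φ hΦ).symm, fun T M => ?_, fun M => rfl⟩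
    rw [Equiv.symm_apply_eq]
    change T = M.gen hV ↔ _
    refine ⟨fun h => h ▸ M.isSumOfExtProjectives hV, fun h => ?_⟩
    obtain ⟨M', rfl⟩ := BasicSupportTilting.exists_gen_eq hV T
    exact (M'.gen_eq_iff hV M).2 ((M'.isSumOfExtProjectives hV).nonempty_iso h)

end
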